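/- **Setting.** Fix integers $d\ge 1$, $b\ge 0$, $s$ and $p$, a symmetric *positive definite* matrix $S\in\mathbb R^{b\times b}$, and constants $\gamma$, $g_0>0$, $\Lambda$, $0\le c_0<c_{\max}$. Let $\mathcal T$ be a conforming simplicial mesh in $\mathbb R^d$ (possibly the periodic lift of a mesh of a torus) such that each element $K$ contains a ball of some radius $\rho_K>0$ with $\operatorname{diam}K\le\gamma\rho_K$, and let $h=\max_{K\in\mathcal T}\operatorname{diam}K$. Let $\mathrm v$ be a vertex in the interior of its patch $\Omega^{\mathrm v}$, the union of the (finitely many) elements containing $\mathrm v$. On each element of the patch let $\mathcal G$ and $\mathcal L^{(1)},\dots,\mathcal L^{(d)}$ be constant symmetric $b\times b$ matrices with entries bounded by $\Lambda$, with $\mathcal G\ge g_0 I$, with $|\lambda|\le c_0$ whenever $\sum_j n_j\mathcal L^{(j)}w=\lambda\,\mathcal G w$ for some $w\ne0$ and some unit vector $n$, and with $\sum_j\partial_j\mathcal L^{(j)}=0$ in the sense of distributions in the interior of $\Omega^{\mathrm v}$. Write $g(u)=\mathcal Gu$ and $[f(u)]_{lj}=[\mathcal L^{(j)}u]_l$ (the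 hyperbolic system is $\partial_t g(u)+\operatorname{div}f(u)=0$). Let $\varphi_{\rm bot},\varphi_{\rm top}$ be continuous functions on $\Omega^{\mathrm v}$, affine on each element, equal at all vertices other than $\mathrm v$, with $\varphi_{\rm bot}(\mathrm v)\le\varphi_{\rm top}(\mathrm v)$ and gradients of norm $<1/c_{\max}$. Put $\delta=\varphi_{\rm top}-\varphi_{\rm bot}$. Let $V_h$ be the space of $\mathbb R^b$-valued functions on $\Omega^{\mathrm v}$ that are polynomials of degree $\le p$ on each element, with the $L^2$ inner product $(\cdot,\cdot)$. For each facet of the patch let $\nu$ be a unit normal, $[\![v]\!]=v^+-v^-$ and $\{v\}=\frac12(v^++v^-)$, where $v^\pm(x)=\lim_{\varepsilon\to0^+}v(x\pm\varepsilon\nu)$, and $\mathcal D=\sum_j\nu_j\mathcal L^{(j)}$. Define $M_0,M_1,A:V_h\to V_h$ by requiring, for all $u,v\in V_h$, $$(M_0u,v)=(g(u)-f(u)\nabla\varphi_{\rm bot},v),\qquad (M_1u,v)=(f(u)\nabla\delta,v),$$ $$(Au,v)=\sum_{K}\int_K\delta f(u):\nabla v\,dx+\sum_F\int_F\delta\,\bigl(\mathcal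 D\{u\}-S[\![u]\!]\bigr)\cdot[\![v]\!].$$ Let $M(\hat t)=M_0-\hat tM_1$ and $\|v\|_B=\sqrt{(Bv,v)}$. For an integer $r\ge1$ let $\tau=1/r$, and for $l=1,\dots,r$ let $M_0^{[l]}=M_0-(l-1)\tau M_1$, $M^{[l]}=M_0^{[l]}-\tau M_1$, $X_0^{[l]}=I$, $X_i^{[l]}=\tau(M_0^{[l]})^{-1}(A+iM_1)X_{i-1}^{[l]}$ for $i\ge1$, $$R_{[l],s}=\sum_{k=0}^{s-1}\frac1{k!}X_k^{[l]}+\frac1{s!}(M^{[l]})^{-1}M_0^{[l]}X_s^{[l]},\qquad R_{r,s}=R_{[r],s}\circ\cdots\circ R_{[1],s}.$$ **Theorem.** Suppose $0<p\le(s-1)/2$. 1. There are constants $c,C>0$, depending only on $d,b,s,p,S,\gamma,g_0,\Lambda,c_0,c_{\max}$, such that for every mesh, vertex, coefficients and tent as above and every $r\ge1$: if $\tau=1/r\le c\,h^{1/(2s-2p)}$, then $$\|R_{r,s}v\|_{M(1)}\le(1+Ch)\,\|v\|_{M_0}\qquad\text{for all }v\in V_h.$$ 2. Consequently the SAT-DG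 method is weakly stable under the $(1+1/(2s-2p))$-CFL condition. That is, for every $\theta>0$ there are $c,C>0$, depending only on $\theta$ and the quantities listed in 1, such that for all data as above for which every element $K$ of the patch has $\operatorname{diam}K\ge\theta h$, and every $r\ge1$: if the physical time step $\Delta t=\tau\delta$ satisfies $\tau\,\delta(x)\le c\,h^{1+1/(2s-2p)}$ for all $x\in\Omega^{\mathrm v}$, then $\|R_{r,s}v\|_{M(1)}\le(1+Ch)\|v\|_{M_0}$ for all $v\in V_h$. -/

import Mathlib

open MeasureTheory
open scoped Matrix ContDiff

noncomputable section

namespace TentDG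

/-- The physical space `ℝ^d` with its Euclidean structure. -/
abbrev Space (d : ℕ) : Type := EuclideanSpace ℝ (Fin d)

/-- The closed simplex spanned by a finite set of points. -/
abbrev hull {d : ℕ} (K : Finset (Space d)) : Set (Space d) := convexHull ℝ (K : Set (Space d))

/-- The elements of a conforming simplicial mesh (a simplicial complex in `ℝ^d`): its
`d`-dimensional simplices, each given by its set of `d + 1` vertices. -/
def elements {d : ℕ} (T : Geometry.SimplicialComplex ℝ (Space d)) : Set (Finset (Space d)) :=
  {K | K ∈ T.faces ∧ K.card = d + 1}

/-- Shape regularity with constant `γ`: every element contains a ball of radius at least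
`diam K / γ`. -/
def ShapeRegular {d : ℕ} (T : Geometry.SimplicialComplex ℝ (Space d)) (γ : ℝ) : Prop :=
  ∀ K ∈ elements T, ∃ (x : Space d) (ρ : ℝ), 0 < ρ ∧ Metric.closedBall x ρ ⊆ hull K ∧
    Metric.diam (hull K) ≤ γ * ρ

/-- `h` is the mesh size: the maximal diameter of the elements. -/
def IsMeshSize {d : ℕ} (T : Geometry.SimplicialComplex ℝ (Space d)) (h : ℝ) : Prop :=
  IsGreatest ((fun K => Metric.diam (hull K)) '' elements T) h

/-- A mesh together with an interior vertex, whose vertex patch is the union of the (finitely many)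
elements containing it. The mesh itself may be infinite, so that a periodic mesh can be
represented by its lift to `ℝ^d`. -/
structure VertexPatch (d : ℕ) where
  /-- the mesh -/
  mesh : Geometry.SimplicialComplex ℝ (Space d)
  /-- the vertex at which the tent is erected -/
  vertex : Space d
  finite_star : {K | K ∈ elements mesh ∧ vertex ∈ K}.Finite
  vertex_interior : vertex ∈ interior (⋃ K ∈ {K | K ∈ elements mesh ∧ vertex ∈ K}, hull K)

namespace VertexPatch

variable {d : ℕ}

/-- The elements of the vertex patch. -/
def elems (P : VertexPatch d) : Finset (Finset (Space d)) := P.finite_star.toFinset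

/-- The vertex patch `Ω^v` as a subset of `ℝ^d`. -/
def carrier (P : VertexPatch d) : Set (Space d) := ⋃ K ∈ P.elems, hull K

/-- All facets (`(d-1)`-dimensional faces) of the elements of the patch. -/
def facets (P : VertexPatch d) : Finset (Finset (Space d)) :=
  P.elems.biUnion fun K => K.powersetCard d

theorem mem_elems {P : VertexPatch d} {K : Finset (Space d)} :
    K ∈ P.elems ↔ K ∈ elements P.mesh ∧ P.vertex ∈ K := by
  simp [elems]

theorem mem_facets {P : VertexPatch d} {F : Finset (Space d)} :
    F ∈ P.facets ↔ ∃ K ∈ P.elems, F ⊆ K ∧ F.card = d := by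
  simp [facets, Finset.mem_powersetCard]

end VertexPatch

variable {d b p : ℕ}

/-- `ν` assigns to each facet of the patch a unit normal vector (of arbitrary direction). -/
def IsNormalField (P : VertexPatch d) (ν : P.facets → Space d) : Prop :=
  ∀ F : P.facets, ‖ν F‖ = 1 ∧ ∀ x ∈ F.1, ∀ y ∈ F.1, inner ℝ (ν F) (y - x) = 0

/-- The coefficients `𝒢` and `ℒ⁽¹⁾, …, ℒ⁽ᵈ⁾` of the system on the patch; they are constant on
each element, hence given by one matrix per element. -/
structure Coefficients (P : VertexPatch d) (b : ℕ) where
  /-- the matrix `𝒢` on each element -/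
  G : P.elems → Matrix (Fin b) (Fin b) ℝ
  /-- the matrices `ℒ⁽ʲ⁾` on each element -/
  L : P.elems → Fin d → Matrix (Fin b) (Fin b) ℝ

namespace Coefficients

variable {P : VertexPatch d}

/-- The matrix `∑ⱼ nⱼ ℒ⁽ʲ⁾`, so that `f(u) n = (∑ⱼ nⱼ ℒ⁽ʲ⁾) u`. -/
def dir (c : Coefficients P b) (K : P.elems) (n : Space d) : Matrix (Fin b) (Fin b) ℝ :=
  ∑ j, n j • c.L K j

/-- The assumptions on the coefficients: symmetric; bounded (by `Λ`); `𝒢 ≥ g₀`; all hyperbolic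
wave speeds are at most `c₀`; and `∑ⱼ ∂ⱼ ℒ⁽ʲ⁾ = 0` in the sense of distributions. -/
structure Admissible (c : Coefficients P b) (g₀ Λ c₀ : ℝ) : Prop where
  G_symm : ∀ K, (c.G K).IsSymm
  L_symm : ∀ K j, (c.L K j).IsSymm
  G_bound : ∀ K l k, |c.G K l k| ≤ Λ
  L_bound : ∀ K j l k, |c.L K j l k| ≤ Λ
  G_pos : ∀ K (w : Fin b → ℝ), g₀ * (w ⬝ᵥ w) ≤ w ⬝ᵥ (c.G K *ᵥ w)
  speed : ∀ K (n : Space d), ‖n‖ = 1 → ∀ (lam : ℝ) (w : Fin b → ℝ), w ≠ 0 →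
    c.dir K n *ᵥ w = lam • (c.G K *ᵥ w) → |lam| ≤ c₀
  div_free : ∀ ψ : Space d → ℝ, ContDiff ℝ ∞ ψ → HasCompactSupport ψ →
    tsupport ψ ⊆ interior P.carrier →
    ∑ K : P.elems, ∑ j : Fin d,
      (∫ x in hull K.1, fderiv ℝ ψ x (EuclideanSpace.single j 1)) • c.L K j = 0

end Coefficients

/-- A continuous piecewise linear function on the patch (the restriction of an advancing front).
The field `grad` is determined by the function: it is its gradient on each element. -/
structure Front (P : VertexPatch d) where
  /-- the function -/
  toFun : Space d → ℝ
  /-- its constant gradient on each element -/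
  grad : P.elems → Space d
  linear_on : ∀ K : P.elems, ∀ x ∈ hull K.1, ∀ y ∈ hull K.1,
    toFun y - toFun x = inner ℝ (grad K) (y - x)

/-- A tent over the patch: a bottom and a top front which agree at all vertices of the patch
other than the central one. -/
structure Tent (P : VertexPatch d) where
  /-- the bottom `φ_bot` -/
  bot : Front P
  /-- the top `φ_top` -/
  top : Front P
  bot_le_top : bot.toFun P.vertex ≤ top.toFun P.vertex
  eq_off_pole : ∀ K ∈ P.elems, ∀ w ∈ K, w ≠ P.vertex → top.toFun w = bot.toFun w

namespace Tent

variable {P : VertexPatch d}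

/-- `δ = φ_top - φ_bot`. -/
def δ (t : Tent P) (x : Space d) : ℝ := t.top.toFun x - t.bot.toFun x

/-- The gradient of `δ` on each element. -/
def gradδ (t : Tent P) (K : P.elems) : Space d := t.top.grad K - t.bot.grad K

/-- The causality condition `‖grad φ‖ < 1 / c_max` for both fronts. -/
def Causal (t : Tent P) (cmax : ℝ) : Prop :=
  ∀ K : P.elems, ‖t.bot.grad K‖ < 1 / cmax ∧ ‖t.top.grad K‖ < 1 / cmax

end Tent

/-- The DG space `V_h`: on each element of the patch, `b` polynomials of total degree `≤ p`. -/
abbrev DGSpace (P : VertexPatch d) (b p : ℕ) : Type :=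
  P.elems → Fin b → MvPolynomial.restrictTotalDegree (Fin d) ℝ p

section Forms

variable {P : VertexPatch d}

/-- The value at `x` of (the polynomial extension of) `v` restricted to the element `K`. -/
def val (v : DGSpace P b p) (K : P.elems) (x : Space d) : Fin b → ℝ :=
  fun l => MvPolynomial.eval (fun i => x i) (v K l : MvPolynomial (Fin d) ℝ)

/-- The partial derivative `∂ⱼ v` at `x`, on the element `K`. -/
def pdv (v : DGSpace P b p) (K : P.elems) (j : Fin d) (x : Space d) : Fin b → ℝ :=
  fun l => MvPolynomial.eval (fun i => x i)
    (MvPolynomial.pderiv j (v K l : MvPolynomial (Fin d) ℝ))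

open Classical in
/-- The element of the patch adjacent to the facet `F` on the side to which `ν` points
(no element, if that side of `F` lies outside the patch). -/
def plusElems (ν : P.facets → Space d) (F : P.facets) : Finset P.elems :=
  Finset.univ.filter fun K => F.1 ⊆ K.1 ∧ ∀ x ∈ F.1, ∀ y ∈ K.1, 0 ≤ inner ℝ (ν F) (y - x)

open Classical in
/-- The element of the patch adjacent to the facet `F` on the side from which `ν` points away
(no element, if that side of `F` lies outside the patch). -/
def minusElems (ν : P.facets → Space d) (F : P.facets) : Finset P.elems :=
  Finset.univ.filter fun K => F.1 ⊆ K.1 ∧ ∀ x ∈ F.1, ∀ y ∈ K.1, inner ℝ (ν F) (y - x) ≤ 0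

/-- The one-sided limit `v(x + εν)`, `ε → 0+`, at a point of the facet `F` (zero outside the
patch; this convention is immaterial, since `δ` vanishes on the boundary of the patch). -/
def tracePlus (ν : P.facets → Space d) (v : DGSpace P b p) (F : P.facets) (x : Space d) :
    Fin b → ℝ :=
  ∑ K ∈ plusElems ν F, val v K x

/-- The one-sided limit `v(x - εν)`, `ε → 0+`, at a point of the facet `F`. -/
def traceMinus (ν : P.facets → Space d) (v : DGSpace P b p) (F : P.facets) (x : Space d) :
    Fin b → ℝ :=
  ∑ K ∈ minusElems ν F, val v K x

/-- The jump across a facet. -/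
def jump (ν : P.facets → Space d) (v : DGSpace P b p) (F : P.facets) (x : Space d) : Fin b → ℝ :=
  tracePlus ν v F x - traceMinus ν v F x

/-- The average on a facet. -/
def avg (ν : P.facets → Space d) (v : DGSpace P b p) (F : P.facets) (x : Space d) : Fin b → ℝ :=
  (1 / 2 : ℝ) • (tracePlus ν v F x + traceMinus ν v F x)

/-- The matrix `𝒟 = ∑ⱼ νⱼ ℒ⁽ʲ⁾` on a facet. It is single-valued on the facets inside the patch
because `∑ⱼ ∂ⱼ ℒ⁽ʲ⁾ = 0`, so it may be taken from the side to which `ν` points. -/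
def facetMatrix (c : Coefficients P b) (ν : P.facets → Space d) (F : P.facets) :
    Matrix (Fin b) (Fin b) ℝ :=
  ∑ K ∈ plusElems ν F, c.dir K (ν F)

/-- The numerical flux `𝒟{u} - S⟦u⟧`. -/
def numFlux (c : Coefficients P b) (ν : P.facets → Space d) (S : Matrix (Fin b) (Fin b) ℝ)
    (u : DGSpace P b p) (F : P.facets) (x : Space d) : Fin b → ℝ :=
  facetMatrix c ν F *ᵥ avg ν u F x - S *ᵥ jump ν u F x

/-- The weighted `L²` form `∑_K ∫_K (W_K u) · v dx`. -/
def massFun (W : P.elems → Matrix (Fin b) (Fin b) ℝ) (u v : DGSpace P b p) : ℝ :=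
  ∑ K : P.elems, ∫ x in hull K.1, (W K *ᵥ val u K x) ⬝ᵥ val v K x

/-- The DG form `(δ f(u), grad v) + (δ F̂, ⟦v⟧)`, where the facet integrals are with respect to
surface measure. -/
def dgFun (c : Coefficients P b) (t : Tent P) (ν : P.facets → Space d)
    (S : Matrix (Fin b) (Fin b) ℝ) (u v : DGSpace P b p) : ℝ :=
  (∑ K : P.elems, ∫ x in hull K.1, t.δ x * ∑ j : Fin d, (c.L K j *ᵥ val u K x) ⬝ᵥ pdv v K j x) +
  ∑ F : P.facets, ∫ x in hull F.1, t.δ x * (numFlux c ν S u F x ⬝ᵥ jump ν v F x)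
    ∂(Measure.euclideanHausdorffMeasure (d - 1))

/-! ### Bilinearity of the forms and nondegeneracy of the `L²` inner product -/

theorem val_add (u v : DGSpace P b p) (K : P.elems) (x : Space d) :
    val (u + v) K x = val u K x + val v K x := by
  ext l; simp [val]

theorem val_smul (a : ℝ) (u : DGSpace P b p) (K : P.elems) (x : Space d) :
    val (a • u) K x = a • val u K x := by
  ext l; simp [val, MvPolynomial.smul_eval]

theorem pdv_add (u v : DGSpace P b p) (K : P.elems) (j : Fin d) (x : Space d) :
    pdv (u + v) K j x = pdv u K j x + pdv v K j x := by
  ext l; simp [pdv]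

theorem pdv_smul (a : ℝ) (u : DGSpace P b p) (K : P.elems) (j : Fin d) (x : Space d) :
    pdv (a • u) K j x = a • pdv u K j x := by
  ext l; simp [pdv, MvPolynomial.smul_eval]

theorem continuous_val (v : DGSpace P b p) (K : P.elems) : Continuous (val v K) := by
  refine continuous_pi fun l => ?_
  exact (MvPolynomial.continuous_eval _).comp (by fun_prop)

theorem continuous_pdv (v : DGSpace P b p) (K : P.elems) (j : Fin d) :
    Continuous (pdv v K j) := by
  refine continuous_pi fun l => ?_
  exact (MvPolynomial.continuous_eval _).comp (by fun_prop)

theorem jump_add (ν : P.facets → Space d) (u v : DGSpace P b p) (F : P.facets) (x : Space d) :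
    jump ν (u + v) F x = jump ν u F x + jump ν v F x := by
  simp only [jump, tracePlus, traceMinus, val_add, Finset.sum_add_distrib]; abel

theorem jump_smul (ν : P.facets → Space d) (a : ℝ) (u : DGSpace P b p) (F : P.facets)
    (x : Space d) : jump ν (a • u) F x = a • jump ν u F x := by
  simp only [jump, tracePlus, traceMinus, val_smul, ← Finset.smul_sum, smul_sub]

theorem numFlux_add (c : Coefficients P b) (ν : P.facets → Space d)
    (S : Matrix (Fin b) (Fin b) ℝ) (u v : DGSpace P b p) (F : P.facets) (x : Space d) :
    numFlux c ν S (u + v) F x = numFlux c ν S u F x + numFlux c ν S v F x := by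
  have h : avg ν (u + v) F x = avg ν u F x + avg ν v F x := by
    simp only [avg, tracePlus, traceMinus, val_add, Finset.sum_add_distrib, ← smul_add]
    congr 1; abel
  simp only [numFlux, h, jump_add, Matrix.mulVec_add]; abel

theorem numFlux_smul (c : Coefficients P b) (ν : P.facets → Space d)
    (S : Matrix (Fin b) (Fin b) ℝ) (a : ℝ) (u : DGSpace P b p) (F : P.facets) (x : Space d) :
    numFlux c ν S (a • u) F x = a • numFlux c ν S u F x := by
  have h : avg ν (a • u) F x = a • avg ν u F x := by
    simp only [avg, tracePlus, traceMinus, val_smul, ← Finset.smul_sum, ← smul_add]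
    rw [smul_comm]
  simp only [numFlux, h, jump_smul, Matrix.mulVec_smul, smul_sub]

theorem continuous_jump (ν : P.facets → Space d) (v : DGSpace P b p) (F : P.facets) :
    Continuous (jump ν v F) := by
  unfold jump tracePlus traceMinus
  exact (continuous_finsetSum _ fun K _ => continuous_val v K).sub
    (continuous_finsetSum _ fun K _ => continuous_val v K)

theorem continuous_numFlux (c : Coefficients P b) (ν : P.facets → Space d)
    (S : Matrix (Fin b) (Fin b) ℝ) (u : DGSpace P b p) (F : P.facets) :
    Continuous (numFlux c ν S u F) := by
  have h : Continuous (avg ν u F) := by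
    have h1 : Continuous fun x => tracePlus ν u F x + traceMinus ν u F x :=
      (continuous_finsetSum _ fun K _ => continuous_val u K).add
        (continuous_finsetSum _ fun K _ => continuous_val u K)
    exact h1.const_smul (1 / 2 : ℝ)
  exact (continuous_const.matrix_mulVec h).sub
    (continuous_const.matrix_mulVec (continuous_jump ν u F))

theorem isCompact_hull (K : Finset (Space d)) : IsCompact (hull K) :=
  K.finite_toSet.isCompact_convexHull ℝ

theorem Front.continuousOn (φ : Front P) (K : P.elems) : ContinuousOn φ.toFun (hull K.1) := by
  intro x hx
  have h : ContinuousOn (fun y => φ.toFun x + inner ℝ (φ.grad K) (y - x)) (hull K.1) := by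
    fun_prop
  refine (h x hx).congr (fun y hy => ?_) (by simp)
  have := φ.linear_on K x hx y hy
  linarith

theorem Tent.continuousOn_δ (t : Tent P) (K : P.elems) : ContinuousOn t.δ (hull K.1) :=
  (t.top.continuousOn K).sub (t.bot.continuousOn K)

theorem facet_subset (F : P.facets) : ∃ K : P.elems, F.1 ⊆ K.1 := by
  obtain ⟨K, hK, hF, -⟩ := VertexPatch.mem_facets.1 F.2
  exact ⟨⟨K, hK⟩, hF⟩

/-- The surface measure of a facet is finite. -/
theorem facet_measure_lt_top (F : P.facets) :
    (Measure.euclideanHausdorffMeasure (d - 1) : Measure (Space d)) (hull F.1) < ⊤ := by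
  obtain ⟨K, hK, hF, hcard⟩ := VertexPatch.mem_facets.1 F.2
  rcases F.1.eq_empty_or_nonempty with h0 | ⟨x₀, hx₀⟩
  · simp [hull, h0]
  have hind : AffineIndependent ℝ ((↑) : F.1 → Space d) :=
    (P.mesh.indep (VertexPatch.mem_elems.1 hK).1.1).mono (by exact_mod_cast hF)
  have hfr : Module.finrank ℝ (vectorSpan ℝ (Set.range ((↑) : F.1 → Space d))) = d - 1 := by
    have hd : 1 ≤ d := by rw [← hcard]; exact Finset.card_pos.2 ⟨x₀, hx₀⟩
    exact hind.finrank_vectorSpan (by rw [Fintype.card_coe, hcard]; omega)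
  set V := vectorSpan ℝ (Set.range ((↑) : F.1 → Space d)) with hV
  have hiso : Isometry (fun w : V => (w : Space d) + x₀) :=
    (isometry_add_right x₀).comp isometry_subtype_coe
  have hpre : IsCompact ((fun w : V => (w : Space d) + x₀) ⁻¹' hull F.1) := by
    refine hiso.isClosedEmbedding.isCompact_preimage (isCompact_hull F.1)
  have himg : hull F.1 ⊆ (fun w : V => (w : Space d) + x₀) ''
      ((fun w : V => (w : Space d) + x₀) ⁻¹' hull F.1) := by
    intro y hy
    have hyV : y - x₀ ∈ V := by
      have h1 : y ∈ affineSpan ℝ (F.1 : Set (Space d)) := convexHull_subset_affineSpan _ hy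
      have h2 : x₀ ∈ affineSpan ℝ (F.1 : Set (Space d)) :=
        subset_affineSpan ℝ _ (by exact_mod_cast hx₀)
      have h3 := AffineSubspace.vsub_mem_direction h1 h2
      rw [direction_affineSpan] at h3
      simpa [hV, Subtype.range_coe_subtype] using h3
    exact ⟨⟨y - x₀, hyV⟩, by simpa using hy, by simp⟩
  refine (measure_mono himg).trans_lt ?_
  rw [hiso.euclideanHausdorffMeasure_image, ← hfr]
  exact hpre.measure_lt_top

theorem integrableOn_mass (W : P.elems → Matrix (Fin b) (Fin b) ℝ) (u v : DGSpace P b p)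
    (K : P.elems) :
    IntegrableOn (fun x => (W K *ᵥ val u K x) ⬝ᵥ val v K x) (hull K.1) :=
  ((continuous_const.matrix_mulVec (continuous_val u K)).dotProduct
    (continuous_val v K)).continuousOn.integrableOn_compact (isCompact_hull _)

theorem integrableOn_vol (c : Coefficients P b) (t : Tent P) (u v : DGSpace P b p)
    (K : P.elems) :
    IntegrableOn (fun x => t.δ x * ∑ j : Fin d, (c.L K j *ᵥ val u K x) ⬝ᵥ pdv v K j x)
      (hull K.1) :=
  ((t.continuousOn_δ K).mul (continuous_finsetSum _ fun j _ =>
    (continuous_const.matrix_mulVec (continuous_val u K)).dotProduct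
      (continuous_pdv v K j)).continuousOn).integrableOn_compact (isCompact_hull _)

theorem integrableOn_facet (c : Coefficients P b) (t : Tent P) (ν : P.facets → Space d)
    (S : Matrix (Fin b) (Fin b) ℝ) (u v : DGSpace P b p) (F : P.facets) :
    IntegrableOn (fun x => t.δ x * (numFlux c ν S u F x ⬝ᵥ jump ν v F x)) (hull F.1)
      (Measure.euclideanHausdorffMeasure (d - 1)) := by
  obtain ⟨K, hK⟩ := facet_subset F
  have hsub : hull F.1 ⊆ hull K.1 := convexHull_mono (by exact_mod_cast hK)
  have hc : ContinuousOn (fun x => t.δ x * (numFlux c ν S u F x ⬝ᵥ jump ν v F x)) (hull F.1) :=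
    ((t.continuousOn_δ K).mono hsub).mul
      ((continuous_numFlux c ν S u F).dotProduct (continuous_jump ν v F)).continuousOn
  exact hc.integrableOn_of_subset_isCompact (isCompact_hull _)
    (isCompact_hull _).isClosed.measurableSet subset_rfl (facet_measure_lt_top F).ne

/-- `massFun` as a bilinear form. -/
def massForm (W : P.elems → Matrix (Fin b) (Fin b) ℝ) : LinearMap.BilinForm ℝ (DGSpace P b p) :=
  LinearMap.mk₂ ℝ (massFun W)
    (fun u₁ u₂ v => by
      simp only [massFun, val_add, Matrix.mulVec_add, add_dotProduct]
      rw [← Finset.sum_add_distrib]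
      exact Finset.sum_congr rfl fun K _ =>
        integral_add (integrableOn_mass W u₁ v K) (integrableOn_mass W u₂ v K))
    (fun a u v => by
      simp only [massFun, val_smul, Matrix.mulVec_smul, smul_dotProduct, integral_smul,
        Finset.smul_sum])
    (fun u v₁ v₂ => by
      simp only [massFun, val_add, dotProduct_add]
      rw [← Finset.sum_add_distrib]
      exact Finset.sum_congr rfl fun K _ =>
        integral_add (integrableOn_mass W u v₁ K) (integrableOn_mass W u v₂ K))
    (fun a u v => by
      simp only [massFun, val_smul, dotProduct_smul, integral_smul, Finset.smul_sum])

/-- `dgFun` as a bilinear form. -/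
def dgForm (c : Coefficients P b) (t : Tent P) (ν : P.facets → Space d)
    (S : Matrix (Fin b) (Fin b) ℝ) : LinearMap.BilinForm ℝ (DGSpace P b p) :=
  LinearMap.mk₂ ℝ (dgFun c t ν S)
    (fun u₁ u₂ v => by
      simp only [dgFun, val_add, Matrix.mulVec_add, add_dotProduct, numFlux_add,
        Finset.sum_add_distrib, mul_add]
      rw [add_add_add_comm, ← Finset.sum_add_distrib, ← Finset.sum_add_distrib]
      congr 1
      · exact Finset.sum_congr rfl fun K _ =>
          integral_add (integrableOn_vol c t u₁ v K) (integrableOn_vol c t u₂ v K)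
      · exact Finset.sum_congr rfl fun F _ =>
          integral_add (integrableOn_facet c t ν S u₁ v F) (integrableOn_facet c t ν S u₂ v F))
    (fun a u v => by
      simp only [dgFun, val_smul, Matrix.mulVec_smul, smul_dotProduct, numFlux_smul,
        ← Finset.smul_sum, mul_smul_comm, integral_smul, smul_add])
    (fun u v₁ v₂ => by
      simp only [dgFun, pdv_add, dotProduct_add, jump_add, Finset.sum_add_distrib, mul_add]
      rw [add_add_add_comm, ← Finset.sum_add_distrib, ← Finset.sum_add_distrib]
      congr 1
      · exact Finset.sum_congr rfl fun K _ =>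
          integral_add (integrableOn_vol c t u v₁ K) (integrableOn_vol c t u v₂ K)
      · exact Finset.sum_congr rfl fun F _ =>
          integral_add (integrableOn_facet c t ν S u v₁ F) (integrableOn_facet c t ν S u v₂ F))
    (fun a u v => by
      simp only [dgFun, pdv_smul, dotProduct_smul, jump_smul,
        ← Finset.smul_sum, mul_smul_comm, integral_smul, smul_add])

/-- The `L²` inner product `(u, v) = ∑_K ∫_K u · v dx` on `V_h`. -/
def ip (P : VertexPatch d) (b p : ℕ) : LinearMap.BilinForm ℝ (DGSpace P b p) :=
  massForm fun _ => 1

theorem interior_hull_nonempty (K : P.elems) : (interior (hull K.1)).Nonempty := by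
  obtain ⟨hK, -⟩ := VertexPatch.mem_elems.1 K.2
  have hind := P.mesh.indep hK.1
  have hspan : affineSpan ℝ (K.1 : Set (Space d)) = ⊤ := by
    have := hind.affineSpan_eq_top_iff_card_eq_finrank_add_one.2
      (by rw [Fintype.card_coe, hK.2]; simp)
    simpa using this
  exact interior_convexHull_nonempty_iff_affineSpan_eq_top.2 hspan

theorem ip_self_eq_zero (v : DGSpace P b p) (hv : ip P b p v v = 0) : v = 0 := by
  have hnn : ∀ K : P.elems, ∀ x, 0 ≤ ((1 : Matrix (Fin b) (Fin b) ℝ) *ᵥ val v K x) ⬝ᵥ val v K x := by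
    intro K x
    rw [Matrix.one_mulVec]
    exact Finset.sum_nonneg fun i _ => mul_self_nonneg _
  have hv' : ∑ K : P.elems, ∫ x in hull K.1,
      ((1 : Matrix (Fin b) (Fin b) ℝ) *ᵥ val v K x) ⬝ᵥ val v K x = 0 := hv
  rw [Finset.sum_eq_zero_iff_of_nonneg
    (fun K _ => integral_nonneg fun x => hnn K x)] at hv'
  funext K l
  have h0 := hv' K (Finset.mem_univ _)
  rw [setIntegral_eq_zero_iff_of_nonneg_ae (Filter.Eventually.of_forall fun x => hnn K x)
    (integrableOn_mass (fun _ => 1) v v K)] at h0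
  have h1 : ∀ x ∈ interior (hull K.1), val v K x = 0 := by
    have hc : Continuous fun x => ((1 : Matrix (Fin b) (Fin b) ℝ) *ᵥ val v K x) ⬝ᵥ val v K x :=
      (continuous_const.matrix_mulVec (continuous_val v K)).dotProduct (continuous_val v K)
    have h2 := Measure.eqOn_open_of_ae_eq
      (ae_restrict_of_ae_restrict_of_subset interior_subset h0) isOpen_interior
      hc.continuousOn continuousOn_const
    intro x hx
    have := h2 hx
    simp only [Matrix.one_mulVec, Pi.zero_apply] at this
    exact dotProduct_self_eq_zero.1 this
  obtain ⟨x₀, hx₀⟩ := interior_hull_nonempty K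
  have hopen : IsOpen ((WithLp.toLp 2 : (Fin d → ℝ) → Space d) ⁻¹' interior (hull K.1)) :=
    isOpen_interior.preimage (PiLp.continuous_toLp 2 _)
  obtain ⟨ε, hε, hball⟩ := Metric.isOpen_iff.1 hopen x₀.ofLp (by simpa using hx₀)
  apply Subtype.ext
  refine MvPolynomial.funext_set (fun i => Metric.ball (x₀.ofLp i) ε) (fun i => ?_) ?_
  · rw [Real.ball_eq_Ioo]
    exact Set.Ioo_infinite (by linarith)
  · intro x hx
    have hx' : WithLp.toLp 2 x ∈ interior (hull K.1) := by
      apply hball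
      rw [ball_pi _ hε]
      exact hx
    have := congrFun (h1 _ hx') l
    simpa [val] using this

theorem ip_nondegenerate : (ip P b p).Nondegenerate :=
  ⟨fun v hv => ip_self_eq_zero v (hv v), fun v hv => ip_self_eq_zero v (hv v)⟩

/-- The operator `B : V_h → V_h` with `(B u, v) = a(u, v)` for all `v`. -/
def operatorOf (a : LinearMap.BilinForm ℝ (DGSpace P b p)) : Module.End ℝ (DGSpace P b p) :=
  a.symmCompOfNondegenerate (ip P b p) ip_nondegenerate

theorem ip_operatorOf (a : LinearMap.BilinForm ℝ (DGSpace P b p)) (u v : DGSpace P b p) :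
    ip P b p (operatorOf a u) v = a u v :=
  LinearMap.BilinForm.symmCompOfNondegenerate_left_apply _ _ _ _

/-- `(M₀ u, v) = (g(u) - f(u) grad φ_bot, v)`. -/
def M₀ (p : ℕ) (c : Coefficients P b) (t : Tent P) : Module.End ℝ (DGSpace P b p) :=
  operatorOf (massForm fun K => c.G K - c.dir K (t.bot.grad K))

/-- `(M₁ u, v) = (f(u) grad δ, v)`. -/
def M₁ (p : ℕ) (c : Coefficients P b) (t : Tent P) : Module.End ℝ (DGSpace P b p) :=
  operatorOf (massForm fun K => c.dir K (t.gradδ K))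

/-- `(A u, v) = (δ f(u), grad v) + (δ F̂, ⟦v⟧)`. -/
def A (p : ℕ) (c : Coefficients P b) (t : Tent P) (ν : P.facets → Space d)
    (S : Matrix (Fin b) (Fin b) ℝ) : Module.End ℝ (DGSpace P b p) :=
  operatorOf (dgForm c t ν S)

/-- The norm `‖v‖_B = √(B v, v)` of a selfadjoint positive definite operator `B`. -/
def normWith (B : Module.End ℝ (DGSpace P b p)) (v : DGSpace P b p) : ℝ :=
  Real.sqrt (ip P b p (B v) v)

end Forms

section SAT

variable {V : Type*} [AddCommGroup V] [Module ℝ V]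

/-- The operators `X₀ = I`, `Xᵢ = τ M₀⁻¹ (A + i M₁) Xᵢ₋₁`. -/
def satX (τ : ℝ) (M₀ M₁ A : Module.End ℝ V) : ℕ → Module.End ℝ V
  | 0 => 1
  | i + 1 => τ • (Ring.inverse M₀ * (A + ((i : ℝ) + 1) • M₁) * satX τ M₀ M₁ A i)

/-- One SAT step of order `s` and pseudotime step `τ`:
`∑_{i<s} Xᵢ / i! + M⁻¹ M₀ X_s / s!`, with `M = M₀ - τ M₁`. -/
def satStep (s : ℕ) (τ : ℝ) (M₀ M₁ A : Module.End ℝ V) : Module.End ℝ V :=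
  (∑ i ∈ Finset.range s, ((i.factorial : ℝ)⁻¹) • satX τ M₀ M₁ A i) +
    ((s.factorial : ℝ)⁻¹) • (Ring.inverse (M₀ - τ • M₁) * M₀ * satX τ M₀ M₁ A s)

/-- The composition of the first `n` SAT steps; the step number `l + 1` starts from the mass
operator `M₀ - l τ M₁`. -/
def satSteps (s : ℕ) (τ : ℝ) (M₀ M₁ A : Module.End ℝ V) : ℕ → Module.End ℝ V
  | 0 => 1
  | l + 1 => satStep s τ (M₀ - ((l : ℝ) * τ) • M₁) M₁ A * satSteps s τ M₀ M₁ A l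

/-- The propagator `R_{r,s}` over the whole tent, with `r` subtents and `τ = 1 / r`. -/
def satPropagator (r s : ℕ) (M₀ M₁ A : Module.End ℝ V) : Module.End ℝ V :=
  satSteps s (1 / (r : ℝ)) M₀ M₁ A r

end SAT

/-- All the data of the fully discrete problem on one tent, other than `S`, `p`, `s`, `r`. -/
structure TentProblem (d b : ℕ) where
  /-- the mesh and the vertex -/
  patch : VertexPatch d
  /-- the mesh size -/
  h : ℝ
  /-- the elementwise constant coefficients of the hyperbolic system -/
  coeff : Coefficients patch b
  /-- the tent -/
  tent : Tent patch
  /-- a choice of unit normals to the facets -/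
  normal : patch.facets → Space d

namespace TentProblem

/-- The standing assumptions, with mesh regularity constant `γ`, bounds `g₀`, `Λ`, `c₀` on the
coefficients and their wave speeds, and causality constant `cmax`. -/
structure Admissible (Q : TentProblem d b) (γ g₀ Λ c₀ cmax : ℝ) : Prop where
  shapeRegular : ShapeRegular Q.patch.mesh γ
  meshSize : IsMeshSize Q.patch.mesh Q.h
  coeff : Q.coeff.Admissible g₀ Λ c₀
  causal : Q.tent.Causal cmax
  normal : IsNormalField Q.patch Q.normal

/-- The stability estimate `‖R_{r,s} v‖_{M(1)} ≤ (1 + C h) ‖v‖_{M₀}` for all `v ∈ V_h`, where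
`M(1) = M₀ - M₁`. -/
def WeakStabilityBound (Q : TentProblem d b) (S : Matrix (Fin b) (Fin b) ℝ) (p s r : ℕ)
    (C : ℝ) : Prop :=
  ∀ v : DGSpace Q.patch b p,
    normWith (M₀ p Q.coeff Q.tent - M₁ p Q.coeff Q.tent)
        (satPropagator r s (M₀ p Q.coeff Q.tent) (M₁ p Q.coeff Q.tent)
          (A p Q.coeff Q.tent Q.normal S) v)
      ≤ (1 + C * Q.h) * normWith (M₀ p Q.coeff Q.tent) v

end TentProblem

end TentDG

end

noncomputable section

namespace TentDG

/-! ### Uniform positivity of the Hilbert matrix -/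

section

/-! The growth of the energy over one step is compared with the numerical dissipation `D`, which
penalizes jumps. Integrating the volume term of the DG form by parts gives A = N - M₁ - J. Here N u
= -δ ∑ⱼ ℒ⁽ʲ⁾ ∂ⱼ u acts elementwise and preserves V_h because δ is affine, while J consists of jump
terms only and satisfies ‖J u‖² ≤ C D(u, u) because S is positive definite. With v = u the symmetry
of the coefficients gives 2 (A u, u) + (M₁ u, u) = -2 D(u, u) (`dgFun_eq`, `dgFun_energy`).

Without J the SAT recursion Xᵢ = τ M₀⁻¹ (N + (i-1) M₁) Xᵢ₋₁ terminates. By the product rule its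
iterates on an element are τⁱ δⁱ qᵢ, where qᵢ arises from qᵢ₋₁ by one derivative, so they vanish at
i = p + 1 (`recursion_terminates`). Hence the true X_{p+1} v is an accumulation of jump terms, and
X_s v is bounded by τ^(s-p) W, where W = ∑_{i ≤ p} √D(Xᵢ v, Xᵢ v) (`StepData.norm_satX_last_le`).

Let T(θ) be the Taylor polynomial ∑_{k < s} θᵏ X_k v / k!. It solves the semidiscrete tent equation
up to a residual proportional to y = M₀ X_s v, and the special last term of the SAT step yields an
exact energy balance (`StepData.energy_identity`). The energy loses 2τ ∫ D(T, T), which is at least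
2 c τ W² because the Hilbert matrix is positive definite. It gains a mixed term of size τ^(s-p+1) W
‖v‖ and a final term of size τ^(2(s-p)) W². For small τ the final term is absorbed by half of the
loss. Young's inequality absorbs the mixed term in the other half and leaves C τ^(2(s-p)+1) ‖v‖²
(`one_step_estimate`). Over the O(1/τ) steps this accumulates to a factor exp(C τ^(2(s-p))), and
τ^(2(s-p)) ≤ h is the CFL condition (`propagator_estimate`).

The constants must not depend on the mesh. With κ a bound for the height of the tent in units of the
element inradii, A, M₁ and N are O(κ): the factor δ ≤ κ ρ compensates the 1/ρ of inverse and trace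
inequalities. The abstract theory is therefore applied to the operators divided by κ, with step κ/r
(`exists_stepData`). Causality gives κ ≤ 2γ/c_max, which proves the first claim. The second claim
comes from choosing κ proportional to the actual height bound. The mass operators are uniformly
coercive since the wave speeds stay below c_max (`Coefficients.coercive`). -/

theorem exists_lower_bound_of_dotProduct_pos {n : Type*} [Fintype n] (H : Matrix n n ℝ)
    (hH : ∀ w : n → ℝ, w ≠ 0 → 0 < w ⬝ᵥ (H *ᵥ w)) :
    ∃ σ : ℝ, 0 < σ ∧ ∀ w : n → ℝ, σ * (w ⬝ᵥ w) ≤ w ⬝ᵥ (H *ᵥ w) := by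
  have hc : Continuous fun w : n → ℝ => w ⬝ᵥ (H *ᵥ w) :=
    continuous_id.dotProduct (continuous_const.matrix_mulVec continuous_id)
  rcases isEmpty_or_nonempty n with hn | hn
  · exact ⟨1, one_pos, fun w => by simp [dotProduct]⟩
  have hcomp : IsCompact (Metric.sphere (0 : n → ℝ) 1) := isCompact_sphere _ _
  have hne : (Metric.sphere (0 : n → ℝ) 1).Nonempty := NormedSpace.sphere_nonempty.2 zero_le_one
  obtain ⟨w₀, hw₀, hmin⟩ := hcomp.exists_isMinOn hne hc.continuousOn
  have hw₀0 : w₀ ≠ 0 := by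
    rintro rfl
    simp at hw₀
  have hpos := hH w₀ hw₀0
  have hcard : (0 : ℝ) < Fintype.card n := by exact_mod_cast Fintype.card_pos
  -- The minimum is taken over the unit sphere of the sup norm; dividing by the dimension
  -- compensates w ⬝ᵥ w ≤ n ‖w‖².
  refine ⟨w₀ ⬝ᵥ (H *ᵥ w₀) / Fintype.card n, by positivity, fun w => ?_⟩
  rcases eq_or_ne w 0 with rfl | hw
  · simp
  have hnw : 0 < ‖w‖ := norm_pos_iff.2 hw
  have h1 : w₀ ⬝ᵥ (H *ᵥ w₀) ≤ (‖w‖⁻¹ • w) ⬝ᵥ (H *ᵥ (‖w‖⁻¹ • w)) :=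
    hmin (by simp [norm_smul, hnw.ne'])
  rw [Matrix.mulVec_smul, smul_dotProduct, dotProduct_smul, smul_eq_mul, smul_eq_mul] at h1
  have h2 : w ⬝ᵥ w ≤ Fintype.card n * ‖w‖ ^ 2 := by
    calc w ⬝ᵥ w = ∑ i, w i * w i := rfl
      _ ≤ ∑ _i : n, ‖w‖ ^ 2 := by
          refine Finset.sum_le_sum fun i _ => ?_
          have := norm_le_pi_norm w i
          rw [Real.norm_eq_abs] at this
          nlinarith [abs_nonneg (w i), abs_mul_abs_self (w i)]
      _ = _ := by simp
  have h3 : w₀ ⬝ᵥ (H *ᵥ w₀) * ‖w‖ ^ 2 ≤ w ⬝ᵥ (H *ᵥ w) := by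
    have := mul_le_mul_of_nonneg_right h1 (sq_nonneg ‖w‖)
    refine this.trans_eq ?_
    field_simp
  rw [div_mul_eq_mul_div, div_le_iff₀ hcard]
  nlinarith

open scoped MatrixOrder in
/-- The Hilbert matrix is positive definite, uniformly for positive semidefinite forms. -/
theorem exists_integral_lower_bound (n : ℕ) : ∃ c : ℝ, 0 < c ∧
    ∀ (V : Type) [AddCommGroup V] [Module ℝ V] (D : LinearMap.BilinForm ℝ V),
      (∀ u, 0 ≤ D u u) → ∀ a : ℕ → V,
        c * ∑ k ∈ Finset.range n, D (a k) (a k) ≤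
          ∫ θ in (0 : ℝ)..1, D (∑ k ∈ Finset.range n, θ ^ k • a k)
            (∑ k ∈ Finset.range n, θ ^ k • a k) := by
  -- The Gram matrix of the monomials in L²(0, 1), so its quadratic form vanishes only on the zero
  -- polynomial.
  set H : Matrix (Fin n) (Fin n) ℝ := fun k l => 1 / ((k : ℝ) + l + 1) with hHdef
  have hHe : ∀ k l : Fin n, H k l = 1 / ((k : ℝ) + l + 1) := fun _ _ => rfl
  have hmono : ∀ k l : ℕ, ∫ θ in (0 : ℝ)..1, θ ^ k * θ ^ l = 1 / ((k : ℝ) + l + 1) := by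
    intro k l
    simp_rw [← pow_add]
    rw [integral_pow]
    simp
  have hint : ∀ w : Fin n → ℝ, w ⬝ᵥ (H *ᵥ w) =
      ∫ θ in (0 : ℝ)..1, (∑ k : Fin n, θ ^ (k : ℕ) * w k) ^ 2 := by
    intro w
    simp_rw [sq, Finset.sum_mul_sum]
    rw [intervalIntegral.integral_finsetSum]
    · simp only [dotProduct, Matrix.mulVec, Finset.mul_sum]
      refine Finset.sum_congr rfl fun k _ => ?_
      rw [intervalIntegral.integral_finsetSum]
      · refine Finset.sum_congr rfl fun l _ => ?_
        rw [hHe, ← hmono k l, ← intervalIntegral.integral_mul_const,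
          ← intervalIntegral.integral_const_mul]
        refine intervalIntegral.integral_congr fun θ _ => ?_
        ring
      · intro l _
        exact Continuous.intervalIntegrable (by fun_prop) _ _
    · intro l _
      exact Continuous.intervalIntegrable (by fun_prop) _ _
  have hpos : ∀ w : Fin n → ℝ, w ≠ 0 → 0 < w ⬝ᵥ (H *ᵥ w) := by
    intro w hw
    rw [hint]
    set q : Polynomial ℝ := ∑ k : Fin n, Polynomial.monomial (k : ℕ) (w k) with hq
    have hqe : ∀ θ : ℝ, q.eval θ = ∑ k : Fin n, θ ^ (k : ℕ) * w k := by
      intro θ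
      simp [hq, Polynomial.eval_finsetSum, mul_comm]
    have hq0 : q ≠ 0 := by
      obtain ⟨k, hk⟩ := Function.ne_iff.1 hw
      intro h0
      apply hk
      have : q.coeff k = w k := by
        simp [hq, Polynomial.coeff_monomial, Fin.val_inj]
      rw [← this, h0]; simp
    refine intervalIntegral.integral_pos zero_lt_one (by fun_prop) (fun θ _ => sq_nonneg _) ?_
    by_contra! hcon
    apply hq0
    refine Polynomial.eq_zero_of_infinite_isRoot q
      ((Set.Icc_infinite (zero_lt_one (α := ℝ))).mono fun θ hθ => ?_)
    have := hcon θ hθ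
    rw [← hqe] at this
    exact pow_eq_zero_iff (two_ne_zero) |>.1 (le_antisymm this (sq_nonneg _))
  obtain ⟨c, hc, hcH⟩ := exists_lower_bound_of_dotProduct_pos H hpos
  refine ⟨c, hc, fun V _ _ D hD a => ?_⟩
  have hPSD : (H - c • (1 : Matrix (Fin n) (Fin n) ℝ)).PosSemidef := by
    refine Matrix.PosSemidef.of_dotProduct_mulVec_nonneg ?_ fun w => ?_
    · ext k l
      simp only [Matrix.conjTranspose_apply, Matrix.sub_apply, Matrix.smul_apply, hHe,
        Matrix.one_apply, star_trivial, eq_comm (a := l), add_comm (l : ℝ)]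
    · have := hcH w
      simp only [star_trivial, Matrix.sub_mulVec, Matrix.smul_mulVec, Matrix.one_mulVec,
        dotProduct_sub, dotProduct_smul, smul_eq_mul]
      linarith
  -- The factorization H - c = BᵀB carries the scalar inequality over to `D`: the excess over c ∑
  -- D(a_k, a_k) is ∑ₘ D(∑ₖ Bₘₖ aₖ, ∑ₖ Bₘₖ aₖ), a sum of nonnegative terms.
  obtain ⟨B, hB⟩ := CStarAlgebra.nonneg_iff_eq_star_mul_self.1 hPSD.nonneg
  have hHB : ∀ k l, H k l = c * (if k = l then 1 else 0) + ∑ m, B m k * B m l := by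
    intro k l
    have := congrFun (congrFun hB k) l
    simp only [Matrix.sub_apply, Matrix.smul_apply, Matrix.one_apply, smul_eq_mul,
      Matrix.star_eq_conjTranspose, Matrix.mul_apply, Matrix.conjTranspose_apply,
      star_trivial] at this
    linarith
  have hval : ∫ θ in (0 : ℝ)..1, D (∑ k ∈ Finset.range n, θ ^ k • a k)
      (∑ k ∈ Finset.range n, θ ^ k • a k) = ∑ k : Fin n, ∑ l : Fin n, H k l * D (a k) (a l) := by
    simp_rw [Finset.sum_range, map_sum, LinearMap.sum_apply, map_smul, LinearMap.smul_apply,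
      smul_eq_mul]
    rw [intervalIntegral.integral_finsetSum]
    · rw [Finset.sum_comm]
      refine Finset.sum_congr rfl fun k _ => ?_
      rw [intervalIntegral.integral_finsetSum]
      · refine Finset.sum_congr rfl fun l _ => ?_
        rw [hHe, ← hmono l k, ← intervalIntegral.integral_mul_const]
        refine intervalIntegral.integral_congr fun θ _ => ?_
        ring
      · intro l _
        exact Continuous.intervalIntegrable (by fun_prop) _ _
    · intro l _
      exact Continuous.intervalIntegrable (by fun_prop) _ _
  rw [hval]
  have hnn : 0 ≤ ∑ m, D (∑ k : Fin n, B m k • a k) (∑ k : Fin n, B m k • a k) :=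
    Finset.sum_nonneg fun m _ => hD _
  have hexp : ∑ k : Fin n, ∑ l : Fin n, H k l * D (a k) (a l) =
      c * ∑ k ∈ Finset.range n, D (a k) (a k) +
        ∑ m, D (∑ k : Fin n, B m k • a k) (∑ k : Fin n, B m k • a k) := by
    simp_rw [hHB, add_mul, Finset.sum_add_distrib]
    congr 1
    · rw [Finset.sum_range, Finset.mul_sum]
      refine Finset.sum_congr rfl fun k _ => ?_
      rw [Finset.sum_eq_single k] <;> simp +contextual [eq_comm]
    · simp_rw [map_sum, LinearMap.sum_apply, map_smul, LinearMap.smul_apply, smul_eq_mul,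
        Finset.sum_mul]
      have : ∀ m, ∑ x, ∑ x_1, B m x * (B m x_1 * D (a x_1) (a x)) =
          ∑ x_1, ∑ x, B m x * (B m x_1 * D (a x_1) (a x)) := fun m => Finset.sum_comm
      simp_rw [this]
      conv_rhs => rw [Finset.sum_comm]
      refine Finset.sum_congr rfl fun k _ => ?_
      conv_rhs => rw [Finset.sum_comm]
      refine Finset.sum_congr rfl fun l _ => Finset.sum_congr rfl fun m _ => ?_
      ring
  rw [hexp]
  linarith

end

/-! ### Abstract time step: bounds for the SAT iterates -/

section

open scoped RealInnerProductSpace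

/-- The operators of one time step: a symmetric, bounded and coercive mass operator `M₀`, a bounded
operator `A` satisfying an energy identity with a dissipation `D` which controls the deviation of
`A` from an operator `N - M₁`, for which the exact recursion terminates after `p + 1` steps. -/
structure StepData {V : Type} [NormedAddCommGroup V] [InnerProductSpace ℝ V]
    (M₀ M₁ A N : Module.End ℝ V) (D : LinearMap.BilinForm ℝ V) (μ K : ℝ) (p : ℕ) : Prop where
  symm : ∀ u v, ⟪M₀ u, v⟫ = ⟪u, M₀ v⟫
  coercive : ∀ v, μ * ‖v‖ ^ 2 ≤ ⟪M₀ v, v⟫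
  bound : ∀ v, ‖M₀ v‖ ≤ K * ‖v‖
  bound_M₁ : ∀ v, ‖M₁ v‖ ≤ K * ‖v‖
  bound_A : ∀ v, ‖A v‖ ≤ K * ‖v‖
  bound_N : ∀ v, ‖N v‖ ≤ K * ‖v‖
  symm_M₁ : ∀ u v, ⟪M₁ u, v⟫ = ⟪u, M₁ v⟫
  nonneg : ∀ u, 0 ≤ D u u
  energy : ∀ u, 2 * ⟪A u, u⟫ + ⟪M₁ u, u⟫ = -2 * D u u
  jump : ∀ u, ‖N u - M₁ u - A u‖ ^ 2 ≤ K * D u u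
  nilpotent : ∀ y : ℕ → V, (∀ k : ℕ, M₀ (y (k + 1)) = N (y k) + (k : ℝ) • M₁ (y k)) →
    y (p + 1) = 0

namespace StepData

variable {V : Type} [NormedAddCommGroup V] [InnerProductSpace ℝ V]
  {M₀ M₁ A N : Module.End ℝ V} {D : LinearMap.BilinForm ℝ V} {μ K : ℝ} {p : ℕ}

theorem norm_le (h : StepData M₀ M₁ A N D μ K p) (v : V) : μ * ‖v‖ ≤ ‖M₀ v‖ := by
  rcases eq_or_ne v 0 with rfl | hv
  · simp
  have h1 := (h.coercive v).trans (real_inner_le_norm _ _)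
  have h2 : 0 < ‖v‖ := norm_pos_iff.2 hv
  nlinarith

variable [FiniteDimensional ℝ V]

theorem isUnit (h : StepData M₀ M₁ A N D μ K p) (hμ : 0 < μ) : IsUnit M₀ := by
  rw [LinearMap.isUnit_iff_ker_eq_bot, LinearMap.ker_eq_bot']
  intro v hv
  have := h.norm_le v
  rw [hv, norm_zero] at this
  exact norm_le_zero_iff.1 (by nlinarith [norm_nonneg v])

theorem apply_inverse (h : StepData M₀ M₁ A N D μ K p) (hμ : 0 < μ) (v : V) :
    M₀ (Ring.inverse M₀ v) = v := by
  rw [← Module.End.mul_apply, Ring.mul_inverse_cancel _ (h.isUnit hμ), Module.End.one_apply]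

theorem norm_inverse_le (h : StepData M₀ M₁ A N D μ K p) (hμ : 0 < μ) (v : V) :
    ‖Ring.inverse M₀ v‖ ≤ ‖v‖ / μ := by
  rw [le_div_iff₀ hμ, mul_comm]
  simpa [h.apply_inverse hμ] using h.norm_le (Ring.inverse M₀ v)

theorem satX_succ (h : StepData M₀ M₁ A N D μ K p) (hμ : 0 < μ) (τ : ℝ) (k : ℕ) (v : V) :
    M₀ (satX τ M₀ M₁ A (k + 1) v) =
      τ • (A (satX τ M₀ M₁ A k v) + ((k : ℝ) + 1) • M₁ (satX τ M₀ M₁ A k v)) := by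
  rw [satX]
  simp only [LinearMap.smul_apply, Module.End.mul_apply, map_smul, h.apply_inverse hμ,
    LinearMap.add_apply]

theorem norm_satX_succ_le (h : StepData M₀ M₁ A N D μ K p) (hμ : 0 < μ) {τ : ℝ}
    (hτ : 0 ≤ τ) (k : ℕ) (v : V) :
    ‖satX τ M₀ M₁ A (k + 1) v‖ ≤ τ * (K * (k + 2) / μ) * ‖satX τ M₀ M₁ A k v‖ := by
  set x := satX τ M₀ M₁ A k v
  have h1 := h.norm_le (satX τ M₀ M₁ A (k + 1) v)
  rw [h.satX_succ hμ, norm_smul, Real.norm_of_nonneg hτ] at h1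
  have h2 : ‖A x + ((k : ℝ) + 1) • M₁ x‖ ≤ K * ‖x‖ + (k + 1) * (K * ‖x‖) := by
    refine (norm_add_le _ _).trans (add_le_add (h.bound_A x) ?_)
    rw [norm_smul, Real.norm_of_nonneg (by positivity)]
    exact mul_le_mul_of_nonneg_left (h.bound_M₁ x) (by positivity)
  have h3 := h1.trans (mul_le_mul_of_nonneg_left h2 hτ)
  rw [← mul_le_mul_iff_right₀ hμ]
  refine h3.trans_eq ?_
  field_simp
  ring

theorem norm_satX_add_le (h : StepData M₀ M₁ A N D μ K p) (hμ : 0 < μ) (hK : 0 ≤ K) {τ : ℝ}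
    (hτ : 0 ≤ τ) {B : ℝ} {s : ℕ} (hB : K * (s + 2) / μ ≤ B) (i j : ℕ) (hij : i + j ≤ s) (v : V) :
    ‖satX τ M₀ M₁ A (i + j) v‖ ≤ (τ * B) ^ j * ‖satX τ M₀ M₁ A i v‖ := by
  have hB0 : 0 ≤ B := le_trans (by positivity) hB
  induction j with
  | zero => simp
  | succ j ih =>
    refine (h.norm_satX_succ_le hμ hτ (i + j) v).trans ?_
    have h1 : K * (((i + j : ℕ) : ℝ) + 2) / μ ≤ B := by
      refine le_trans ?_ hB
      have : ((i + j : ℕ) : ℝ) ≤ s := by exact_mod_cast (by omega)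
      gcongr
    calc τ * (K * (((i + j : ℕ) : ℝ) + 2) / μ) * ‖satX τ M₀ M₁ A (i + j) v‖
        ≤ τ * B * ((τ * B) ^ j * ‖satX τ M₀ M₁ A i v‖) := by
          gcongr
          exact ih (by omega)
      _ = _ := by ring

theorem norm_satX_le (h : StepData M₀ M₁ A N D μ K p) (hμ : 0 < μ) (hK : 0 ≤ K) {τ : ℝ}
    (hτ : 0 ≤ τ) {B : ℝ} {s : ℕ} (hB : K * (s + 2) / μ ≤ B) (j : ℕ) (hj : j ≤ s) (v : V) :
    ‖satX τ M₀ M₁ A j v‖ ≤ (τ * B) ^ j * ‖v‖ := by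
  have := h.norm_satX_add_le hμ hK hτ hB 0 j (by omega) v
  simpa [satX] using this

/-- With J = N - M₁ - A, the SAT recursion is the terminating recursion of `nilpotent` perturbed by
-J. At index p + 1 only the perturbations survive, each bounded by the root of the dissipation. They
enter through at least one factor τ, and further factors τ are discarded. -/
theorem norm_satX_last_le (h : StepData M₀ M₁ A N D μ K p) (hμ : 0 < μ) (hK : 0 ≤ K) {τ : ℝ}
    (hτ : 0 ≤ τ) (hτ1 : τ ≤ 1) {B : ℝ} (hB1 : 1 ≤ B) (hB : K * (p + 2) / μ ≤ B)
    (hB' : √K / μ ≤ B) (v : V) :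
    ‖satX τ M₀ M₁ A (p + 1) v‖ ≤ τ * B ^ (p + 1) *
      ∑ i ∈ Finset.range (p + 1), √(D (satX τ M₀ M₁ A i v) (satX τ M₀ M₁ A i v)) := by
  set x : ℕ → V := fun k => satX τ M₀ M₁ A k v with hx
  -- The unperturbed recursion with the powers of τ factored out.
  let z : ℕ → V := fun k => Nat.rec v (fun k y => Ring.inverse M₀ (N y + (k : ℝ) • M₁ y)) k
  have hz : ∀ k : ℕ, M₀ (z (k + 1)) = N (z k) + (k : ℝ) • M₁ (z k) := fun k =>
    h.apply_inverse hμ _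
  have key : ∀ k ≤ p + 1, ‖x k - τ ^ k • z k‖ ≤ τ * B ^ k *
      ∑ i ∈ Finset.range k, √(D (x i) (x i)) := by
    intro k
    induction k with
    | zero => intro _; simp [hx, satX, z]
    | succ k ih =>
      intro hk
      have ih' := ih (by omega)
      -- A + (k + 1) M₁ = (N + k M₁) - (N - M₁ - A): the shift of the index by one is the M₁
      -- produced by integration by parts.
      have e1 : M₀ (x (k + 1) - τ ^ (k + 1) • z (k + 1)) =
          τ • (N (x k - τ ^ k • z k) + (k : ℝ) • M₁ (x k - τ ^ k • z k)
            - (N (x k) - M₁ (x k) - A (x k))) := by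
        rw [map_sub, map_smul, hz, hx]
        simp only [h.satX_succ hμ, map_sub, map_smul]
        module
      have e2 := h.norm_le (x (k + 1) - τ ^ (k + 1) • z (k + 1))
      rw [e1, norm_smul, Real.norm_of_nonneg hτ] at e2
      set e := x k - τ ^ k • z k
      have hJ : ‖N (x k) - M₁ (x k) - A (x k)‖ ≤ √K * √(D (x k) (x k)) := by
        rw [← Real.sqrt_mul hK]
        exact Real.le_sqrt_of_sq_le (h.jump _)
      have e3 : ‖N e + (k : ℝ) • M₁ e - (N (x k) - M₁ (x k) - A (x k))‖ ≤
          K * (p + 2) * ‖e‖ + √K * √(D (x k) (x k)) := by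
        refine (norm_sub_le _ _).trans (add_le_add ((norm_add_le _ _).trans ?_) hJ)
        rw [norm_smul, Real.norm_of_nonneg (by positivity)]
        have h1 := h.bound_N e
        have h2 := mul_le_mul_of_nonneg_left (h.bound_M₁ e) (Nat.cast_nonneg (α := ℝ) k)
        have h3 : (k : ℝ) ≤ p := by exact_mod_cast (by omega)
        have h4 : (k : ℝ) * (K * ‖e‖) ≤ p * (K * ‖e‖) := by gcongr
        nlinarith [mul_nonneg hK (norm_nonneg e)]
      set S := ∑ i ∈ Finset.range k, √(D (x i) (x i)) with hS
      have hS0 : 0 ≤ S := Finset.sum_nonneg fun _ _ => Real.sqrt_nonneg _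
      have e4 : ‖x (k + 1) - τ ^ (k + 1) • z (k + 1)‖ ≤
          τ * (K * (p + 2) / μ * ‖e‖ + √K / μ * √(D (x k) (x k))) := by
        rw [← mul_le_mul_iff_right₀ hμ]
        refine (e2.trans (mul_le_mul_of_nonneg_left e3 hτ)).trans_eq ?_
        field_simp
      rw [Finset.sum_range_succ, ← hS]
      have hB0 : 0 ≤ B := by linarith
      have hBk : 1 ≤ B ^ k := one_le_pow₀ hB1
      have e5 : ‖e‖ ≤ B ^ k * S := ih'.trans (by
        rw [mul_assoc]; exact mul_le_of_le_one_left (by positivity) hτ1)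
      calc _ ≤ τ * (K * (p + 2) / μ * ‖e‖ + √K / μ * √(D (x k) (x k))) := e4
        _ ≤ τ * (B * (B ^ k * S) + B * B ^ k * √(D (x k) (x k))) := by
          have e6 : √K / μ * √(D (x k) (x k)) ≤ B * B ^ k * √(D (x k) (x k)) := by
            refine mul_le_mul_of_nonneg_right (hB'.trans ?_) (Real.sqrt_nonneg _)
            exact le_mul_of_one_le_right hB0 hBk
          have e7 : K * (p + 2) / μ * ‖e‖ ≤ B * (B ^ k * S) :=
            mul_le_mul hB e5 (norm_nonneg _) hB0
          gcongr
        _ = _ := by ring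
  have := key (p + 1) le_rfl
  rwa [h.nilpotent z hz, smul_zero, sub_zero] at this

end StepData

end

/-! ### Energy balance of one SAT step -/

section

open scoped RealInnerProductSpace

theorem hasDerivAt_taylor {V : Type} [NormedAddCommGroup V] [NormedSpace ℝ V] (x : ℕ → V) (n : ℕ) (θ : ℝ) :
    HasDerivAt (fun θ : ℝ => ∑ k ∈ Finset.range (n + 1), (θ ^ k * (k.factorial : ℝ)⁻¹) • x k)
      (∑ k ∈ Finset.range n, (θ ^ k * (k.factorial : ℝ)⁻¹) • x (k + 1)) θ := by
  have h : ∀ k ∈ Finset.range (n + 1),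
      HasDerivAt (fun θ : ℝ => (θ ^ k * (k.factorial : ℝ)⁻¹) • x k)
        (((k : ℝ) * θ ^ (k - 1) * (k.factorial : ℝ)⁻¹) • x k) θ := fun k _ =>
    ((hasDerivAt_pow k θ).mul_const _).smul_const _
  have := HasDerivAt.fun_sum h
  rw [Finset.sum_range_succ'] at this
  simp only [Nat.cast_zero, zero_mul, zero_smul, add_zero] at this
  convert this using 1
  refine Finset.sum_congr rfl fun k _ => ?_
  congr 1
  rw [Nat.factorial_succ]
  push_cast
  have : ((k : ℝ) + 1) ≠ 0 := by positivity
  have h2 : (k.factorial : ℝ) ≠ 0 := by positivity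
  field_simp

namespace StepData

variable {V : Type} [NormedAddCommGroup V] [InnerProductSpace ℝ V] [FiniteDimensional ℝ V]
  {M₀ M₁ A N : Module.End ℝ V} {D : LinearMap.BilinForm ℝ V} {μ K : ℝ} {p : ℕ}

/-- Integrate over θ the derivative of the energy of T(θ) with respect to M₀ - θτM₁, corrected by a
term that trades the pairing of the residual y with T for its pairing with T'. The gain is that T',
unlike T, carries a factor τ. -/
theorem energy_identity (h : StepData M₀ M₁ A N D μ K p) (hμ : 0 < μ) {τ : ℝ}
    (h' : StepData (M₀ - τ • M₁) M₁ A N D μ K p) (n : ℕ) (v : V) (T T' : ℝ → V)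
    (hT : T = fun θ => ∑ k ∈ Finset.range (n + 1),
      (θ ^ k * (k.factorial : ℝ)⁻¹) • satX τ M₀ M₁ A k v)
    (hT' : T' = fun θ => ∑ k ∈ Finset.range n,
      (θ ^ k * (k.factorial : ℝ)⁻¹) • satX τ M₀ M₁ A (k + 1) v) (y : V)
    (hy : y = M₀ (satX τ M₀ M₁ A (n + 1) v)) :
    ⟪(M₀ - τ • M₁) (satStep (n + 1) τ M₀ M₁ A v), satStep (n + 1) τ M₀ M₁ A v⟫ =
      ⟪M₀ v, v⟫ - 2 * τ * (∫ θ in (0 : ℝ)..1, D (T θ) (T θ)) +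
      (∫ θ in (0 : ℝ)..1, 2 * (θ ^ (n + 1) * ((n + 1).factorial : ℝ)⁻¹) * ⟪T' θ, y⟫) +
      (((n + 1).factorial : ℝ)⁻¹) ^ 2 * ⟪Ring.inverse (M₀ - τ • M₁) y, y⟫ := by
  set x : ℕ → V := fun k => satX τ M₀ M₁ A k v with hx
  set f : ℝ := ((n + 1).factorial : ℝ)⁻¹ with hf
  have hTd : ∀ θ, HasDerivAt T (T' θ) θ := by
    intro θ; rw [hT, hT']; exact hasDerivAt_taylor x n θ
  -- The coefficient 2θⁿ⁺¹/(n+1)! is the antiderivative of 2θⁿ/n!, so differentiating the correction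
  -- cancels the residual paired with T.
  set P : ℝ → ℝ := fun θ => ⟪M₀ (T θ) - (θ * τ) • M₁ (T θ), T θ⟫ +
    2 * (θ ^ (n + 1) * f) * ⟪T θ, y⟫ with hP
  -- Equivalently d/dθ [(M₀ - θτM₁) T] = τ A T - (θⁿ/n!) y: the semidiscrete equation with the
  -- residual of Taylor truncation. The weights i of M₁ in Xᵢ account for the θ-dependence of the
  -- mass operator.
  have hrel : ∀ θ, M₀ (T' θ) - (θ * τ) • M₁ (T' θ) + (θ ^ n * (n.factorial : ℝ)⁻¹) • y =
      τ • (A (T θ) + M₁ (T θ)) := by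
    intro θ
    have e1 : M₀ (T' θ) + (θ ^ n * (n.factorial : ℝ)⁻¹) • y =
        ∑ k ∈ Finset.range (n + 1), (θ ^ k * (k.factorial : ℝ)⁻¹) • M₀ (x (k + 1)) := by
      rw [Finset.sum_range_succ, hT', hy, map_sum]
      simp only [map_smul, hx]
    have e2 : (θ * τ) • M₁ (T' θ) = ∑ k ∈ Finset.range (n + 1),
        (θ ^ k * (k.factorial : ℝ)⁻¹) • (τ • (k : ℝ) • M₁ (x k)) := by
      rw [Finset.sum_range_succ', hT', map_sum, Finset.smul_sum]
      simp only [Nat.cast_zero, zero_smul, smul_zero, add_zero, map_smul, smul_smul, hx]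
      refine Finset.sum_congr rfl fun k _ => ?_
      congr 1
      rw [Nat.factorial_succ]
      push_cast
      have : ((k : ℝ) + 1) ≠ 0 := by positivity
      field_simp
      ring
    rw [sub_add_eq_add_sub, e1, e2, ← Finset.sum_sub_distrib, hT]
    simp only [map_sum, map_smul, ← Finset.sum_add_distrib, Finset.smul_sum]
    refine Finset.sum_congr rfl fun k _ => ?_
    rw [hx]
    simp only [h.satX_succ hμ]
    module
  have hM : ∀ (B : Module.End ℝ V) θ, HasDerivAt (fun θ => B (T θ)) (B (T' θ)) θ := fun B θ =>
    (LinearMap.toContinuousLinearMap B).hasFDerivAt.comp_hasDerivAt θ (hTd θ)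
  have hPd : ∀ θ, HasDerivAt P (-2 * τ * D (T θ) (T θ) +
      2 * (θ ^ (n + 1) * f) * ⟪T' θ, y⟫) θ := by
    intro θ
    have d1 := ((hM M₀ θ).sub ((((hasDerivAt_id θ).mul_const τ)).smul (hM M₁ θ))).inner ℝ (hTd θ)
    have d2 := (((hasDerivAt_pow (n + 1) θ).mul_const f).const_mul 2).mul
      ((hTd θ).inner ℝ (hasDerivAt_const θ y))
    refine (d1.add d2).congr_deriv ?_
    have e := congrArg (fun z => 2 * ⟪z, T θ⟫) (hrel θ)
    simp only [inner_add_left, inner_sub_left, real_inner_smul_left] at e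
    have s1 := h.symm (T θ) (T' θ)
    have s2 := h.symm_M₁ (T θ) (T' θ)
    have en := h.energy (T θ)
    have c1 := real_inner_comm (T θ) (M₀ (T' θ))
    have c2 := real_inner_comm (T θ) (M₁ (T' θ))
    have c3 := real_inner_comm (T θ) y
    have hff : ((n + 1 : ℕ) : ℝ) * f = (n.factorial : ℝ)⁻¹ := by
      rw [hf, Nat.factorial_succ]
      push_cast
      have : ((n : ℝ) + 1) ≠ 0 := by positivity
      field_simp
    simp only [id, inner_add_left, inner_sub_left, real_inner_smul_left, inner_zero_right,
      Nat.add_sub_cancel, one_mul, Pi.sub_apply, Pi.smul_apply', zero_add]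
    rw [← hff] at e
    rw [s1, s2, ← c3]
    linear_combination e + τ * en - c1 + θ * τ * c2
  have hTc : Continuous T := continuous_iff_continuousAt.2 fun θ => (hTd θ).continuousAt
  have hTc' : Continuous T' := by rw [hT']; fun_prop
  -- The energy identity expresses the quadratic form of `D` through operators, which gives
  -- continuity.
  have hDc : Continuous fun θ => D (T θ) (T θ) := by
    have : ∀ θ, D (T θ) (T θ) = ⟪-A (T θ), T θ⟫ - ⟪M₁ (T θ), T θ⟫ / 2 := by
      intro θ
      have := h.energy (T θ)
      rw [inner_neg_left]; linarith
    simp_rw [this]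
    have hc : ∀ B : Module.End ℝ V, Continuous fun θ => B (T θ) := fun B =>
      (LinearMap.continuous_of_finiteDimensional B).comp hTc
    exact ((hc A).neg.inner hTc).sub (((hc M₁).inner hTc).div_const 2)
  have hc1 : Continuous fun θ => -2 * τ * D (T θ) (T θ) := continuous_const.mul hDc
  have hc2 : Continuous fun θ => 2 * (θ ^ (n + 1) * f) * ⟪T' θ, y⟫ := by fun_prop
  have hint := intervalIntegral.integral_eq_sub_of_hasDerivAt (a := 0) (b := 1)
    (fun θ _ => hPd θ) ((hc1.add hc2).intervalIntegrable _ _)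
  rw [intervalIntegral.integral_add (hc1.intervalIntegrable _ _) (hc2.intervalIntegrable _ _),
    intervalIntegral.integral_const_mul] at hint
  have hT0 : T 0 = v := by
    rw [hT]
    simp only [Finset.sum_range_succ', pow_succ, mul_zero, zero_mul, zero_smul,
      Finset.sum_const_zero]
    simp [satX]
  have hP0 : P 0 = ⟪M₀ v, v⟫ := by simp [hP, hT0]
  -- With M⁻¹ M₀ in the last term, the cross term of the new energy is 2f (T(1), y), exactly the
  -- correction contained in P(1).
  have hw : satStep (n + 1) τ M₀ M₁ A v = T 1 + f • Ring.inverse (M₀ - τ • M₁) y := by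
    simp [satStep, hT, hy, hf, LinearMap.sum_apply]
  have hinv := h'.apply_inverse hμ y
  rw [hw]
  set ρ := Ring.inverse (M₀ - τ • M₁) y
  have hMs := h'.symm (T 1) ρ
  rw [map_add, map_smul, hinv, inner_add_left, inner_add_right, inner_add_right,
    real_inner_smul_left, real_inner_smul_left, real_inner_smul_right, real_inner_smul_right, hMs,
    hinv]
  have hP1 : P 1 = ⟪(M₀ - τ • M₁) (T 1), T 1⟫ + 2 * f * ⟪T 1, y⟫ := by
    simp [hP]
  have c1 := real_inner_comm (T 1) y
  have c2 := real_inner_comm ρ y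
  rw [hP0, hP1] at hint
  rw [c2] at *
  linear_combination (-1 : ℝ) * hint + f * c1

end StepData

end

/-! ### Growth of the energy in one step and composition of steps -/

section

open scoped RealInnerProductSpace

/-- The dissipation loss 2τ cD W² is split into equal halves: one absorbs the quadratic term in y,
the other absorbs the W part of the mixed term. -/
theorem one_step_estimate (s p : ℕ) (hps : p < s) (μ K : ℝ) (hμ : 0 < μ) (hK : 0 < K) :
    ∃ τ₀ : ℝ, 0 < τ₀ ∧ τ₀ ≤ 1 ∧ ∃ C : ℝ, 0 < C ∧
      ∀ (V : Type) [NormedAddCommGroup V] [InnerProductSpace ℝ V] [FiniteDimensional ℝ V]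
        (M₀ M₁ A N : Module.End ℝ V) (D : LinearMap.BilinForm ℝ V) (τ : ℝ),
        0 < τ → τ ≤ τ₀ → StepData M₀ M₁ A N D μ K p → StepData (M₀ - τ • M₁) M₁ A N D μ K p →
        ∀ v, ⟪(M₀ - τ • M₁) (satStep s τ M₀ M₁ A v), satStep s τ M₀ M₁ A v⟫ ≤
          (1 + C * τ ^ (2 * (s - p) + 1)) * ⟪M₀ v, v⟫ := by
  obtain ⟨c, hc, hcD⟩ := exists_integral_lower_bound s
  obtain ⟨n, rfl⟩ : ∃ n, s = n + 1 := ⟨s - 1, by omega⟩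
  set B : ℝ := max 1 (max (K * ((n + 1 : ℕ) + 2) / μ) (√K / μ)) with hBdef
  have hB1 : 1 ≤ B := le_max_left _ _
  have hB0 : 0 ≤ B := by linarith
  have hB2 : K * ((n + 1 : ℕ) + 2) / μ ≤ B := (le_max_left _ _).trans (le_max_right _ _)
  have hB3 : √K / μ ≤ B := (le_max_right _ _).trans (le_max_right _ _)
  have hB4 : K * (p + 2) / μ ≤ B := by
    refine le_trans ?_ hB2
    have : (p : ℝ) ≤ (n + 1 : ℕ) := by exact_mod_cast hps.le
    gcongr
  have hBs : 1 ≤ B ^ (n + 1) := one_le_pow₀ hB1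
  set f : ℝ := ((n + 1).factorial : ℝ)⁻¹ with hf
  have hf0 : 0 < f := by positivity
  have hf1 : f ≤ 1 := inv_le_one_of_one_le₀ (by exact_mod_cast Nat.factorial_pos _)
  set cD : ℝ := c * f ^ 2 / (p + 1) with hcDdef
  have hcD0 : 0 < cD := by positivity
  set E : ℝ := B ^ (n + 1) * B ^ (p + 1) with hE
  have hE0 : 0 < E := by positivity
  set C₁ : ℝ := 2 * n * B ^ (n + 1) * K * E with hC₁
  set C₂ : ℝ := K ^ 2 / μ * E ^ 2 with hC₂
  have hC₂0 : 0 < C₂ := by positivity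
  have hC₁0 : 0 ≤ C₁ := by positivity
  -- The bound cD / C₂ makes the quadratic term in y absorbable; the `+ 1` keeps the constant
  -- positive when n = 0, where C₁ = 0.
  refine ⟨min 1 (cD / C₂), by positivity, min_le_left _ _, (C₁ ^ 2 + 1) / (4 * cD) / μ,
    by positivity, ?_⟩
  intro V _ _ _ M₀ M₁ A N D τ hτ hτ₀ h h' v
  have hτ1 : τ ≤ 1 := hτ₀.trans (min_le_left _ _)
  have hτC : τ * C₂ ≤ cD := by
    rw [← le_div_iff₀ hC₂0]; exact hτ₀.trans (min_le_right _ _)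
  set x : ℕ → V := fun k => satX τ M₀ M₁ A k v with hx
  set y := M₀ (satX τ M₀ M₁ A (n + 1) v) with hy
  let T : ℝ → V := fun θ => ∑ k ∈ Finset.range (n + 1),
      (θ ^ k * (k.factorial : ℝ)⁻¹) • satX τ M₀ M₁ A k v
  let T' : ℝ → V := fun θ => ∑ k ∈ Finset.range n,
      (θ ^ k * (k.factorial : ℝ)⁻¹) • satX τ M₀ M₁ A (k + 1) v
  have hid := h.energy_identity hμ h' n v T T' rfl rfl y rfl
  set W : ℝ := ∑ i ∈ Finset.range (p + 1), √(D (x i) (x i)) with hW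
  have hW0 : 0 ≤ W := Finset.sum_nonneg fun _ _ => Real.sqrt_nonneg _
  set m := n + 1 - p with hm
  have hxs : ‖x (n + 1)‖ ≤ E * τ ^ m * W := by
    have e1 := h.norm_satX_add_le hμ hK.le hτ.le hB2 (p + 1) (n - p) (by omega) v
    have e2 := h.norm_satX_last_le hμ hK.le hτ.le hτ1 hB1 hB4 hB3 v
    rw [show p + 1 + (n - p) = n + 1 by omega] at e1
    have hpw : B ^ (n - p) ≤ B ^ (n + 1) := pow_le_pow_right₀ hB1 (by omega)
    calc ‖x (n + 1)‖ ≤ (τ * B) ^ (n - p) * (τ * B ^ (p + 1) * W) :=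
          e1.trans (mul_le_mul_of_nonneg_left e2 (by positivity))
      _ = B ^ (n - p) * (τ ^ (n - p + 1) * B ^ (p + 1) * W) := by ring
      _ ≤ B ^ (n + 1) * (τ ^ (n - p + 1) * B ^ (p + 1) * W) := by gcongr
      _ = _ := by rw [hE, hm, show n - p + 1 = n + 1 - p by omega]; ring
  have hyn : ‖y‖ ≤ K * (E * τ ^ m * W) :=
    (h.bound _).trans (mul_le_mul_of_nonneg_left hxs hK.le)
  -- Hilbert matrix bound for the coefficients x_k / k!. The smallest weight exceeds f, and W
  -- involves only the first p + 1 of the n + 1 terms, whence the factor p + 1 from Cauchy-Schwarz.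
  have hdiss : cD * W ^ 2 ≤ ∫ θ in (0 : ℝ)..1, D (T θ) (T θ) := by
    have e1 := hcD V D h.nonneg fun k => (k.factorial : ℝ)⁻¹ • x k
    simp only [smul_smul] at e1
    refine le_trans ?_ e1
    have e2 : f ^ 2 * ∑ k ∈ Finset.range (n + 1), D (x k) (x k) ≤
        ∑ k ∈ Finset.range (n + 1),
          D ((k.factorial : ℝ)⁻¹ • x k) ((k.factorial : ℝ)⁻¹ • x k) := by
      rw [Finset.mul_sum]
      refine Finset.sum_le_sum fun k hk => ?_
      simp only [map_smul, LinearMap.smul_apply, smul_eq_mul]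
      have : f ≤ (k.factorial : ℝ)⁻¹ := by
        refine inv_anti₀ (by positivity) ?_
        exact_mod_cast Nat.factorial_le (by rw [Finset.mem_range] at hk; omega)
      rw [← mul_assoc, ← sq]
      exact mul_le_mul_of_nonneg_right (by gcongr) (h.nonneg _)
    have e3 : W ^ 2 ≤ (p + 1) * ∑ k ∈ Finset.range (n + 1), D (x k) (x k) := by
      have := sq_sum_le_card_mul_sum_sq (s := Finset.range (p + 1))
        (f := fun i => √(D (x i) (x i)))
      rw [Finset.card_range] at this
      push_cast at this
      refine this.trans (mul_le_mul_of_nonneg_left ?_ (by positivity))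
      simp_rw [Real.sq_sqrt (h.nonneg _)]
      exact Finset.sum_le_sum_of_subset_of_nonneg
        (Finset.range_subset_range.2 (by omega)) fun _ _ _ => h.nonneg _
    calc cD * W ^ 2 ≤ cD * ((p + 1) * ∑ k ∈ Finset.range (n + 1), D (x k) (x k)) := by gcongr
      _ = c * (f ^ 2 * ∑ k ∈ Finset.range (n + 1), D (x k) (x k)) := by
        rw [hcDdef]; field_simp
      _ ≤ _ := by gcongr
  have hmix : (∫ θ in (0 : ℝ)..1, 2 * (θ ^ (n + 1) * f) * ⟪T' θ, y⟫) ≤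
      C₁ * τ ^ (m + 1) * W * ‖v‖ := by
    have hb : ∀ θ ∈ Set.uIoc (0 : ℝ) 1, ‖2 * (θ ^ (n + 1) * f) * ⟪T' θ, y⟫‖ ≤
        C₁ * τ ^ (m + 1) * W * ‖v‖ := by
      intro θ hθ
      rw [Set.uIoc_of_le zero_le_one] at hθ
      have hθ0 := hθ.1.le
      have e1 : ‖T' θ‖ ≤ n * (τ * B ^ (n + 1) * ‖v‖) := by
        refine (norm_sum_le _ _).trans ?_
        have : ∀ k ∈ Finset.range n,
            ‖(θ ^ k * (k.factorial : ℝ)⁻¹) • satX τ M₀ M₁ A (k + 1) v‖ ≤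
              τ * B ^ (n + 1) * ‖v‖ := by
          intro k hk
          rw [Finset.mem_range] at hk
          rw [norm_smul]
          have a1 : ‖θ ^ k * (k.factorial : ℝ)⁻¹‖ ≤ 1 := by
            rw [Real.norm_of_nonneg (by positivity)]
            exact mul_le_one₀ (pow_le_one₀ hθ0 hθ.2) (by positivity)
              (inv_le_one_of_one_le₀ (by exact_mod_cast Nat.factorial_pos _))
          have a2 := h.norm_satX_le hμ hK.le hτ.le hB2 (k + 1) (by omega) v
          refine (mul_le_of_le_one_left (norm_nonneg _) a1).trans (a2.trans ?_)
          rw [mul_pow]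
          have a3 : τ ^ (k + 1) ≤ τ := pow_le_of_le_one hτ.le hτ1 (by omega)
          have a4 : B ^ (k + 1) ≤ B ^ (n + 1) := pow_le_pow_right₀ hB1 (by omega)
          gcongr
        refine (Finset.sum_le_sum this).trans_eq ?_
        simp
      rw [norm_mul, Real.norm_of_nonneg (by positivity : 0 ≤ 2 * (θ ^ (n + 1) * f))]
      have e2 : 2 * (θ ^ (n + 1) * f) ≤ 2 := by
        have : θ ^ (n + 1) * f ≤ 1 := mul_le_one₀ (pow_le_one₀ hθ0 hθ.2) hf0.le hf1
        linarith
      calc _ ≤ 2 * (‖T' θ‖ * ‖y‖) := by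
            refine mul_le_mul e2 (norm_inner_le_norm _ _) (norm_nonneg _) (by norm_num)
        _ ≤ 2 * (n * (τ * B ^ (n + 1) * ‖v‖) * (K * (E * τ ^ m * W))) := by gcongr
        _ = _ := by rw [hC₁]; ring
    have := intervalIntegral.norm_integral_le_of_norm_le_const hb
    simp only [sub_zero, abs_one, mul_one] at this
    exact (le_abs_self _).trans this
  have hlast : f ^ 2 * ⟪Ring.inverse (M₀ - τ • M₁) y, y⟫ ≤ τ * (cD * W ^ 2) := by
    have e1 : ⟪Ring.inverse (M₀ - τ • M₁) y, y⟫ ≤ ‖y‖ ^ 2 / μ := by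
      refine (real_inner_le_norm _ _).trans ?_
      rw [sq, mul_div_right_comm]
      exact mul_le_mul_of_nonneg_right (h'.norm_inverse_le hμ y) (norm_nonneg _)
    calc f ^ 2 * ⟪Ring.inverse (M₀ - τ • M₁) y, y⟫ ≤ f ^ 2 * (‖y‖ ^ 2 / μ) := by gcongr
      _ ≤ 1 * ((K * (E * τ ^ m * W)) ^ 2 / μ) := by
        have : f ^ 2 ≤ 1 := pow_le_one₀ hf0.le hf1
        gcongr
      _ = τ ^ (2 * m) * (C₂ * W ^ 2) := by rw [hC₂]; ring
      -- Since m = s - p ≥ 1, two powers of τ are available: one is matched with the dissipation,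
      -- the other supplies smallness.
      _ ≤ τ ^ 2 * (C₂ * W ^ 2) := by
        have : τ ^ (2 * m) ≤ τ ^ 2 := pow_le_pow_of_le_one hτ.le hτ1 (by omega)
        gcongr
      _ = τ * ((τ * C₂) * W ^ 2) := by ring
      _ ≤ _ := by gcongr
  -- Completing the square in W; the exponent 2m + 1 of the remainder determines the final CFL
  -- exponent.
  have hyoung : C₁ * τ ^ (m + 1) * W * ‖v‖ ≤
      τ * (cD * W ^ 2) + C₁ ^ 2 / (4 * cD) * τ ^ (2 * m + 1) * ‖v‖ ^ 2 := by
    have : τ * (cD * W ^ 2) + C₁ ^ 2 / (4 * cD) * τ ^ (2 * m + 1) * ‖v‖ ^ 2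
        - C₁ * τ ^ (m + 1) * W * ‖v‖ =
        τ * (cD * (W - C₁ * τ ^ m * ‖v‖ / (2 * cD)) ^ 2) := by
      field_simp
      ring
    have h2 : 0 ≤ τ * (cD * (W - C₁ * τ ^ m * ‖v‖ / (2 * cD)) ^ 2) := by positivity
    linarith
  have hfin : C₁ ^ 2 / (4 * cD) * τ ^ (2 * m + 1) * ‖v‖ ^ 2 ≤
      (C₁ ^ 2 + 1) / (4 * cD) / μ * τ ^ (2 * m + 1) * ⟪M₀ v, v⟫ := by
    have h1 := h.coercive v
    calc C₁ ^ 2 / (4 * cD) * τ ^ (2 * m + 1) * ‖v‖ ^ 2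
        ≤ (C₁ ^ 2 + 1) / (4 * cD) * τ ^ (2 * m + 1) * ‖v‖ ^ 2 := by gcongr; linarith
      _ = (C₁ ^ 2 + 1) / (4 * cD) / μ * τ ^ (2 * m + 1) * (μ * ‖v‖ ^ 2) := by field_simp
      _ ≤ _ := by gcongr
  rw [hid]
  have := mul_le_mul_of_nonneg_left hdiss hτ.le
  rw [add_mul, one_mul]
  linarith

/-- Plain operator bounds, without use of dissipation. They serve for steps too long for
`one_step_estimate`, of which there can be only boundedly many. -/
theorem one_step_crude (s p : ℕ) (μ K κ : ℝ) (hμ : 0 < μ) (hK : 0 < K) (hκ : 0 ≤ κ) :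
    ∃ C : ℝ, 1 ≤ C ∧
      ∀ (V : Type) [NormedAddCommGroup V] [InnerProductSpace ℝ V] [FiniteDimensional ℝ V]
        (M₀ M₁ A N : Module.End ℝ V) (D : LinearMap.BilinForm ℝ V) (τ : ℝ),
        0 < τ → τ ≤ κ → StepData M₀ M₁ A N D μ K p → StepData (M₀ - τ • M₁) M₁ A N D μ K p →
        ∀ v, ⟪(M₀ - τ • M₁) (satStep s τ M₀ M₁ A v), satStep s τ M₀ M₁ A v⟫ ≤
          C * ⟪M₀ v, v⟫ := by
  set B : ℝ := K * (s + 2) / μ with hB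
  have hB0 : 0 ≤ B := by positivity
  set G : ℝ := (∑ k ∈ Finset.range s, (κ * B) ^ k) + K / μ * (κ * B) ^ s with hG
  have hG0 : 0 ≤ G := by positivity
  refine ⟨1 + K * G ^ 2 / μ, by linarith [show 0 ≤ K * G ^ 2 / μ by positivity], ?_⟩
  intro V _ _ _ M₀ M₁ A N D τ hτ hτκ h h' v
  have hX : ∀ k ≤ s, ‖satX τ M₀ M₁ A k v‖ ≤ (κ * B) ^ k * ‖v‖ := by
    intro k hk
    refine (h.norm_satX_le hμ hK.le hτ.le (s := s) le_rfl k hk v).trans ?_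
    gcongr
  have hfac : ∀ k : ℕ, ‖((k.factorial : ℝ)⁻¹)‖ ≤ 1 := by
    intro k
    rw [Real.norm_of_nonneg (by positivity)]
    exact inv_le_one_of_one_le₀ (by exact_mod_cast Nat.factorial_pos _)
  have hw : ‖satStep s τ M₀ M₁ A v‖ ≤ G * ‖v‖ := by
    rw [satStep, LinearMap.add_apply, LinearMap.sum_apply, hG, add_mul, Finset.sum_mul]
    refine (norm_add_le _ _).trans (add_le_add ((norm_sum_le _ _).trans ?_) ?_)
    · refine Finset.sum_le_sum fun k hk => ?_
      rw [LinearMap.smul_apply, norm_smul]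
      exact (mul_le_of_le_one_left (norm_nonneg _) (hfac k)).trans
        (hX k (Finset.mem_range.1 hk).le)
    · rw [LinearMap.smul_apply, norm_smul]
      refine (mul_le_of_le_one_left (norm_nonneg _) (hfac s)).trans ?_
      rw [Module.End.mul_apply, Module.End.mul_apply]
      refine (h'.norm_inverse_le hμ _).trans ?_
      have := (h.bound (satX τ M₀ M₁ A s v)).trans
        (mul_le_mul_of_nonneg_left (hX s le_rfl) hK.le)
      calc _ ≤ K * ((κ * B) ^ s * ‖v‖) / μ := by gcongr
        _ = _ := by ring
  set w := satStep s τ M₀ M₁ A v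
  have h1 : ⟪(M₀ - τ • M₁) w, w⟫ ≤ K * ‖w‖ * ‖w‖ :=
    (real_inner_le_norm _ _).trans (mul_le_mul_of_nonneg_right (h'.bound w) (norm_nonneg _))
  have h2 := h.coercive v
  have h3 : 0 ≤ ⟪M₀ v, v⟫ := le_trans (by positivity) h2
  calc _ ≤ K * ‖w‖ * ‖w‖ := h1
    _ ≤ K * (G * ‖v‖) * (G * ‖v‖) := by gcongr
    _ = K * G ^ 2 / μ * (μ * ‖v‖ ^ 2) := by field_simp
    _ ≤ K * G ^ 2 / μ * ⟪M₀ v, v⟫ := by gcongr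
    _ ≤ _ := by nlinarith

/-- Composition of steps which all enjoy the same growth bound. -/
theorem steps_estimate {V : Type} [NormedAddCommGroup V] [InnerProductSpace ℝ V]
    {M₀ M₁ A : Module.End ℝ V} {s : ℕ} {τ G : ℝ} (hG : 0 ≤ G) (n : ℕ)
    (hstep : ∀ l < n, ∀ v, ⟪(M₀ - ((l : ℝ) * τ) • M₁ - τ • M₁)
        (satStep s τ (M₀ - ((l : ℝ) * τ) • M₁) M₁ A v),
          satStep s τ (M₀ - ((l : ℝ) * τ) • M₁) M₁ A v⟫ ≤
        G * ⟪(M₀ - ((l : ℝ) * τ) • M₁) v, v⟫) (v : V) :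
    ⟪(M₀ - ((n : ℝ) * τ) • M₁) (satSteps s τ M₀ M₁ A n v), satSteps s τ M₀ M₁ A n v⟫ ≤
      G ^ n * ⟪M₀ v, v⟫ := by
  induction n with
  | zero => simp [satSteps]
  | succ n ih =>
    have h1 := hstep n (by omega) (satSteps s τ M₀ M₁ A n v)
    have h2 := ih fun l hl => hstep l (by omega)
    have e : M₀ - (((n + 1 : ℕ) : ℝ) * τ) • M₁ = M₀ - ((n : ℝ) * τ) • M₁ - τ • M₁ := by
      push_cast; module
    rw [e, satSteps, Module.End.mul_apply]
    refine h1.trans ((mul_le_mul_of_nonneg_left h2 hG).trans_eq ?_)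
    ring

end

/-! ### Growth over the whole tent and rescaling of pseudotime -/

section

open scoped RealInnerProductSpace

/-- Short steps compound to an exponential whose exponent is O(h). Long steps can occur under the
CFL condition only if h ≥ 1, and then a constant growth factor is itself at most C h. -/
theorem propagator_estimate (s p : ℕ) (hps : p < s) (μ K κ₀ : ℝ) (hμ : 0 < μ) (hK : 0 < K)
    (hκ₀ : 0 < κ₀) :
    ∃ c : ℝ, 0 < c ∧ ∃ C : ℝ, 0 < C ∧
      ∀ (V : Type) [NormedAddCommGroup V] [InnerProductSpace ℝ V] [FiniteDimensional ℝ V]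
        (M₀ M₁ A N : Module.End ℝ V) (D : LinearMap.BilinForm ℝ V) (κ h : ℝ) (r : ℕ),
        0 < κ → κ ≤ κ₀ → 0 < h → 1 ≤ r →
        κ / r ≤ c * h ^ (1 / (2 * (s : ℝ) - 2 * (p : ℝ))) →
        (∀ t : ℝ, 0 ≤ t → t ≤ κ → StepData (M₀ - t • M₁) M₁ A N D μ K p) →
        ∀ v, ⟪(M₀ - κ • M₁) (satSteps s (κ / r) M₀ M₁ A r v),
            satSteps s (κ / r) M₀ M₁ A r v⟫ ≤ (1 + C * h) ^ 2 * ⟪M₀ v, v⟫ := by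
  obtain ⟨c, hc, hc1, C₁, hC₁, H₁⟩ := one_step_estimate s p hps μ K hμ hK
  obtain ⟨C₂, hC₂, H₂⟩ := one_step_crude s p μ K κ₀ hμ hK hκ₀.le
  set C₃ : ℝ := C₂ ^ ⌈κ₀ / c⌉₊ with hC₃
  have hC₃1 : 1 ≤ C₃ := one_le_pow₀ hC₂
  set a : ℝ := C₁ * κ₀ with ha
  have ha0 : 0 < a := by positivity
  have hae : 0 < a * Real.exp a := by positivity
  refine ⟨c, hc, C₃ + a * Real.exp a, by positivity, ?_⟩
  intro V _ _ _ M₀ M₁ A N D κ h r hκ hκκ hh hr hτc hdata v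
  set τ : ℝ := κ / r with hτ
  have hr0 : (0 : ℝ) < r := by exact_mod_cast hr
  have hτ0 : 0 < τ := by positivity
  have hrτ : (r : ℝ) * τ = κ := by rw [hτ]; field_simp
  have hτκ : τ ≤ κ₀ := by
    refine le_trans ?_ hκκ
    rw [← hrτ]
    exact le_mul_of_one_le_left hτ0.le (by exact_mod_cast hr)
  have hE0 : 0 ≤ ⟪M₀ v, v⟫ := by
    have := (hdata 0 le_rfl hκ.le).coercive v
    rw [zero_smul, sub_zero] at this
    exact le_trans (by positivity) this
  have hd : ∀ l < r, StepData (M₀ - ((l : ℝ) * τ) • M₁) M₁ A N D μ K p ∧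
      StepData (M₀ - ((l : ℝ) * τ) • M₁ - τ • M₁) M₁ A N D μ K p := by
    intro l hl
    have h1 : ((l : ℝ) + 1) * τ ≤ κ := by
      rw [← hrτ]
      have : (l : ℝ) + 1 ≤ r := by exact_mod_cast hl
      gcongr
    refine ⟨hdata _ (by positivity) (by nlinarith), ?_⟩
    rw [sub_sub, ← add_smul]
    exact hdata _ (by positivity) (by nlinarith)
  have key : ∃ G : ℝ, 0 ≤ G ∧ G ^ r ≤ (1 + (C₃ + a * Real.exp a) * h) ^ 2 ∧
      ∀ l < r, ∀ v, ⟪(M₀ - ((l : ℝ) * τ) • M₁ - τ • M₁)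
        (satStep s τ (M₀ - ((l : ℝ) * τ) • M₁) M₁ A v),
          satStep s τ (M₀ - ((l : ℝ) * τ) • M₁) M₁ A v⟫ ≤
        G * ⟪(M₀ - ((l : ℝ) * τ) • M₁) v, v⟫ := by
    -- The energy is a squared norm; the unsquared factor already bounds it.
    have hsq : 1 + (C₃ + a * Real.exp a) * h ≤ (1 + (C₃ + a * Real.exp a) * h) ^ 2 := by
      have : 0 ≤ (C₃ + a * Real.exp a) * h := by positivity
      nlinarith
    have hm0 : (0 : ℝ) < 2 * s - 2 * p := by
      have : (p : ℝ) < s := by exact_mod_cast hps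
      linarith
    rcases le_or_gt τ c with hcase | hcase
    · refine ⟨1 + C₁ * τ ^ (2 * (s - p) + 1), by positivity, ?_, fun l hl v =>
        H₁ V _ _ _ _ _ τ hτ0 hcase (hd l hl).1 (hd l hl).2 v⟩
      refine le_trans ?_ hsq
      -- What remains of the local error τ^(2(s-p)+1) after r = κ/τ steps. Since c ≤ 1, the CFL
      -- condition says y ≤ h.
      set y : ℝ := τ ^ (2 * (s - p)) with hy
      have hy0 : 0 ≤ y := by positivity
      have hy1 : y ≤ 1 := pow_le_one₀ hτ0.le (hcase.trans hc1)
      have hyh : y ≤ h := by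
        calc y ≤ (c * h ^ (1 / (2 * (s : ℝ) - 2 * (p : ℝ)))) ^ (2 * (s - p)) := by
              rw [hy]; gcongr
          _ ≤ (1 * h ^ (1 / (2 * (s : ℝ) - 2 * (p : ℝ)))) ^ (2 * (s - p)) := by gcongr
          _ = h := by
            rw [one_mul, ← Real.rpow_natCast, ← Real.rpow_mul hh.le]
            have : ((2 * (s - p) : ℕ) : ℝ) = 2 * s - 2 * p := by
              push_cast [Nat.cast_sub hps.le]; ring
            rw [this, one_div_mul_cancel hm0.ne', Real.rpow_one]
      have h1 : (1 + C₁ * τ ^ (2 * (s - p) + 1)) ^ r ≤ Real.exp (a * y) := by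
        calc (1 + C₁ * τ ^ (2 * (s - p) + 1)) ^ r
            ≤ (Real.exp (C₁ * τ ^ (2 * (s - p) + 1))) ^ r := by
              gcongr
              rw [add_comm]
              exact Real.add_one_le_exp _
          _ = Real.exp (C₁ * κ * y) := by
              rw [← Real.exp_nat_mul, ← hrτ, hy]
              congr 1
              ring
          _ ≤ _ := by
              rw [ha]
              gcongr
      -- Multiply 1 - x ≤ exp(-x) by exp x, with x = a y; combined with y ≤ 1 this makes the
      -- exponential linear in y.
      have h2 : Real.exp (a * y) ≤ 1 + a * y * Real.exp (a * y) := by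
        have h3 := Real.add_one_le_exp (-(a * y))
        have h4 := mul_le_mul_of_nonneg_right h3 (Real.exp_pos (a * y)).le
        rw [← Real.exp_add, neg_add_cancel, Real.exp_zero] at h4
        linarith
      have h5 : a * y * Real.exp (a * y) ≤ a * Real.exp a * h := by
        have : Real.exp (a * y) ≤ Real.exp a :=
          Real.exp_le_exp.2 (mul_le_of_le_one_right ha0.le hy1)
        calc a * y * Real.exp (a * y) ≤ a * h * Real.exp a := by gcongr
          _ = _ := by ring
      have h6 : 0 ≤ C₃ * h := by positivity
      rw [add_mul]
      linarith
    · refine ⟨C₂, by linarith, ?_, fun l hl v =>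
        H₂ V _ _ _ _ _ τ hτ0 hτκ (hd l hl).1 (hd l hl).2 v⟩
      refine le_trans ?_ hsq
      -- Otherwise c h^(1/(2s-2p)) ≤ c < τ would contradict the CFL condition.
      have hh1 : 1 ≤ h := by
        by_contra! hlt
        have : h ^ (1 / (2 * (s : ℝ) - 2 * (p : ℝ))) ≤ 1 :=
          Real.rpow_le_one hh.le hlt.le (by positivity)
        have h2 : c * h ^ (1 / (2 * (s : ℝ) - 2 * (p : ℝ))) ≤ c := mul_le_of_le_one_right hc.le this
        linarith
      have hrC : r ≤ ⌈κ₀ / c⌉₊ := by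
        have : (r : ℝ) ≤ κ₀ / c := by
          rw [le_div_iff₀ hc]
          calc (r : ℝ) * c ≤ r * τ := by gcongr
            _ ≤ κ₀ := by rw [hrτ]; exact hκκ
        exact_mod_cast this.trans (Nat.le_ceil _)
      have h1 : C₂ ^ r ≤ C₃ := pow_le_pow_right₀ hC₂ hrC
      have h2 : C₃ ≤ C₃ * h := le_mul_of_one_le_right (by linarith) hh1
      have h3 : 0 ≤ a * Real.exp a * h := by positivity
      rw [add_mul]
      linarith
  obtain ⟨G, hG, hGr, hstep⟩ := key
  have := steps_estimate hG r hstep v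
  rw [hrτ] at this
  exact this.trans (mul_le_mul_of_nonneg_right hGr hE0)

/-- Only the products τ M₁ and τ A matter. This permits passing to M₁/κ and A/κ, which are bounded
independently of the mesh, with step κτ. -/
theorem satX_smul {V : Type} [AddCommGroup V] [Module ℝ V] (τ κ : ℝ)
    (M₀ M₁ A : Module.End ℝ V) (k : ℕ) :
    satX τ M₀ (κ • M₁) (κ • A) k = satX (κ * τ) M₀ M₁ A k := by
  induction k with
  | zero => rfl
  | succ k ih =>
    rw [satX, satX, ih, smul_comm _ κ M₁, ← smul_add, mul_smul_comm, smul_mul_assoc, smul_smul,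
      mul_comm]

theorem satSteps_smul {V : Type} [AddCommGroup V] [Module ℝ V] (s : ℕ) (τ κ : ℝ)
    (M₀ M₁ A : Module.End ℝ V) (n : ℕ) :
    satSteps s τ M₀ (κ • M₁) (κ • A) n = satSteps s (κ * τ) M₀ M₁ A n := by
  induction n with
  | zero => rfl
  | succ n ih =>
    rw [satSteps, satSteps, ih]
    congr 1
    have e : ((n : ℝ) * τ) • κ • M₁ = ((n : ℝ) * (κ * τ)) • M₁ := by module
    have e2 : τ • κ • M₁ = (κ * τ) • M₁ := by module
    rw [satStep, satStep, e, e2]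
    simp only [satX_smul]

end

/-! ### Barycentric coordinates and Fubini along an oblique direction -/

section

section Simplex

variable {d : ℕ} {P : VertexPatch d}

/-- The vertices of an element as an affine basis; its coordinates are the barycentric ones. -/
def bary (K : P.elems) : AffineBasis K.1 ℝ (Space d) where
  toFun := (↑)
  ind' := P.mesh.indep (VertexPatch.mem_elems.1 K.2).1.1
  tot' := by
    have hK := (VertexPatch.mem_elems.1 K.2).1
    exact (P.mesh.indep hK.1).affineSpan_eq_top_iff_card_eq_finrank_add_one.2
      (by rw [Fintype.card_coe, hK.2]; simp)

@[simp] theorem bary_apply (K : P.elems) (w : K.1) : bary K w = w := rfl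

theorem bary_sum_smul (K : P.elems) (x : Space d) :
    ∑ w : K.1, (bary K).coord w x • (w : Space d) = x :=
  (bary K).linear_combination_coord_eq_self x

theorem bary_coord_vertex (K : P.elems) (w w' : K.1) :
    (bary K).coord w w' = if w = w' then 1 else 0 := by
  rw [← bary_apply K w', AffineBasis.coord_apply]

theorem mem_hull_iff (K : P.elems) (x : Space d) :
    x ∈ hull K.1 ↔ ∀ w, 0 ≤ (bary K).coord w x := by
  have := (bary K).convexHull_eq_nonneg_coord
  rw [show Set.range (bary K) = (K.1 : Set (Space d)) from Subtype.range_coe] at this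
  rw [hull, this]; rfl

theorem mem_hull_subset_iff (K : P.elems) {G : Finset (Space d)} (hG : G ⊆ K.1) (x : Space d) :
    x ∈ hull G ↔ (∀ w, 0 ≤ (bary K).coord w x) ∧ ∀ w : K.1, w.1 ∉ G → (bary K).coord w x = 0 := by
  constructor
  · intro hx
    refine ⟨(mem_hull_iff K x).1 (convexHull_mono (by exact_mod_cast hG) hx), fun w hw => ?_⟩
    have hconv : Convex ℝ {y | (bary K).coord w y = 0} := by
      have : {y | (bary K).coord w y = 0} = (bary K).coord w ⁻¹' {0} := rfl
      rw [this]
      exact (convex_singleton (0 : ℝ)).affine_preimage _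
    refine convexHull_min (fun y hy => ?_) hconv hx
    have := bary_coord_vertex K w ⟨y, hG hy⟩
    rw [if_neg (by rintro rfl; exact hw hy)] at this
    exact this
  · rintro ⟨h0, h1⟩
    rw [hull, Finset.mem_convexHull']
    refine ⟨fun y => if hy : y ∈ K.1 then (bary K).coord ⟨y, hy⟩ x else 0, ?_, ?_, ?_⟩
    · intro y hy
      simp [hG hy, h0]
    · set f : Space d → ℝ := fun y => if hy : y ∈ K.1 then (bary K).coord ⟨y, hy⟩ x else 0
      calc ∑ y ∈ G, f y = ∑ y ∈ K.1, f y := Finset.sum_subset hG fun y hy hyG => by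
            simp [f, hy, h1 ⟨y, hy⟩ hyG]
        _ = ∑ w : K.1, f w := (Finset.sum_coe_sort K.1 f).symm
        _ = ∑ w : K.1, (bary K).coord w x := Finset.sum_congr rfl fun w _ => by simp [f]
        _ = 1 := (bary K).sum_coord_apply_eq_one x
    · set f : Space d → ℝ := fun y => if hy : y ∈ K.1 then (bary K).coord ⟨y, hy⟩ x else 0
      calc ∑ y ∈ G, f y • y = ∑ y ∈ K.1, f y • y := Finset.sum_subset hG fun y hy hyG => by
            simp [f, hy, h1 ⟨y, hy⟩ hyG]
        _ = ∑ w : K.1, f w • (w : Space d) := (Finset.sum_coe_sort K.1 fun y => f y • y).symm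
        _ = ∑ w : K.1, (bary K).coord w x • (w : Space d) :=
          Finset.sum_congr rfl fun w _ => by simp [f]
        _ = x := bary_sum_smul K x

/-- A linear functional that is constant on a facet is proportional to the barycentric coordinate
of the opposite vertex. -/
theorem inner_eq_coord_mul (K : P.elems) (w : K.1) {ν : Space d}
    (hν : ∀ x ∈ K.1.erase w, ∀ y ∈ K.1.erase w, inner ℝ ν (y - x) = 0) {x₀ : Space d}
    (hx₀ : x₀ ∈ K.1.erase w) (x : Space d) :
    inner ℝ ν (x - x₀) = (bary K).coord w x * inner ℝ ν (w - x₀) := by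
  have h1 : x - x₀ = ∑ w' : K.1, (bary K).coord w' x • ((w' : Space d) - x₀) := by
    simp only [smul_sub, Finset.sum_sub_distrib, bary_sum_smul, ← Finset.sum_smul,
      (bary K).sum_coord_apply_eq_one, one_smul]
  rw [h1, inner_sum, Finset.sum_eq_single w]
  · rw [real_inner_smul_right]
  · intro w' _ hw'
    rw [real_inner_smul_right, hν x₀ hx₀ w' (Finset.mem_erase.2 ⟨fun h => hw' (Subtype.ext h), w'.2⟩),
      mul_zero]
  · simp

/-- If the height of the opposite vertex over the facet plane were zero, ν would be orthogonal to
every displacement, including itself. -/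
theorem inner_opposite_ne_zero (K : P.elems) (w : K.1) {ν : Space d} (hν1 : ‖ν‖ = 1)
    (hν : ∀ x ∈ K.1.erase w, ∀ y ∈ K.1.erase w, inner ℝ ν (y - x) = 0) {x₀ : Space d}
    (hx₀ : x₀ ∈ K.1.erase w) : inner ℝ ν ((w : Space d) - x₀) ≠ 0 := by
  intro h0
  have := inner_eq_coord_mul K w hν hx₀ (x₀ + ν)
  rw [h0, mul_zero, add_sub_cancel_left, real_inner_self_eq_norm_sq, hν1] at this
  norm_num at this

end Simplex

section Shear

variable {d : ℕ}

/-- The transvection x ↦ x + ⟨ν, x⟩ (e - ν) fixes the hyperplane ν^⊥, maps ν to e and has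
determinant ⟨ν, e⟩. After this change of variables Fubini applies to the orthogonal splitting by ν.
-/
theorem integral_eq_shear {ν e : Space d} (hν : ‖ν‖ = 1) (he : inner ℝ ν e ≠ 0) (x₀ : Space d)
    {f : Space d → ℝ} (hf : Integrable f) :
    ∫ x, f x = |inner ℝ ν e| * ∫ y : (ℝ ∙ ν)ᗮ, ∫ t : ℝ, f (x₀ + y + t • e) := by
  set L : Space d →ₗ[ℝ] Space d := LinearMap.transvection (innerₗ _ ν) (e - ν) with hL
  have hLa : ∀ x, L x = x + (inner ℝ ν x : ℝ) • (e - ν) := fun x => by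
    simp [hL, LinearMap.transvection.apply]
  have hdet : LinearMap.det L = inner ℝ ν e := by
    rw [hL, LinearMap.transvection.det]
    simp [inner_sub_right, hν]
  have hLc : Continuous L := L.continuous_of_finiteDimensional
  have hmap := Measure.map_linearMap_addHaar_eq_smul_addHaar (volume : Measure (Space d))
    (f := L) (by rw [hdet]; exact he)
  rw [hdet] at hmap
  have hf' : Integrable (fun x => f (x₀ + x)) := hf.comp_add_left x₀
  have hpos : 0 < |inner ℝ ν e| := abs_pos.2 he
  have hinj : Function.Injective L := by
    have := LinearMap.equivOfDetNeZero L (by rw [hdet]; exact he)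
    have hu := LinearMap.isUnit_iff_isUnit_det L |>.2 (by rw [hdet]; exact he.isUnit)
    exact ((Module.End.isUnit_iff L).1 hu).1
  have hemb : MeasurableEmbedding L := hLc.measurableEmbedding hinj
  have h1 : ∫ x, f x = |inner ℝ ν e| * ∫ x, f (x₀ + L x) := by
    rw [← hemb.integral_map (g := fun x => f (x₀ + x)), hmap, integral_smul_measure,
      integral_add_left_eq_self f x₀, ENNReal.toReal_ofReal (abs_nonneg _), abs_inv, smul_eq_mul,
      mul_inv_cancel_left₀ hpos.ne']
  have hfL : Integrable (fun x => f (x₀ + L x)) := by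
    refine (hemb.integrable_map_iff (g := fun x => f (x₀ + x))).1 ?_
    rw [hmap]
    exact hf'.smul_measure ENNReal.ofReal_ne_top
  rw [h1]
  congr 1
  set V := (ℝ ∙ ν)ᗮ
  have hmp : MeasurePreserving (fun q : V × ℝ => (q.1 : Space d) + q.2 • ν) := by
    have m1 := (Submodule.measurePreserving_measurableEquivProd (P := Space d) (ℝ ∙ ν) 0).symm
    rw [InnerProductSpace.euclideanHausdorffMeasure_eq_volume] at m1
    have m2 := (LinearIsometryEquiv.toSpanUnitSingleton (𝕜 := ℝ) ν hν).measurePreserving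
    have m3 : MeasurePreserving (Prod.swap : V × ℝ → ℝ × V) := Measure.measurePreserving_swap
    have m4 := m1.comp ((m2.prod (MeasurePreserving.id (volume : Measure V))).comp m3)
    convert m4 using 1
    ext1 q
    simp [add_comm]
  have hemb2 : MeasurableEmbedding (fun q : V × ℝ => (q.1 : Space d) + q.2 • ν) := by
    refine Continuous.measurableEmbedding (by fun_prop) ?_
    intro q q' h
    simp only at h
    have hq : ∀ y : V, inner ℝ ν (y : Space d) = 0 := fun y =>
      Submodule.mem_orthogonal_singleton_iff_inner_right.1 y.2
    have h2 := congrArg (fun z => (inner ℝ ν z : ℝ)) h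
    simp only [inner_add_right, hq, real_inner_smul_right, real_inner_self_eq_norm_sq, hν, zero_add,
      one_pow, mul_one] at h2
    rw [h2, add_left_inj] at h
    exact Prod.ext (Subtype.ext h) h2
  rw [← hmp.integral_comp hemb2, Measure.volume_eq_prod, integral_prod]
  · refine integral_congr_ae (Filter.Eventually.of_forall fun y => ?_)
    refine integral_congr_ae (Filter.Eventually.of_forall fun t => ?_)
    have hq : inner ℝ ν (y : Space d) = 0 := Submodule.mem_orthogonal_singleton_iff_inner_right.1 y.2
    simp only [hLa, inner_add_right, hq, real_inner_smul_right, real_inner_self_eq_norm_sq, hν]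
    congr 1
    module
  · exact (hmp.integrable_comp_emb hemb2).2 hfL

/-- Translation by x₀ embeds ν^⊥ isometrically, so it carries Lebesgue measure to surface measure.
Volume and facet integrals thus become integrals over the same parameter space. -/
theorem setIntegral_facet_eq (hd : 1 ≤ d) {ν : Space d} (hν : ‖ν‖ = 1) (x₀ : Space d)
    {F : Set (Space d)} (hFm : MeasurableSet F) (hF : ∀ x ∈ F, inner ℝ ν (x - x₀) = 0)
    (g : Space d → ℝ) :
    ∫ x in F, g x ∂(Measure.euclideanHausdorffMeasure (d - 1)) =
      ∫ y : (ℝ ∙ ν)ᗮ, F.indicator g (x₀ + y) := by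
  set V := (ℝ ∙ ν)ᗮ
  have hiso : Isometry (fun y : V => x₀ + (y : Space d)) :=
    (isometry_add_left x₀).comp isometry_subtype_coe
  have hfr : Module.finrank ℝ V = d - 1 := by
    have h1 : _ + Module.finrank ℝ V = _ := (ℝ ∙ ν).finrank_add_finrank_orthogonal
    rw [finrank_span_singleton (by rintro rfl; simp at hν)] at h1
    simp only [finrank_euclideanSpace, Fintype.card_fin] at h1
    omega
  have hmap := hiso.map_euclideanHausdorffMeasure (d := d - 1)
  rw [← hfr, InnerProductSpace.euclideanHausdorffMeasure_eq_volume] at hmap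
  have hsub : F ⊆ Set.range fun y : V => x₀ + (y : Space d) := by
    intro x hx
    exact ⟨⟨x - x₀, Submodule.mem_orthogonal_singleton_iff_inner_right.2 (hF x hx)⟩, by simp⟩
  rw [← hfr, ← integral_indicator hFm, ← setIntegral_eq_integral_of_forall_compl_eq_zero
    (s := Set.range fun y : V => x₀ + (y : Space d)), ← hmap,
    hiso.isClosedEmbedding.measurableEmbedding.integral_map]
  intro x hx
  exact Set.indicator_of_notMem (fun h => hx (hsub h)) _

end Shear

end

/-! ### Divergence theorem on an element of the patch -/

section

variable {d : ℕ} {P : VertexPatch d}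

/-- The central vertex as a vertex of an element. -/
def apex (K : P.elems) : K.1 := ⟨P.vertex, (VertexPatch.mem_elems.1 K.2).2⟩

@[simp] theorem coe_apex (K : P.elems) : (apex K : Space d) = P.vertex := rfl

theorem bary_coord_add_smul (K : P.elems) (w w' : K.1) (x : Space d) (t : ℝ) :
    (bary K).coord w' (x + t • ((w : Space d) - P.vertex)) =
      (bary K).coord w' x + t * ((if w' = w then 1 else 0) - if w' = apex K then 1 else 0) := by
  have h1 : x + t • ((w : Space d) - P.vertex) = t • ((w : Space d) -ᵥ P.vertex) +ᵥ x := by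
    simp [add_comm]
  rw [h1, AffineMap.map_vadd, map_smul, AffineMap.linearMap_vsub, ← coe_apex K, bary_coord_vertex,
    bary_coord_vertex]
  simp [add_comm]

/-- The divergence theorem on a simplex, in the direction of an edge from the central vertex, for
functions that vanish on the facet opposite to that vertex. -/
theorem integral_fderiv_edge (hd : 1 ≤ d) (K : P.elems) (w : K.1) (hw : w ≠ apex K) {ν : Space d}
    (hν1 : ‖ν‖ = 1) (hν : ∀ x ∈ K.1.erase w, ∀ y ∈ K.1.erase w, inner ℝ ν (y - x) = 0)
    {g : Space d → ℝ} (hg : ContDiff ℝ 1 g) (h0 : ∀ x ∈ hull (K.1.erase P.vertex), g x = 0) :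
    ∫ x in hull K.1, fderiv ℝ g x ((w : Space d) - P.vertex) =
      -|inner ℝ ν ((w : Space d) - P.vertex)| *
        ∫ x in hull (K.1.erase w), g x ∂(Measure.euclideanHausdorffMeasure (d - 1)) := by
  set e : Space d := (w : Space d) - P.vertex with he
  have hvF : P.vertex ∈ K.1.erase w :=
    Finset.mem_erase.2 ⟨fun h => hw (Subtype.ext h.symm), (apex K).2⟩
  have hne := inner_opposite_ne_zero K w hν1 hν hvF
  have hmeasK : MeasurableSet (hull K.1) := (isCompact_hull _).isClosed.measurableSet
  have hmeasF : MeasurableSet (hull (K.1.erase w)) := (isCompact_hull _).isClosed.measurableSet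
  have hFsub : K.1.erase w ⊆ K.1 := Finset.erase_subset _ _
  have hf : Continuous fun x => fderiv ℝ g x e :=
    (hg.continuous_fderiv one_ne_zero).clm_apply continuous_const
  have hFperp : ∀ x ∈ hull (K.1.erase w), inner ℝ ν (x - P.vertex) = 0 := by
    intro x hx
    rw [inner_eq_coord_mul K w hν hvF, ((mem_hull_subset_iff K hFsub x).1 hx).2 w (by simp),
      zero_mul]
  rw [← integral_indicator hmeasK, integral_eq_shear hν1 hne P.vertex
    ((hf.continuousOn.integrableOn_compact (isCompact_hull _)).integrable_indicator hmeasK),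
    setIntegral_facet_eq hd hν1 P.vertex hmeasF hFperp, neg_mul, ← mul_neg, ← integral_neg]
  congr 1
  refine integral_congr_ae (Filter.Eventually.of_forall fun y => ?_)
  simp only
  set z : Space d := P.vertex + (y : Space d) with hz
  have hyν : inner ℝ ν (y : Space d) = 0 := Submodule.mem_orthogonal_singleton_iff_inner_right.1 y.2
  have hzw : (bary K).coord w z = 0 := by
    have := inner_eq_coord_mul K w hν hvF z
    rw [hz, add_sub_cancel_left, hyν, eq_comm, mul_eq_zero] at this
    exact this.resolve_right hne
  set lam := (bary K).coord (apex K) z with hlam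
  have hcw : ∀ t : ℝ, (bary K).coord w (z + t • e) = t := by
    intro t; rw [he, bary_coord_add_smul, hzw]; simp [hw]
  have hca : ∀ t : ℝ, (bary K).coord (apex K) (z + t • e) = lam - t := by
    intro t; rw [he, bary_coord_add_smul, ← hlam]; simp [hw.symm]; ring
  have hco : ∀ t : ℝ, ∀ w', w' ≠ w → w' ≠ apex K →
      (bary K).coord w' (z + t • e) = (bary K).coord w' z := by
    intro t w' h1 h2; rw [he, bary_coord_add_smul]; simp [h1, h2]
  -- The line z + t e through a point z of the facet plane meets the simplex exactly for t ∈ [0,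
  -- lam] if z is in the facet, and not at all otherwise. Its far end lies on the facet opposite the
  -- central vertex, where g vanishes, so the fundamental theorem of calculus leaves only -g(z).
  by_cases hzF : z ∈ hull (K.1.erase w)
  · have hz0 := ((mem_hull_subset_iff K hFsub z).1 hzF).1
    have hlam0 : 0 ≤ lam := hz0 _
    have hmem : ∀ t : ℝ, z + t • e ∈ hull K.1 ↔ t ∈ Set.Icc 0 lam := by
      intro t
      rw [mem_hull_iff]
      constructor
      · intro h
        have h1 := h w
        have h2 := h (apex K)
        rw [hcw] at h1
        rw [hca] at h2
        exact ⟨h1, by linarith⟩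
      · rintro ⟨h1, h2⟩ w'
        rcases eq_or_ne w' w with rfl | hw1
        · rw [hcw]; exact h1
        rcases eq_or_ne w' (apex K) with rfl | hw2
        · rw [hca]; linarith
        rw [hco t w' hw1 hw2]; exact hz0 _
    have h1 : (fun t : ℝ => (hull K.1).indicator (fun x => fderiv ℝ g x e) (z + t • e)) =
        (Set.Icc 0 lam).indicator fun t => fderiv ℝ g (z + t • e) e := by
      ext t
      by_cases ht : t ∈ Set.Icc 0 lam
      · rw [Set.indicator_of_mem ht, Set.indicator_of_mem ((hmem t).2 ht)]
      · rw [Set.indicator_of_notMem ht, Set.indicator_of_notMem (fun h => ht ((hmem t).1 h))]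
    have hderiv : ∀ t : ℝ, HasDerivAt (fun t : ℝ => g (z + t • e)) (fderiv ℝ g (z + t • e) e) t := by
      intro t
      have h2 : HasDerivAt (fun t : ℝ => z + t • e) e t := by
        simpa using ((hasDerivAt_id t).smul_const e).const_add z
      exact ((hg.differentiable one_ne_zero) _).hasFDerivAt.comp_hasDerivAt t h2
    have hcont : Continuous fun t : ℝ => fderiv ℝ g (z + t • e) e := hf.comp (by fun_prop)
    rw [h1, integral_indicator measurableSet_Icc, integral_Icc_eq_integral_Ioc,
      ← intervalIntegral.integral_of_le hlam0,
      intervalIntegral.integral_eq_sub_of_hasDerivAt (fun t _ => hderiv t)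
        (hcont.intervalIntegrable _ _), Set.indicator_of_mem hzF]
    have h3 : g (z + lam • e) = 0 := by
      refine h0 _ ((mem_hull_subset_iff K (Finset.erase_subset _ _) _).2 ⟨?_, ?_⟩)
      · exact (mem_hull_iff K _).1 ((hmem lam).2 ⟨hlam0, le_rfl⟩)
      · intro w' hw'
        have : w' = apex K := by
          by_contra hcon
          exact hw' (Finset.mem_erase.2 ⟨fun h => hcon (Subtype.ext h), w'.2⟩)
        rw [this, hca, sub_self]
    simp [h3]
  · have hnot : ∀ t : ℝ, z + t • e ∉ hull K.1 := by
      intro t ht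
      apply hzF
      rw [mem_hull_iff] at ht
      have h1 := ht w
      have h2 := ht (apex K)
      rw [hcw] at h1
      rw [hca] at h2
      refine (mem_hull_subset_iff K hFsub z).2 ⟨fun w' => ?_, fun w' hw' => ?_⟩
      · rcases eq_or_ne w' w with rfl | hw1
        · rw [hzw]
        rcases eq_or_ne w' (apex K) with rfl | hw2
        · rw [← hlam]; linarith
        rw [← hco t w' hw1 hw2]; exact ht _
      · have : w' = w := by
          by_contra hcon
          exact hw' (Finset.mem_erase.2 ⟨fun h => hcon (Subtype.ext h), w'.2⟩)
        rw [this, hzw]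
    rw [Set.indicator_of_notMem hzF, neg_zero]
    exact integral_eq_zero_of_ae
      (Filter.Eventually.of_forall fun t => Set.indicator_of_notMem (hnot t) _)

/-- The sign of the outward normal of an element relative to the normal field. -/
def side (ν : P.facets → Space d) (F : P.facets) (K : P.elems) : ℝ :=
  (open Classical in if K ∈ minusElems ν F then 1 else 0) -
    (open Classical in if K ∈ plusElems ν F then 1 else 0)

theorem card_elem (K : P.elems) : K.1.card = d + 1 := (VertexPatch.mem_elems.1 K.2).1.2

theorem card_facet (F : P.facets) : F.1.card = d := by
  obtain ⟨_, _, _, h⟩ := VertexPatch.mem_facets.1 F.2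
  exact h

theorem exists_eq_erase {K : P.elems} {F : P.facets} (h : F.1 ⊆ K.1) :
    ∃ w : K.1, F.1 = K.1.erase w := by
  obtain ⟨w, hw, hwF⟩ := Finset.exists_mem_notMem_of_card_lt_card
    (s := F.1) (t := K.1) (by rw [card_elem, card_facet]; omega)
  refine ⟨⟨w, hw⟩, Finset.eq_of_subset_of_card_le (fun y hy => ?_) ?_⟩
  · exact Finset.mem_erase.2 ⟨fun e => hwF (e ▸ hy : (⟨w, hw⟩ : K.1).1 ∈ F.1), h hy⟩
  · rw [Finset.card_erase_of_mem hw, card_elem, card_facet]; omega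

theorem mem_plusElems_iff {ν : P.facets → Space d} (hν : IsNormalField P ν) {K : P.elems}
    {F : P.facets} (w : K.1) (hF : F.1 = K.1.erase w) {x₀ : Space d} (hx₀ : x₀ ∈ F.1) :
    K ∈ plusElems ν F ↔ 0 ≤ inner ℝ (ν F) ((w : Space d) - x₀) := by
  simp only [plusElems, Finset.mem_filter, Finset.mem_univ, true_and]
  constructor
  · exact fun h => h.2 x₀ hx₀ w w.2
  · intro h
    refine ⟨hF ▸ Finset.erase_subset _ _, fun x hx y hy => ?_⟩
    have h1 := inner_eq_coord_mul K w (hF ▸ (hν F).2) (hF ▸ hx) y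
    have h2 : inner ℝ (ν F) ((w : Space d) - x) = inner ℝ (ν F) ((w : Space d) - x₀) := by
      have := (hν F).2 x₀ hx₀ x hx
      rw [inner_sub_right] at this ⊢
      rw [inner_sub_right]; linarith
    rw [h1, h2]
    refine mul_nonneg ?_ h
    have := bary_coord_vertex K w ⟨y, hy⟩
    rw [this]; split_ifs <;> norm_num

theorem minusElems_eq (ν : P.facets → Space d) (F : P.facets) :
    minusElems ν F = plusElems (fun F => -ν F) F := by
  simp [minusElems, plusElems, inner_neg_left]

theorem IsNormalField.neg {ν : P.facets → Space d} (hν : IsNormalField P ν) :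
    IsNormalField P fun F => -ν F := fun F =>
  ⟨by rw [norm_neg]; exact (hν F).1, fun x hx y hy => by
    rw [inner_neg_left, (hν F).2 x hx y hy, neg_zero]⟩

theorem mem_minusElems_iff {ν : P.facets → Space d} (hν : IsNormalField P ν) {K : P.elems}
    {F : P.facets} (w : K.1) (hF : F.1 = K.1.erase w) {x₀ : Space d} (hx₀ : x₀ ∈ F.1) :
    K ∈ minusElems ν F ↔ inner ℝ (ν F) ((w : Space d) - x₀) ≤ 0 := by
  rw [minusElems_eq, mem_plusElems_iff hν.neg w hF hx₀, inner_neg_left, neg_nonneg]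

theorem side_mul_inner {ν : P.facets → Space d} (hν : IsNormalField P ν) {K : P.elems}
    {F : P.facets} (w : K.1) (hF : F.1 = K.1.erase w) {x₀ : Space d} (hx₀ : x₀ ∈ F.1) :
    side ν F K * inner ℝ (ν F) ((w : Space d) - x₀) = -|inner ℝ (ν F) ((w : Space d) - x₀)| := by
  simp only [side, mem_minusElems_iff hν w hF hx₀, mem_plusElems_iff hν w hF hx₀]
  rcases lt_trichotomy (inner ℝ (ν F) ((w : Space d) - x₀)) 0 with h | h | h
  · simp [h.le, h.not_ge, abs_of_neg h]
  · simp [h]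
  · simp [h.le, h.not_ge, abs_of_pos h]

theorem side_eq_zero {ν : P.facets → Space d} {K : P.elems} {F : P.facets} (h : ¬ F.1 ⊆ K.1) :
    side ν F K = 0 := by
  simp [side, minusElems, plusElems, h]

/-- The divergence theorem on an element of the patch, for functions that vanish on the facet
opposite to the central vertex. -/
theorem integral_fderiv_elem (hd : 1 ≤ d) {ν : P.facets → Space d} (hν : IsNormalField P ν)
    (K : P.elems) {g : Space d → ℝ} (hg : ContDiff ℝ 1 g)
    (h0 : ∀ x ∈ hull (K.1.erase P.vertex), g x = 0) (a : Space d) :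
    ∫ x in hull K.1, fderiv ℝ g x a =
      ∑ F : P.facets with P.vertex ∈ F.1, side ν F K * inner ℝ (ν F) a *
        ∫ x in hull F.1, g x ∂(Measure.euclideanHausdorffMeasure (d - 1)) := by
  set I : P.facets → ℝ := fun F =>
    ∫ x in hull F.1, g x ∂(Measure.euclideanHausdorffMeasure (d - 1)) with hI
  -- For an edge direction only the facet omitting w contributes: every other facet of K through the
  -- central vertex contains the whole edge, hence its normal is orthogonal to it.
  have key : ∀ w : K.1, ∫ x in hull K.1, fderiv ℝ g x ((w : Space d) - P.vertex) =
      ∑ F : P.facets with P.vertex ∈ F.1,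
        side ν F K * inner ℝ (ν F) ((w : Space d) - P.vertex) * I F := by
    intro w
    rcases eq_or_ne w (apex K) with rfl | hw
    · simp
    have hvw : P.vertex ≠ w := fun h => hw (Subtype.ext h.symm)
    have hmem : K.1.erase w ∈ P.facets := VertexPatch.mem_facets.2
      ⟨K.1, K.2, Finset.erase_subset _ _, by rw [Finset.card_erase_of_mem w.2, card_elem]; omega⟩
    have hvF : P.vertex ∈ K.1.erase w := Finset.mem_erase.2 ⟨hvw, (apex K).2⟩
    rw [Finset.sum_eq_single ⟨K.1.erase w, hmem⟩]
    · rw [side_mul_inner hν w rfl hvF, integral_fderiv_edge hd K w hw (hν ⟨_, hmem⟩).1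
        (hν ⟨_, hmem⟩).2 hg h0]
    · intro F hF hne
      rw [Finset.mem_filter] at hF
      by_cases hFK : F.1 ⊆ K.1
      · obtain ⟨w', hw'⟩ := exists_eq_erase hFK
        have hww : w.1 ∈ F.1 := by
          rw [hw']
          refine Finset.mem_erase.2 ⟨fun h => hne (Subtype.ext ?_), w.2⟩
          exact hw'.trans (congrArg K.1.erase h.symm)
        rw [(hν F).2 _ hF.2 _ hww]; simp
      · rw [side_eq_zero hFK]; simp
    · intro h
      exact absurd (Finset.mem_filter.2 ⟨Finset.mem_univ (⟨_, hmem⟩ : P.facets), hvF⟩) h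
  -- The edges from the central vertex span the space, and both sides are linear in the direction.
  obtain ⟨c, ha⟩ : ∃ c : K.1 → ℝ, a = ∑ w : K.1, c w • ((w : Space d) - P.vertex) := by
    refine ⟨fun w => (bary K).coord w (P.vertex + a), ?_⟩
    simp only [smul_sub, Finset.sum_sub_distrib, bary_sum_smul, ← Finset.sum_smul,
      (bary K).sum_coord_apply_eq_one, one_smul, add_sub_cancel_left]
  have hint : ∀ b : Space d, IntegrableOn (fun x => fderiv ℝ g x b) (hull K.1) := fun b =>
    ((hg.continuous_fderiv one_ne_zero).clm_apply
      continuous_const).continuousOn.integrableOn_compact (isCompact_hull _)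
  rw [ha]
  simp only [map_sum, map_smul, inner_sum, real_inner_smul_right]
  simp only [smul_eq_mul]
  rw [integral_finsetSum _ fun w _ => (hint _).const_mul (c w)]
  simp only [ integral_const_mul, key, Finset.mul_sum, Finset.sum_mul]
  rw [Finset.sum_comm]
  refine Finset.sum_congr rfl fun F _ => Finset.sum_congr rfl fun w _ => ?_
  ring

end

/-! ### Facets inside the patch: neighbouring elements and single-valued normal coefficients -/

section

variable {d b : ℕ} {P : VertexPatch d}

/-- A facet containing the central vertex has a relative interior point with a neighbourhood that
is covered by the patch and meets only elements and faces containing the facet. -/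
theorem exists_facet_ball (F : P.facets) (hvF : P.vertex ∈ F.1) :
    ∃ (x₀ : Space d) (r : ℝ), 0 < r ∧ x₀ ∈ hull F.1 ∧ Metric.ball x₀ r ⊆ interior P.carrier ∧
      ∀ K : P.elems, (¬ F.1 ⊆ K.1 → ∀ x ∈ Metric.ball x₀ r, x ∉ hull K.1) ∧
        (F.1 ⊆ K.1 → ∀ x ∈ Metric.ball x₀ r, ∀ w : K.1, w.1 ∈ F.1 → 0 < (bary K).coord w x) := by
  have hd : (0 : ℝ) < d := by
    have : 0 < F.1.card := Finset.card_pos.2 ⟨_, hvF⟩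
    rw [card_facet] at this
    exact_mod_cast this
  set wt : Space d → ℝ := fun _ => (d : ℝ)⁻¹ with hwt
  have hwt1 : ∑ i ∈ F.1, wt i = 1 := by
    rw [Finset.sum_const, card_facet, nsmul_eq_mul]
    exact mul_inv_cancel₀ hd.ne'
  set cb : Space d := F.1.affineCombination ℝ id wt with hcb
  have hcoord : ∀ K : P.elems, F.1 ⊆ K.1 → ∀ w : K.1,
      (bary K).coord w cb = if w.1 ∈ F.1 then (d : ℝ)⁻¹ else 0 := by
    intro K hFK w
    rw [hcb, Finset.map_affineCombination _ _ _ hwt1,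
      Finset.affineCombination_eq_linear_combination _ _ _ hwt1]
    have : ∀ y ∈ F.1, wt y • ((bary K).coord w ∘ id) y = if w.1 = y then (d : ℝ)⁻¹ else 0 := by
      intro y hy
      have := bary_coord_vertex K w ⟨y, hFK hy⟩
      simp only [Function.comp_apply, id] at this ⊢
      rw [this, hwt]
      simp [Subtype.ext_iff]
    rw [Finset.sum_congr rfl this, Finset.sum_ite_eq]
  -- A small move from the central vertex towards the centroid of the facet stays in the interior of
  -- the patch and makes all coordinates belonging to the facet positive.
  set pt : ℝ → Space d := fun ε => AffineMap.lineMap P.vertex cb ε with hpt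
  have hptc : Continuous pt := AffineMap.lineMap_continuous
  have hpt0 : pt 0 = P.vertex := AffineMap.lineMap_apply_zero _ _
  have hptcoord : ∀ ε : ℝ, ∀ K : P.elems, F.1 ⊆ K.1 → ∀ w : K.1, (bary K).coord w (pt ε) =
      (1 - ε) * (if w = apex K then 1 else 0) + ε * if w.1 ∈ F.1 then (d : ℝ)⁻¹ else 0 := by
    intro ε K hFK w
    rw [hpt]
    simp only
    rw [AffineMap.apply_lineMap, hcoord K hFK w, ← coe_apex K, bary_coord_vertex,
      AffineMap.lineMap_apply_ring]
  have hint : P.vertex ∈ interior P.carrier := by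
    have := P.vertex_interior
    simpa [VertexPatch.carrier, VertexPatch.elems] using this
  obtain ⟨ε, hε0, hε1, hεint⟩ : ∃ ε : ℝ, 0 < ε ∧ ε < 1 ∧ pt ε ∈ interior P.carrier := by
    have h1 : ∀ᶠ ε in nhds (0 : ℝ), pt ε ∈ interior P.carrier :=
      hptc.continuousAt.eventually_mem (isOpen_interior.mem_nhds (by rwa [hpt0]))
    obtain ⟨η, hη, hη'⟩ := Metric.eventually_nhds_iff.1 h1
    refine ⟨min (η / 2) (1 / 2), by positivity, ?_, hη' ?_⟩
    · exact (min_le_right _ _).trans_lt (by norm_num)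
    · rw [Real.dist_eq, sub_zero, abs_of_pos (by positivity)]
      exact (min_le_left _ _).trans_lt (by linarith)
  set x₀ := pt ε with hx₀
  have hpos : ∀ K : P.elems, F.1 ⊆ K.1 → ∀ w : K.1, w.1 ∈ F.1 → 0 < (bary K).coord w x₀ := by
    intro K hFK w hw
    rw [hptcoord ε K hFK w, if_pos hw]
    have : 0 ≤ (1 - ε) * (if w = apex K then (1 : ℝ) else 0) :=
      mul_nonneg (by linarith) (by split_ifs <;> norm_num)
    have : 0 < ε * (d : ℝ)⁻¹ := by positivity
    linarith
  obtain ⟨K₀, hK₀⟩ := facet_subset F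
  have hx₀F : x₀ ∈ hull F.1 := by
    refine (mem_hull_subset_iff K₀ hK₀ x₀).2 ⟨fun w => ?_, fun w hw => ?_⟩
    · by_cases hw : w.1 ∈ F.1
      · exact (hpos K₀ hK₀ w hw).le
      · rw [hptcoord ε K₀ hK₀ w, if_neg hw, if_neg (fun h => hw (by rw [h]; exact hvF))]; simp
    · rw [hptcoord ε K₀ hK₀ w, if_neg hw, if_neg (fun h => hw (by rw [h]; exact hvF))]; simp
  have hev : ∀ᶠ x in nhds x₀, x ∈ interior P.carrier ∧ ∀ K : P.elems, (¬ F.1 ⊆ K.1 → x ∉ hull K.1) ∧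
      (F.1 ⊆ K.1 → ∀ w : K.1, w.1 ∈ F.1 → 0 < (bary K).coord w x) := by
    refine Filter.Eventually.and (isOpen_interior.mem_nhds hεint) (Filter.eventually_all.2 fun K => ?_)
    by_cases hFK : F.1 ⊆ K.1
    · simp only [hFK, not_true_eq_false, false_implies, true_and, true_implies]
      refine Filter.eventually_all.2 fun w => ?_
      by_cases hw : w.1 ∈ F.1
      · simp only [hw, true_implies]
        have hc : Continuous ((bary K).coord w) := AffineMap.continuous_of_finiteDimensional _
        exact hc.continuousAt.eventually_mem (isOpen_Ioi.mem_nhds (hpos K hFK w hw))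
      · simp [hw]
    · simp only [hFK, not_false_eq_true, true_implies, false_implies, and_true]
      -- By conformity an element containing x₀ meets the facet in the common face, and a point with
      -- all facet coordinates positive lies in no proper face; so the element contains the facet.
      refine (isCompact_hull K.1).isClosed.isOpen_compl.mem_nhds fun hxK => hFK ?_
      have hKf := (VertexPatch.mem_elems.1 K.2).1.1
      have hFf : F.1 ∈ P.mesh.faces := by
        have := (P.mesh.isRelLowerSet_faces (VertexPatch.mem_elems.1 K₀.2).1.1).2
        exact this hK₀ ⟨_, hvF⟩
      have hx := P.mesh.inter_subset_convexHull hKf hFf ⟨hxK, hx₀F⟩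
      rw [← Finset.coe_inter] at hx
      have hx' := (mem_hull_subset_iff K₀ (Finset.inter_subset_right.trans hK₀) x₀).1 hx
      intro y hy
      by_contra hyK
      have h1 := hx'.2 ⟨y, hK₀ hy⟩ (fun h => hyK (Finset.mem_inter.1 h).1)
      have h2 := hpos K₀ hK₀ ⟨y, hK₀ hy⟩ hy
      linarith
  obtain ⟨r, hr, hball⟩ := Metric.eventually_nhds_iff_ball.1 hev
  exact ⟨x₀, r, hr, hx₀F, fun x hx => (hball x hx).1, fun K =>
    ⟨fun h x hx => ((hball x hx).2 K).1 h, fun h x hx => ((hball x hx).2 K).2 h⟩⟩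

theorem inner_hull_facet {ν : P.facets → Space d} (hν : IsNormalField P ν) {F : P.facets}
    {x₀ : Space d} (hx₀ : x₀ ∈ F.1) {x : Space d} (hx : x ∈ hull F.1) :
    inner ℝ (ν F) (x - x₀) = 0 := by
  obtain ⟨K, hK⟩ := facet_subset F
  obtain ⟨w, hw⟩ := exists_eq_erase hK
  rw [inner_eq_coord_mul K w (hw ▸ (hν F).2) (hw ▸ hx₀),
    ((mem_hull_subset_iff K hK x).1 hx).2 w (by simp [hw]), zero_mul]

/-- A point z slightly off the relative interior of the facet, on the positive side, is covered by
the patch, which gives existence. Every element on that side contains z, so by conformity two such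
elements share the opposite vertex as well and coincide. -/
theorem exists_plusElems_eq {ν : P.facets → Space d} (hν : IsNormalField P ν) {F : P.facets}
    (hvF : P.vertex ∈ F.1) : ∃ K, plusElems ν F = {K} := by
  obtain ⟨x₀, r, hr, hx₀, hcar, hK⟩ := exists_facet_ball F hvF
  set z : Space d := x₀ + (r / 2) • ν F with hz
  have hzb : z ∈ Metric.ball x₀ r := by
    rw [Metric.mem_ball, hz, dist_self_add_left, norm_smul, (hν F).1,
      Real.norm_of_nonneg (by positivity)]
    linarith
  have hzi : inner ℝ (ν F) (z - P.vertex) = r / 2 := by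
    have := inner_hull_facet hν hvF hx₀
    rw [hz, add_sub_right_comm, inner_add_right, this, real_inner_smul_right,
      real_inner_self_eq_norm_sq, (hν F).1]
    ring
  have hcoordz : ∀ (K : P.elems) (w : K.1), F.1 = K.1.erase w →
      (bary K).coord w z * inner ℝ (ν F) ((w : Space d) - P.vertex) = r / 2 := by
    intro K w hw
    rw [← hzi, inner_eq_coord_mul K w (hw ▸ (hν F).2) (hw ▸ hvF) z]
  have hzc := interior_subset (hcar hzb)
  rw [VertexPatch.carrier, Set.mem_iUnion₂] at hzc
  obtain ⟨K, hKe, hzK⟩ := hzc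
  have hFK : F.1 ⊆ K := by
    by_contra hcon
    exact (hK ⟨K, hKe⟩).1 hcon z hzb hzK
  obtain ⟨w, hw⟩ := exists_eq_erase (K := ⟨K, hKe⟩) hFK
  have hmem : (⟨K, hKe⟩ : P.elems) ∈ plusElems ν F := by
    rw [mem_plusElems_iff hν w hw hvF]
    have h1 := (mem_hull_iff ⟨K, hKe⟩ z).1 hzK w
    have h2 := hcoordz ⟨K, hKe⟩ w hw
    by_contra! hcon
    nlinarith
  have hin : ∀ K' ∈ plusElems ν F, ∀ w : K'.1, F.1 = K'.1.erase w →
      0 < (bary K').coord w z ∧ z ∈ hull K'.1 := by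
    intro K' hK' w hw
    have hFK' : F.1 ⊆ K'.1 := hw ▸ Finset.erase_subset _ _
    have h0 := (mem_plusElems_iff hν w hw hvF).1 hK'
    have h1 := hcoordz K' w hw
    have h2 : 0 < (bary K').coord w z := by
      by_contra! hcon
      nlinarith
    refine ⟨h2, (mem_hull_iff K' z).2 fun w' => ?_⟩
    rcases eq_or_ne w' w with rfl | hne
    · exact h2.le
    · refine ((hK K').2 hFK' z hzb w' ?_).le
      rw [hw]
      exact Finset.mem_erase.2 ⟨fun h => hne (Subtype.ext h), w'.2⟩
  refine ⟨⟨K, hKe⟩, Finset.eq_singleton_iff_unique_mem.2 ⟨hmem, fun K' hK' => ?_⟩⟩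
  have hFK' : F.1 ⊆ K'.1 := (Finset.mem_filter.1 hK').2.1
  obtain ⟨w', hw'⟩ := exists_eq_erase hFK'
  obtain ⟨h1, h2⟩ := hin K' hK' w' hw'
  have hx := P.mesh.inter_subset_convexHull (VertexPatch.mem_elems.1 K'.2).1.1
    (VertexPatch.mem_elems.1 hKe).1.1 ⟨h2, hzK⟩
  rw [← Finset.coe_inter] at hx
  have hx' := (mem_hull_subset_iff K' Finset.inter_subset_left z).1 hx
  have hwK : w'.1 ∈ K := by
    by_contra hcon
    have := hx'.2 w' fun h => hcon (Finset.mem_inter.1 h).2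
    linarith
  refine Subtype.ext (Finset.eq_of_subset_of_card_le (fun y hy => ?_) ?_)
  · by_cases hyw : y = w'.1
    · rw [hyw]; exact hwK
    · exact hFK (hw' ▸ Finset.mem_erase.2 ⟨hyw, hy⟩)
  · rw [card_elem K', card_elem ⟨K, hKe⟩]

theorem exists_minusElems_eq {ν : P.facets → Space d} (hν : IsNormalField P ν) {F : P.facets}
    (hvF : P.vertex ∈ F.1) : ∃ K, minusElems ν F = {K} := by
  rw [minusElems_eq]
  exact exists_plusElems_eq hν.neg hvF

/-- The coefficients in normal direction are single-valued on the facets inside the patch. -/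
theorem dir_normal_eq (hd : 1 ≤ d) {ν : P.facets → Space d} (hν : IsNormalField P ν)
    {c : Coefficients P b} {g₀ Λ c₀ : ℝ} (hc : c.Admissible g₀ Λ c₀) {F : P.facets}
    (hvF : P.vertex ∈ F.1) {Kp Km : P.elems} (hp : plusElems ν F = {Kp})
    (hm : minusElems ν F = {Km}) : c.dir Kp (ν F) = c.dir Km (ν F) := by
  obtain ⟨x₀, r, hr, hx₀, hcar, hK⟩ := exists_facet_ball F hvF
  -- Tested with a bump whose support meets no other facet, the distributional equation reduces to a
  -- positive multiple of the difference of the two normal matrices.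
  let φ : ContDiffBump x₀ := ⟨r / 4, r / 2, by positivity, by linarith⟩
  set ψ : Space d → ℝ := (φ : Space d → ℝ) with hψ
  have hψs : ContDiff ℝ ∞ ψ := φ.contDiff
  have hψz : ∀ x, x ∉ Metric.ball x₀ r → ψ x = 0 := by
    intro x hx
    refine φ.zero_of_le_dist ?_
    rw [Metric.mem_ball, not_lt] at hx
    change r / 2 ≤ dist x x₀
    linarith
  have hts : tsupport ψ ⊆ interior P.carrier := by
    rw [hψ, φ.tsupport_eq]
    refine (Metric.closedBall_subset_ball ?_).trans hcar
    change r / 2 < r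
    linarith
  have h := hc.div_free ψ hψs φ.hasCompactSupport hts
  have hface : ∀ (K : P.elems) (G : Finset (Space d)), G ⊆ K.1 → ¬ F.1 ⊆ G →
      ∀ x ∈ hull G, ψ x = 0 := by
    intro K G hGK hFG x hx
    refine hψz x fun hxb => ?_
    by_cases hFK : F.1 ⊆ K.1
    · obtain ⟨y, hyF, hyG⟩ := Finset.not_subset.1 hFG
      have h1 := (hK K).2 hFK x hxb ⟨y, hFK hyF⟩ hyF
      have h2 := ((mem_hull_subset_iff K hGK x).1 hx).2 ⟨y, hFK hyF⟩ hyG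
      linarith
    · exact (hK K).1 hFK x hxb (convexHull_mono (by exact_mod_cast hGK) hx)
  set I : ℝ := ∫ x in hull F.1, ψ x ∂(Measure.euclideanHausdorffMeasure (d - 1)) with hI
  have helem : ∀ (K : P.elems) (a : Space d), ∫ x in hull K.1, fderiv ℝ ψ x a =
      side ν F K * inner ℝ (ν F) a * I := by
    intro K a
    rw [integral_fderiv_elem hd hν K (hψs.of_le (by exact_mod_cast le_top))
      (hface K _ (Finset.erase_subset _ _) fun h => by simpa using h hvF) a,
      Finset.sum_eq_single F]
    · intro F' _ hne
      obtain ⟨K', hK'⟩ := facet_subset F'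
      have : ¬ F.1 ⊆ F'.1 := fun h => hne (Subtype.ext
        (Finset.eq_of_subset_of_card_le h (by rw [card_facet, card_facet])).symm)
      rw [setIntegral_eq_zero_of_forall_eq_zero (hface K' _ hK' this), mul_zero]
    · intro h
      exact absurd (Finset.mem_filter.2 ⟨Finset.mem_univ F, hvF⟩) h
  have hIpos : 0 < I := by
    have hperp : ∀ x ∈ hull F.1, inner ℝ (ν F) (x - x₀) = 0 := by
      intro x hx
      have h1 := inner_hull_facet hν hvF hx
      have h2 := inner_hull_facet hν hvF hx₀
      rw [← sub_sub_sub_cancel_right x x₀ P.vertex, inner_sub_right, h1, h2, sub_zero]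
    rw [hI, setIntegral_facet_eq hd (hν F).1 x₀ (isCompact_hull _).isClosed.measurableSet hperp]
    -- Within the plane of F the ball around x₀ lies in F, so restricting to F cuts off nothing and
    -- the integral of the bump over the plane is positive.
    have heq : ∀ y : (ℝ ∙ ν F)ᗮ, (hull F.1).indicator ψ (x₀ + y) = ψ (x₀ + y) := by
      intro y
      by_cases hy : x₀ + (y : Space d) ∈ Metric.ball x₀ r
      · refine Set.indicator_of_mem ?_ _
        obtain ⟨K, hFK⟩ := facet_subset F
        obtain ⟨w, hw⟩ := exists_eq_erase hFK
        have hyν : inner ℝ (ν F) (y : Space d) = 0 :=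
          Submodule.mem_orthogonal_singleton_iff_inner_right.1 y.2
        have h1 := inner_eq_coord_mul K w (hw ▸ (hν F).2) (hw ▸ hvF) (x₀ + y)
        rw [add_sub_right_comm, inner_add_right, inner_hull_facet hν hvF hx₀, hyν, add_zero,
          eq_comm, mul_eq_zero] at h1
        have h2 := h1.resolve_right
          (inner_opposite_ne_zero K w (hν F).1 (hw ▸ (hν F).2) (hw ▸ hvF))
        have h3 : ∀ w' : K.1, w'.1 ∉ F.1 → w' = w := by
          intro w' hw'
          by_contra hcon
          exact hw' (hw ▸ Finset.mem_erase.2 ⟨fun h => hcon (Subtype.ext h), w'.2⟩)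
        refine (mem_hull_subset_iff K hFK _).2 ⟨fun w' => ?_, fun w' hw' => by rw [h3 w' hw', h2]⟩
        by_cases hw' : w'.1 ∈ F.1
        · exact ((hK K).2 hFK _ hy w' hw').le
        · rw [h3 w' hw', h2]
      · rw [hψz _ hy]
        by_cases h : x₀ + (y : Space d) ∈ hull F.1
        · rw [Set.indicator_of_mem h, hψz _ hy]
        · rw [Set.indicator_of_notMem h]
    simp_rw [heq]
    have hiso : Isometry (fun y : (ℝ ∙ ν F)ᗮ => x₀ + (y : Space d)) :=
      (isometry_add_left x₀).comp isometry_subtype_coe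
    refine Continuous.integral_pos_of_hasCompactSupport_nonneg_nonzero
      (x := (0 : (ℝ ∙ ν F)ᗮ)) (φ.continuous.comp hiso.continuous)
      (φ.hasCompactSupport.comp_isClosedEmbedding hiso.isClosedEmbedding)
      (fun y => φ.nonneg) ?_
    have : φ x₀ = 1 := φ.one_of_mem_closedBall (Metric.mem_closedBall_self φ.rIn_pos.le)
    simp [hψ, this]
  have hsum : ∑ K : P.elems, (side ν F K * I) • c.dir K (ν F) = 0 := by
    rw [← h]
    refine Finset.sum_congr rfl fun K _ => ?_
    rw [Coefficients.dir, Finset.smul_sum]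
    refine Finset.sum_congr rfl fun j _ => ?_
    rw [helem, smul_smul]
    congr 1
    simp [EuclideanSpace.inner_single_right]
    ring
  simp only [side, hp, hm, Finset.mem_singleton, sub_mul, ite_mul, one_mul, zero_mul, sub_smul,
    Finset.sum_sub_distrib, ite_smul, zero_smul, Finset.sum_ite_eq', Finset.mem_univ, if_true] at hsum
  rw [← smul_sub, smul_eq_zero, sub_eq_zero] at hsum
  exact (hsum.resolve_left hIpos.ne').symm

end

/-! ### Polynomials and the inverse inequality -/

section

section Polynomial

variable {d p : ℕ}

/-- The value of a polynomial at a point of the physical space. -/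
def peval (q : MvPolynomial (Fin d) ℝ) (x : Space d) : ℝ := MvPolynomial.eval (fun i => x i) q

theorem continuous_peval (q : MvPolynomial (Fin d) ℝ) : Continuous (peval q) :=
  (MvPolynomial.continuous_eval _).comp (by fun_prop)

theorem hasFDerivAt_peval (q : MvPolynomial (Fin d) ℝ) (x : Space d) :
    HasFDerivAt (peval q)
      (∑ j, peval (MvPolynomial.pderiv j q) x • (EuclideanSpace.proj j : Space d →L[ℝ] ℝ)) x := by
  induction q using MvPolynomial.induction_on with
  | C a =>
    have : peval (MvPolynomial.C a) = fun _ : Space d => a := by ext; simp [peval]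
    rw [this]
    refine (hasFDerivAt_const a x).congr_fderiv ?_
    simp [peval]
  | add q q' hq hq' =>
    have : peval (q + q') = fun y => peval q y + peval q' y := by ext; simp [peval]
    rw [this]
    refine (hq.add hq').congr_fderiv ?_
    simp [peval, add_smul, Finset.sum_add_distrib]
  | mul_X q i hq =>
    have : peval (q * MvPolynomial.X i) = fun y => peval q y * y i := by ext; simp [peval]
    rw [this]
    refine (hq.mul (EuclideanSpace.proj i : Space d →L[ℝ] ℝ).hasFDerivAt).congr_fderiv ?_
    have hd : ∀ j, peval (MvPolynomial.pderiv j (q * MvPolynomial.X i)) x =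
        peval (MvPolynomial.pderiv j q) x * x i + peval q x * if i = j then 1 else 0 := by
      intro j
      simp only [peval, MvPolynomial.pderiv_mul, MvPolynomial.pderiv_X, Pi.single_apply, map_add,
        map_mul, MvPolynomial.eval_X]
      split_ifs <;> simp
    ext a
    simp only [hd, add_apply, smul_apply,
      sum_apply, smul_eq_mul, add_mul, Finset.sum_add_distrib, Finset.mul_sum,
      mul_ite, mul_one, mul_zero, ite_mul, zero_mul, Finset.sum_ite_eq, Finset.mem_univ, if_true]
    rw [add_comm]
    congr 1
    refine Finset.sum_congr rfl fun j _ => ?_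
    rw [show (EuclideanSpace.proj i : Space d →L[ℝ] ℝ) x = x i from rfl]
    ring

theorem fderiv_peval (q : MvPolynomial (Fin d) ℝ) (x a : Space d) :
    fderiv ℝ (peval q) x a = ∑ j, peval (MvPolynomial.pderiv j q) x * a j := by
  rw [(hasFDerivAt_peval q x).fderiv]
  simp

theorem contDiff_peval (q : MvPolynomial (Fin d) ℝ) {n : WithTop ℕ∞} : ContDiff ℝ n (peval q) := by
  induction q using MvPolynomial.induction_on with
  | C a =>
    have : peval (MvPolynomial.C a) = fun _ : Space d => a := by ext; simp [peval]
    rw [this]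
    exact contDiff_const
  | add q q' hq hq' =>
    have : peval (q + q') = fun y => peval q y + peval q' y := by ext; simp [peval]
    rw [this]
    exact hq.add hq'
  | mul_X q i hq =>
    have : peval (q * MvPolynomial.X i) = fun y => peval q y * y i := by ext; simp [peval]
    rw [this]
    exact hq.mul (EuclideanSpace.proj i : Space d →L[ℝ] ℝ).contDiff

theorem totalDegree_pderiv_le (q : MvPolynomial (Fin d) ℝ) (j : Fin d) :
    (MvPolynomial.pderiv j q).totalDegree ≤ q.totalDegree - 1 := by
  conv_lhs => rw [q.as_sum, map_sum]
  refine MvPolynomial.totalDegree_finsetSum_le fun s hs => ?_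
  rw [MvPolynomial.pderiv_monomial]
  by_cases hsj : s j = 0
  · simp [hsj]
  refine (MvPolynomial.totalDegree_monomial_le _ _).trans ?_
  have h1 : s.degree ≤ q.totalDegree := by
    rw [Finsupp.degree_eq_sum]
    have := MvPolynomial.le_totalDegree hs
    rwa [Finsupp.sum_fintype _ _ (by simp)] at this
  have h2 : s - Finsupp.single j 1 + Finsupp.single j 1 = s :=
    tsub_add_cancel_of_le (by simpa [Finsupp.single_le_iff] using Nat.one_le_iff_ne_zero.2 hsj)
  have h3 := congrArg Finsupp.degree h2
  rw [map_add, Finsupp.degree_single] at h3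
  have h4 : (s - Finsupp.single j 1).sum (fun _ e => e) = (s - Finsupp.single j 1).degree := by
    rw [Finsupp.degree_eq_sum, Finsupp.sum_fintype _ _ (by simp)]
  change (s - Finsupp.single j 1).sum (fun _ e => e) ≤ _
  omega

/-- The pullback of a polynomial under `y ↦ x₀ + ρ y`. -/
def rescale (x₀ : Space d) (ρ : ℝ) : MvPolynomial (Fin d) ℝ →ₐ[ℝ] MvPolynomial (Fin d) ℝ :=
  MvPolynomial.aeval fun i => MvPolynomial.C (x₀ i) + MvPolynomial.C ρ * MvPolynomial.X i

theorem peval_rescale (x₀ : Space d) (ρ : ℝ) (q : MvPolynomial (Fin d) ℝ) (y : Space d) :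
    peval (rescale x₀ ρ q) y = peval q (x₀ + ρ • y) := by
  induction q using MvPolynomial.induction_on with
  | C a => simp [peval, rescale]
  | add q q' hq hq' => simp only [peval, map_add] at *; rw [hq, hq']
  | mul_X q i hq =>
    simp only [peval, map_mul] at *
    rw [hq]
    simp [rescale]

theorem pderiv_rescale (x₀ : Space d) (ρ : ℝ) (q : MvPolynomial (Fin d) ℝ) (j : Fin d) :
    MvPolynomial.pderiv j (rescale x₀ ρ q) =
      MvPolynomial.C ρ * rescale x₀ ρ (MvPolynomial.pderiv j q) := by
  induction q using MvPolynomial.induction_on with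
  | C a => simp [rescale]
  | add q q' hq hq' => simp only [map_add, hq, hq', mul_add]
  | mul_X q i hq =>
    have hX : MvPolynomial.pderiv j (rescale x₀ ρ (MvPolynomial.X i)) =
        MvPolynomial.C ρ * rescale x₀ ρ (MvPolynomial.pderiv j (MvPolynomial.X i)) := by
      simp only [rescale, MvPolynomial.aeval_X, map_add, MvPolynomial.pderiv_C,
        MvPolynomial.pderiv_C_mul, zero_add, MvPolynomial.pderiv_X, Pi.single_apply]
      split_ifs <;> simp
    simp only [map_mul, MvPolynomial.pderiv_mul, map_add, hq, hX]
    ring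

theorem totalDegree_rescale_le (x₀ : Space d) (ρ : ℝ) (q : MvPolynomial (Fin d) ℝ) :
    (rescale x₀ ρ q).totalDegree ≤ q.totalDegree := by
  have hlin : ∀ i, (MvPolynomial.C (x₀ i) + MvPolynomial.C ρ * MvPolynomial.X i :
      MvPolynomial (Fin d) ℝ).totalDegree ≤ 1 := by
    intro i
    refine (MvPolynomial.totalDegree_add _ _).trans (max_le (by simp) ?_)
    refine (MvPolynomial.totalDegree_mul _ _).trans ?_
    simp
  rw [rescale, MvPolynomial.aeval_def, MvPolynomial.eval₂_eq]
  refine MvPolynomial.totalDegree_finsetSum_le fun s hs => ?_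
  refine (MvPolynomial.totalDegree_mul _ _).trans ?_
  rw [MvPolynomial.algebraMap_eq, MvPolynomial.totalDegree_C, zero_add]
  refine (MvPolynomial.totalDegree_finsetProd _ _).trans ?_
  refine le_trans (Finset.sum_le_sum fun i _ => (MvPolynomial.totalDegree_pow _ _).trans
    (Nat.mul_le_mul_left _ (hlin i))) ?_
  simp only [mul_one]
  exact MvPolynomial.le_totalDegree hs

theorem peval_eq_zero_of_ball {q : MvPolynomial (Fin d) ℝ}
    (h : ∀ x ∈ Metric.ball (0 : Space d) 1, peval q x = 0) : q = 0 := by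
  have hopen : IsOpen ((WithLp.toLp 2 : (Fin d → ℝ) → Space d) ⁻¹' Metric.ball 0 1) :=
    Metric.isOpen_ball.preimage (PiLp.continuous_toLp 2 _)
  obtain ⟨ε, hε, hball⟩ := Metric.isOpen_iff.1 hopen 0 (by simp)
  refine MvPolynomial.funext_set (fun i => Metric.ball 0 ε) (fun i => ?_) ?_
  · rw [Real.ball_eq_Ioo]
    exact Set.Ioo_infinite (by linarith)
  · intro x hx
    have := h (WithLp.toLp 2 x) (hball (by rw [ball_pi _ hε]; exact hx))
    simpa [peval] using this

/-- Inverse estimate on the unit ball: all norms on a finite-dimensional space are equivalent. -/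
theorem exists_inverse_estimate_unit (d p : ℕ) (R : ℝ) : ∃ C : ℝ, 0 < C ∧
    ∀ q : MvPolynomial (Fin d) ℝ, q.totalDegree ≤ p → ∀ j,
      ∫ x in Metric.closedBall (0 : Space d) R, peval (MvPolynomial.pderiv j q) x ^ 2 ≤
        C * ∫ x in Metric.closedBall (0 : Space d) 1, peval q x ^ 2 := by
  set W := MvPolynomial.restrictTotalDegree (Fin d) ℝ p
  set B := Module.finBasis ℝ W
  set n := Module.finrank ℝ W
  set β : Fin n → MvPolynomial (Fin d) ℝ := fun i => (B i : MvPolynomial (Fin d) ℝ) with hβ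
  have hcomp : ∀ r : ℝ, IsCompact (Metric.closedBall (0 : Space d) r) := fun r =>
    isCompact_closedBall _ _
  have hI : ∀ (f : Space d → ℝ) (r : ℝ), Continuous f →
      IntegrableOn f (Metric.closedBall (0 : Space d) r) := fun f r hf =>
    hf.continuousOn.integrableOn_compact (hcomp r)
  -- The L² Gram matrix of a basis on the unit ball; it is positive definite since a polynomial
  -- vanishing on the ball is zero. Its lower bound σ controls the coefficients of q.
  set H : Matrix (Fin n) (Fin n) ℝ := fun k l =>
    ∫ x in Metric.closedBall (0 : Space d) 1, peval (β k) x * peval (β l) x with hH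
  have hsumv : ∀ (w : Fin n → ℝ) x, peval (∑ i, w i • β i) x = ∑ i, w i * peval (β i) x := by
    intro w x; simp [peval, MvPolynomial.smul_eval]
  have hquad : ∀ w : Fin n → ℝ, w ⬝ᵥ (H *ᵥ w) =
      ∫ x in Metric.closedBall (0 : Space d) 1, peval (∑ i, w i • β i) x ^ 2 := by
    intro w
    simp_rw [hsumv, sq, Finset.sum_mul_sum]
    have hcp : ∀ k l, Continuous fun x : Space d =>
        w k * peval (β k) x * (w l * peval (β l) x) := fun k l =>
      (continuous_const.mul (continuous_peval _)).mul (continuous_const.mul (continuous_peval _))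
    rw [integral_finsetSum]
    swap
    · exact fun k _ => hI _ _ (continuous_finsetSum _ fun l _ => hcp k l)
    simp only [dotProduct, Matrix.mulVec, Finset.mul_sum]
    refine Finset.sum_congr rfl fun k _ => ?_
    rw [integral_finsetSum]
    swap
    · exact fun l _ => hI _ _ (hcp k l)
    refine Finset.sum_congr rfl fun l _ => ?_
    rw [hH]
    simp only
    rw [← integral_mul_const, ← integral_const_mul]
    exact integral_congr_ae (Filter.Eventually.of_forall fun x => by simp only; ring)
  have hpos : ∀ w : Fin n → ℝ, w ≠ 0 → 0 < w ⬝ᵥ (H *ᵥ w) := by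
    intro w hw
    rw [hquad]
    set q := ∑ i, w i • β i with hq
    have hnn : 0 ≤ ∫ x in Metric.closedBall (0 : Space d) 1, peval q x ^ 2 :=
      integral_nonneg fun x => sq_nonneg _
    refine lt_of_le_of_ne hnn fun h0 => hw ?_
    have hc : Continuous fun x => peval q x ^ 2 := (continuous_peval q).pow 2
    have h1 := (setIntegral_eq_zero_iff_of_nonneg_ae (Filter.Eventually.of_forall fun x =>
      sq_nonneg (peval q x)) (hI _ _ hc)).1 h0.symm
    have h2 := Measure.eqOn_open_of_ae_eq (ae_restrict_of_ae_restrict_of_subset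
      Metric.ball_subset_closedBall h1) Metric.isOpen_ball hc.continuousOn continuousOn_const
    have h3 : q = 0 := peval_eq_zero_of_ball fun x hx => by simpa using h2 hx
    have h4 : ∑ i, w i • B i = 0 := by
      apply Subtype.ext
      rw [hq] at h3
      simpa [hβ] using h3
    exact funext fun i => Fintype.linearIndependent_iff.1 B.linearIndependent w h4 i
  obtain ⟨σ, hσ, hσH⟩ := exists_lower_bound_of_dotProduct_pos H hpos
  set E : ℝ := ∑ j : Fin d, ∑ i : Fin n, ∫ x in Metric.closedBall (0 : Space d) R,
    peval (MvPolynomial.pderiv j (β i)) x ^ 2 with hE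
  have hE0 : 0 ≤ E := Finset.sum_nonneg fun j _ => Finset.sum_nonneg fun i _ =>
    integral_nonneg fun x => sq_nonneg _
  -- E collects the derivative norms of all basis elements on the large ball; adding 1 keeps the
  -- constant positive even if E = 0.
  refine ⟨(E + 1) / σ, by positivity, fun q hq j => ?_⟩
  set w : Fin n → ℝ := fun i => B.repr ⟨q, (MvPolynomial.mem_restrictTotalDegree _ _ _).2 hq⟩ i
  have hqw : q = ∑ i, w i • β i := by
    have := congrArg Subtype.val
      (B.sum_repr ⟨q, (MvPolynomial.mem_restrictTotalDegree _ _ _).2 hq⟩)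
    rw [AddSubmonoidClass.coe_finsetSum] at this
    exact this.symm
  have hderiv : ∀ x, peval (MvPolynomial.pderiv j q) x ^ 2 ≤
      (w ⬝ᵥ w) * ∑ i, peval (MvPolynomial.pderiv j (β i)) x ^ 2 := by
    intro x
    have : peval (MvPolynomial.pderiv j q) x = ∑ i, w i * peval (MvPolynomial.pderiv j (β i)) x := by
      rw [hqw]; simp [peval, MvPolynomial.smul_eval]
    rw [this]
    refine (Finset.sum_mul_sq_le_sq_mul_sq _ _ _).trans_eq ?_
    simp [dotProduct, sq]
  have hww : 0 ≤ w ⬝ᵥ w := Finset.sum_nonneg fun i _ => mul_self_nonneg _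
  have hcd : ∀ i, Continuous fun x : Space d => peval (MvPolynomial.pderiv j (β i)) x ^ 2 :=
    fun i => (continuous_peval _).pow 2
  calc ∫ x in Metric.closedBall (0 : Space d) R, peval (MvPolynomial.pderiv j q) x ^ 2
      ≤ ∫ x in Metric.closedBall (0 : Space d) R,
          (w ⬝ᵥ w) * ∑ i, peval (MvPolynomial.pderiv j (β i)) x ^ 2 :=
        integral_mono (hI _ _ ((continuous_peval _).pow 2))
          (hI _ _ (continuous_const.mul (continuous_finsetSum _ fun i _ => hcd i))) hderiv
    _ = (w ⬝ᵥ w) * ∑ i, ∫ x in Metric.closedBall (0 : Space d) R,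
          peval (MvPolynomial.pderiv j (β i)) x ^ 2 := by
        rw [integral_const_mul, integral_finsetSum _ fun i _ => hI _ _ (hcd i)]
    _ ≤ (w ⬝ᵥ w) * (E + 1) := by
        gcongr
        have : _ ≤ E := Finset.single_le_sum (f := fun j => ∑ i : Fin n, ∫ x in Metric.closedBall
          (0 : Space d) R, peval (MvPolynomial.pderiv j (β i)) x ^ 2)
          (fun j _ => Finset.sum_nonneg fun i _ => integral_nonneg fun x => sq_nonneg _)
          (Finset.mem_univ j)
        exact this.trans (by linarith)
    _ = (E + 1) / σ * (σ * (w ⬝ᵥ w)) := by field_simp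
    _ ≤ (E + 1) / σ * (w ⬝ᵥ (H *ᵥ w)) := by gcongr; exact hσH w
    _ = _ := by rw [hquad, ← hqw]

theorem setIntegral_closedBall_rescale {ρ : ℝ} (hρ : 0 < ρ) (x₀ : Space d) (r : ℝ)
    (f : Space d → ℝ) :
    ∫ y in Metric.closedBall (0 : Space d) r, f (x₀ + ρ • y) =
      (ρ ^ d)⁻¹ * ∫ x in Metric.closedBall x₀ (r * ρ), f x := by
  have h1 := Measure.setIntegral_comp_smul_of_pos volume (fun z => f (x₀ + z))
    (Metric.closedBall (0 : Space d) r) hρ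
  rw [h1, finrank_euclideanSpace, Fintype.card_fin, smul_eq_mul, _root_.smul_closedBall' hρ.ne',
    smul_zero, Real.norm_of_nonneg hρ.le]
  congr 1
  rw [← (measurePreserving_add_left volume x₀).setIntegral_preimage_emb
    (measurableEmbedding_addLeft x₀) f]
  congr 2
  ext z
  simp [mul_comm]

/-- Inverse estimate for a set that is comparable with a ball. -/
theorem exists_inverse_estimate (d p : ℕ) (R : ℝ) : ∃ C : ℝ, 0 < C ∧
    ∀ (s : Set (Space d)) (x₀ : Space d) (ρ : ℝ), 0 < ρ → IsCompact s →
      Metric.closedBall x₀ ρ ⊆ s → s ⊆ Metric.closedBall x₀ (R * ρ) →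
      ∀ q : MvPolynomial (Fin d) ℝ, q.totalDegree ≤ p → ∀ j,
        ∫ x in s, peval (MvPolynomial.pderiv j q) x ^ 2 ≤ C / ρ ^ 2 * ∫ x in s, peval q x ^ 2 := by
  obtain ⟨C, hC, H⟩ := exists_inverse_estimate_unit d p R
  refine ⟨C, hC, fun s x₀ ρ hρ hs h1 h2 q hq j => ?_⟩
  have hI : ∀ (q : MvPolynomial (Fin d) ℝ) (s : Set (Space d)), IsCompact s →
      IntegrableOn (fun x => peval q x ^ 2) s := fun q s hs =>
    ((continuous_peval q).pow 2).continuousOn.integrableOn_compact hs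
  have hmono : ∀ (q : MvPolynomial (Fin d) ℝ) (s t : Set (Space d)), IsCompact t → s ⊆ t →
      ∫ x in s, peval q x ^ 2 ≤ ∫ x in t, peval q x ^ 2 := fun q s t ht hst =>
    setIntegral_mono_set (hI q t ht) (Filter.Eventually.of_forall fun x => sq_nonneg _)
      (Filter.Eventually.of_forall hst)
  -- Pulled back to the unit ball, the derivative gains a factor ρ while the volume factors ρ^d
  -- cancel. The set is then squeezed between the balls of radius ρ and R ρ.
  have h3 := H (rescale x₀ ρ q) ((totalDegree_rescale_le x₀ ρ q).trans hq) j
  simp only [pderiv_rescale] at h3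
  have h4 : ∀ y, peval (MvPolynomial.C ρ * rescale x₀ ρ (MvPolynomial.pderiv j q)) y ^ 2 =
      ρ ^ 2 * peval (MvPolynomial.pderiv j q) (x₀ + ρ • y) ^ 2 := by
    intro y
    rw [← peval_rescale, ← mul_pow]
    simp [peval]
  simp only [h4, peval_rescale] at h3
  rw [integral_const_mul, setIntegral_closedBall_rescale hρ x₀ R
      (fun x => peval (MvPolynomial.pderiv j q) x ^ 2),
    setIntegral_closedBall_rescale hρ x₀ 1 (fun x => peval q x ^ 2), one_mul] at h3
  have h5 : ∫ x in Metric.closedBall x₀ (R * ρ), peval (MvPolynomial.pderiv j q) x ^ 2 ≤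
      C / ρ ^ 2 * ∫ x in Metric.closedBall x₀ ρ, peval q x ^ 2 := by
    have h6 : 0 < ρ ^ d := by positivity
    rw [div_mul_eq_mul_div, le_div_iff₀ (by positivity)]
    rw [← mul_le_mul_iff_right₀ (inv_pos.2 h6)]
    calc _ = ρ ^ 2 * ((ρ ^ d)⁻¹ * ∫ x in Metric.closedBall x₀ (R * ρ),
          peval (MvPolynomial.pderiv j q) x ^ 2) := by ring
      _ ≤ _ := h3
      _ = _ := by ring
  refine (hmono _ _ _ (isCompact_closedBall _ _) h2).trans (h5.trans ?_)
  exact mul_le_mul_of_nonneg_left (hmono _ _ _ hs h1) (by positivity)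

end Polynomial

end

/-! ### The tent height as a polynomial, and integration by parts of the DG form -/

section

variable {d b p : ℕ} {P : VertexPatch d}

theorem val_eq_peval (v : DGSpace P b p) (K : P.elems) (x : Space d) (l : Fin b) :
    val v K x l = peval (v K l : MvPolynomial (Fin d) ℝ) x := rfl

theorem pdv_eq_peval (v : DGSpace P b p) (K : P.elems) (j : Fin d) (x : Space d) (l : Fin b) :
    pdv v K j x l = peval (MvPolynomial.pderiv j (v K l : MvPolynomial (Fin d) ℝ)) x := rfl

theorem totalDegree_dg_le (v : DGSpace P b p) (K : P.elems) (l : Fin b) :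
    (v K l : MvPolynomial (Fin d) ℝ).totalDegree ≤ p :=
  (MvPolynomial.mem_restrictTotalDegree _ _ _).1 (v K l).2

theorem mem_apex {K : P.elems} : P.vertex ∈ K.1 := (VertexPatch.mem_elems.1 K.2).2

namespace Tent

/-- The affine function that agrees with `δ` on an element, as a polynomial. -/
def δpoly (t : Tent P) (K : P.elems) : MvPolynomial (Fin d) ℝ :=
  MvPolynomial.C (t.δ P.vertex - inner ℝ (t.gradδ K) P.vertex) +
    ∑ j, MvPolynomial.C (t.gradδ K j) * MvPolynomial.X j

theorem peval_δpoly (t : Tent P) (K : P.elems) (x : Space d) :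
    peval (t.δpoly K) x = t.δ P.vertex + inner ℝ (t.gradδ K) (x - P.vertex) := by
  have : inner ℝ (t.gradδ K) x = ∑ j, t.gradδ K j * x j := by
    simp [PiLp.inner_apply, mul_comm]
  simp [peval, δpoly, inner_sub_right, this]
  ring

theorem pderiv_δpoly (t : Tent P) (K : P.elems) (j : Fin d) :
    MvPolynomial.pderiv j (t.δpoly K) = MvPolynomial.C (t.gradδ K j) := by
  simp [δpoly, MvPolynomial.pderiv_X, Pi.single_apply]

theorem totalDegree_δpoly_le (t : Tent P) (K : P.elems) : (t.δpoly K).totalDegree ≤ 1 := by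
  refine (MvPolynomial.totalDegree_add _ _).trans (max_le (by rw [MvPolynomial.totalDegree_C]; omega) ?_)
  refine MvPolynomial.totalDegree_finsetSum_le fun j _ => ?_
  refine (MvPolynomial.totalDegree_mul _ _).trans ?_
  simp

theorem δ_eq_peval (t : Tent P) (K : P.elems) {x : Space d} (hx : x ∈ hull K.1) :
    t.δ x = peval (t.δpoly K) x := by
  have hv : P.vertex ∈ hull K.1 := subset_convexHull ℝ _ mem_apex
  have h1 := t.top.linear_on K _ hv x hx
  have h2 := t.bot.linear_on K _ hv x hx
  rw [peval_δpoly, gradδ, inner_sub_left, δ, δ]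
  linarith

/-- The fronts agree at all vertices but the central one, so δ is a multiple of the hat function
there. Its bounds and its vanishing on the patch boundary follow from this. -/
theorem peval_δpoly_eq_coord (t : Tent P) (K : P.elems) (x : Space d) :
    peval (t.δpoly K) x = (bary K).coord (apex K) x * t.δ P.vertex := by
  have h1 : x - P.vertex = ∑ w : K.1, (bary K).coord w x • ((w : Space d) - P.vertex) := by
    simp only [smul_sub, Finset.sum_sub_distrib, bary_sum_smul, ← Finset.sum_smul,
      (bary K).sum_coord_apply_eq_one, one_smul]
  have h2 : peval (t.δpoly K) x =
      ∑ w : K.1, (bary K).coord w x * peval (t.δpoly K) (w : Space d) := by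
    simp only [peval_δpoly, mul_add, Finset.sum_add_distrib, ← Finset.sum_mul,
      (bary K).sum_coord_apply_eq_one, one_mul]
    rw [h1]
    simp only [inner_sum, real_inner_smul_right]
  rw [h2, Finset.sum_eq_single (apex K)]
  · rw [coe_apex, peval_δpoly, sub_self, inner_zero_right, add_zero]
  · intro w _ hw
    rw [← t.δ_eq_peval K (subset_convexHull ℝ _ w.2), δ,
      t.eq_off_pole K.1 K.2 w w.2 (fun h => hw (Subtype.ext h)), sub_self, mul_zero]
  · simp

theorem peval_δpoly_opposite (t : Tent P) (K : P.elems) {x : Space d}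
    (hx : x ∈ hull (K.1.erase P.vertex)) : peval (t.δpoly K) x = 0 := by
  rw [peval_δpoly_eq_coord,
    ((mem_hull_subset_iff K (Finset.erase_subset _ _) x).1 hx).2 (apex K) (by simp), zero_mul]

theorem δ_eq_zero_of_notMem (t : Tent P) {F : P.facets} (hF : P.vertex ∉ F.1) {x : Space d}
    (hx : x ∈ hull F.1) : t.δ x = 0 := by
  obtain ⟨K, hK⟩ := facet_subset F
  rw [t.δ_eq_peval K (convexHull_mono (by exact_mod_cast hK) hx)]
  refine t.peval_δpoly_opposite K (convexHull_mono ?_ hx)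
  intro y hy
  rw [Finset.mem_coe] at hy ⊢
  exact Finset.mem_erase.2 ⟨fun h => hF (h ▸ hy), hK hy⟩

theorem δ_vertex_nonneg (t : Tent P) : 0 ≤ t.δ P.vertex := sub_nonneg.2 t.bot_le_top

theorem δ_mem_Icc (t : Tent P) (K : P.elems) {x : Space d} (hx : x ∈ hull K.1) :
    t.δ x ∈ Set.Icc 0 (t.δ P.vertex) := by
  rw [t.δ_eq_peval K hx, peval_δpoly_eq_coord]
  have h := (mem_hull_iff K x).1 hx
  refine ⟨mul_nonneg (h _) t.δ_vertex_nonneg, mul_le_of_le_one_left t.δ_vertex_nonneg ?_⟩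
  rw [← (bary K).sum_coord_apply_eq_one x]
  exact Finset.single_le_sum (f := fun w => (bary K).coord w x) (fun w _ => h w)
    (Finset.mem_univ _)

end Tent

/-- The operator `u ↦ -δ ∑ⱼ ℒ⁽ʲ⁾ ∂ⱼ u` on polynomial vectors. -/
def transportPoly (c : Coefficients P b) (t : Tent P) (K : P.elems)
    (w : Fin b → MvPolynomial (Fin d) ℝ) (l : Fin b) : MvPolynomial (Fin d) ℝ :=
  -(t.δpoly K) * ∑ j, ∑ k, MvPolynomial.C (c.L K j l k) * MvPolynomial.pderiv j (w k)

/-- The affine factor δ restores the degree lost by the derivative. Positivity of `p` makes 1 + (p -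
1) ≤ p true with truncated subtraction. -/
theorem totalDegree_transportPoly_le (hp : 0 < p) (c : Coefficients P b) (t : Tent P) (K : P.elems)
    (w : Fin b → MvPolynomial (Fin d) ℝ) (hw : ∀ l, (w l).totalDegree ≤ p) (l : Fin b) :
    (transportPoly c t K w l).totalDegree ≤ p := by
  refine (MvPolynomial.totalDegree_mul _ _).trans ?_
  rw [MvPolynomial.totalDegree_neg]
  have h1 := t.totalDegree_δpoly_le K
  have h2 : (∑ j, ∑ k, MvPolynomial.C (c.L K j l k) *
      MvPolynomial.pderiv j (w k)).totalDegree ≤ p - 1 := by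
    refine MvPolynomial.totalDegree_finsetSum_le fun j _ =>
      MvPolynomial.totalDegree_finsetSum_le fun k _ => ?_
    refine (MvPolynomial.totalDegree_mul _ _).trans ?_
    rw [MvPolynomial.totalDegree_C, zero_add]
    exact (totalDegree_pderiv_le _ _).trans (Nat.sub_le_sub_right (hw k) 1)
  omega

/-- The operator `u ↦ -δ ∑ⱼ ℒ⁽ʲ⁾ ∂ⱼ u` on the DG space. -/
def transport (hp : 0 < p) (c : Coefficients P b) (t : Tent P) :
    Module.End ℝ (DGSpace P b p) where
  toFun u K l := ⟨transportPoly c t K (fun k => (u K k : MvPolynomial (Fin d) ℝ)) l,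
    (MvPolynomial.mem_restrictTotalDegree _ _ _).2
      (totalDegree_transportPoly_le hp c t K _ (totalDegree_dg_le u K) l)⟩
  map_add' u v := by
    funext K l
    apply Subtype.ext
    simp [transportPoly, mul_add, Finset.sum_add_distrib]
  map_smul' a u := by
    funext K l
    apply Subtype.ext
    simp [transportPoly, Finset.smul_sum, MvPolynomial.smul_eq_C_mul, Finset.mul_sum]
    exact Finset.sum_congr rfl fun j _ => Finset.sum_congr rfl fun k _ => by ring

theorem val_transport (hp : 0 < p) (c : Coefficients P b) (t : Tent P) (u : DGSpace P b p)
    (K : P.elems) (x : Space d) :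
    val (transport hp c t u) K x =
      -(peval (t.δpoly K) x) • ∑ j, c.L K j *ᵥ pdv u K j x := by
  ext l
  rw [val_eq_peval]
  simp [transport, transportPoly, peval, Matrix.mulVec, dotProduct, pdv]

/-- The jump terms of the DG form after integration by parts. -/
def jumpFun (c : Coefficients P b) (t : Tent P) (ν : P.facets → Space d)
    (S : Matrix (Fin b) (Fin b) ℝ) (u v : DGSpace P b p) : ℝ :=
  ∑ F : P.facets, ∫ x in hull F.1, t.δ x * ((facetMatrix c ν F *ᵥ jump ν u F x) ⬝ᵥ avg ν v F x +
    (S *ᵥ jump ν u F x) ⬝ᵥ jump ν v F x) ∂(Measure.euclideanHausdorffMeasure (d - 1))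

/-- The dissipation of the DG form. -/
def dissFun (t : Tent P) (ν : P.facets → Space d) (S : Matrix (Fin b) (Fin b) ℝ)
    (u v : DGSpace P b p) : ℝ :=
  ∑ F : P.facets, ∫ x in hull F.1, t.δ x * ((S *ᵥ jump ν u F x) ⬝ᵥ jump ν v F x)
    ∂(Measure.euclideanHausdorffMeasure (d - 1))

theorem integrableOn_facet_of_continuous (t : Tent P) (F : P.facets) {f : Space d → ℝ}
    (hf : Continuous f) :
    IntegrableOn (fun x => t.δ x * f x) (hull F.1)
      (Measure.euclideanHausdorffMeasure (d - 1)) := by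
  obtain ⟨K, hK⟩ := facet_subset F
  have hsub : hull F.1 ⊆ hull K.1 := convexHull_mono (by exact_mod_cast hK)
  exact (((t.continuousOn_δ K).mono hsub).mul hf.continuousOn).integrableOn_of_subset_isCompact
    (isCompact_hull _) (isCompact_hull _).isClosed.measurableSet subset_rfl
    (facet_measure_lt_top F).ne

/-- Integration by parts on an element. -/
theorem integral_by_parts_elem (hd : 1 ≤ d) (hp : 0 < p) (c : Coefficients P b) (t : Tent P)
    {ν : P.facets → Space d} (hν : IsNormalField P ν) (u v : DGSpace P b p) (K : P.elems) :
    ∫ x in hull K.1, t.δ x * ∑ j : Fin d, (c.L K j *ᵥ val u K x) ⬝ᵥ pdv v K j x =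
      (∫ x in hull K.1, val (transport hp c t u) K x ⬝ᵥ val v K x) -
      (∫ x in hull K.1, (c.dir K (t.gradδ K) *ᵥ val u K x) ⬝ᵥ val v K x) +
      ∑ F : P.facets with P.vertex ∈ F.1, side ν F K *
        ∫ x in hull F.1, t.δ x * ((c.dir K (ν F) *ᵥ val u K x) ⬝ᵥ val v K x)
          ∂(Measure.euclideanHausdorffMeasure (d - 1)) := by
  -- The components δ (ℒ⁽ʲ⁾u)·v of a polynomial vector field whose divergence is to be integrated;
  -- the factor δ makes it vanish on the facet opposite the central vertex.
  set G : Fin d → MvPolynomial (Fin d) ℝ := fun j => t.δpoly K *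
    ∑ l, (∑ k, MvPolynomial.C (c.L K j l k) * (u K k : MvPolynomial (Fin d) ℝ)) *
      (v K l : MvPolynomial (Fin d) ℝ) with hG
  have hGval : ∀ j x, peval (G j) x =
      peval (t.δpoly K) x * ((c.L K j *ᵥ val u K x) ⬝ᵥ val v K x) := by
    intro j x
    simp [hG, peval, Matrix.mulVec, dotProduct, val]
  have hGder : ∀ j x, peval (MvPolynomial.pderiv j (G j)) x =
      t.gradδ K j * ((c.L K j *ᵥ val u K x) ⬝ᵥ val v K x) +
      peval (t.δpoly K) x * ((c.L K j *ᵥ pdv u K j x) ⬝ᵥ val v K x) +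
      peval (t.δpoly K) x * ((c.L K j *ᵥ val u K x) ⬝ᵥ pdv v K j x) := by
    intro j x
    rw [hG]
    simp only [MvPolynomial.pderiv_mul, Tent.pderiv_δpoly, map_sum]
    simp only [peval, map_add, map_mul, map_sum, MvPolynomial.eval_C, Matrix.mulVec, dotProduct,
      val, pdv, MvPolynomial.pderiv_C, zero_mul, zero_add, Finset.sum_add_distrib, mul_add]
    ring
  have hfd : ∀ j x, fderiv ℝ (peval (G j)) x (EuclideanSpace.single j 1) =
      peval (MvPolynomial.pderiv j (G j)) x := by
    intro j x
    rw [fderiv_peval, Finset.sum_eq_single j] <;> simp +contextual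
  have hdiv : ∀ j, ∫ x in hull K.1, peval (MvPolynomial.pderiv j (G j)) x =
      ∑ F : P.facets with P.vertex ∈ F.1, side ν F K * ν F j *
        ∫ x in hull F.1, peval (G j) x ∂(Measure.euclideanHausdorffMeasure (d - 1)) := by
    intro j
    have h0 : ∀ x ∈ hull (K.1.erase P.vertex), peval (G j) x = 0 := fun x hx => by
      rw [hGval, t.peval_δpoly_opposite K hx, zero_mul]
    have := integral_fderiv_elem hd hν K (contDiff_peval (G j)) h0 (EuclideanSpace.single j 1)
    simp only [hfd] at this
    rw [this]
    refine Finset.sum_congr rfl fun F _ => ?_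
    simp [EuclideanSpace.inner_single_right]
  have hcompK := isCompact_hull K.1
  have hIc : ∀ f : Space d → ℝ, Continuous f → IntegrableOn f (hull K.1) := fun f hf =>
    hf.continuousOn.integrableOn_compact hcompK
  have hcu := continuous_val u K
  have hcv := continuous_val v K
  have hcdu := fun j => continuous_pdv u K j
  have hcdv := fun j => continuous_pdv v K j
  have hcδ := continuous_peval (t.δpoly K)
  have hdot : ∀ (M : Matrix (Fin b) (Fin b) ℝ) (f g : Space d → Fin b → ℝ), Continuous f →
      Continuous g → Continuous fun x => (M *ᵥ f x) ⬝ᵥ g x := fun M f g hf hg =>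
    (continuous_const.matrix_mulVec hf).dotProduct hg
  have hlhs : ∫ x in hull K.1, t.δ x * ∑ j : Fin d, (c.L K j *ᵥ val u K x) ⬝ᵥ pdv v K j x =
      ∫ x in hull K.1, ((val (transport hp c t u) K x ⬝ᵥ val v K x -
        (c.dir K (t.gradδ K) *ᵥ val u K x) ⬝ᵥ val v K x) +
        ∑ j, peval (MvPolynomial.pderiv j (G j)) x) := by
    refine setIntegral_congr_fun hcompK.isClosed.measurableSet fun x hx => ?_
    rw [t.δ_eq_peval K hx, val_transport, Coefficients.dir]
    simp only [hGder, Finset.sum_add_distrib, ← Finset.mul_sum, Matrix.sum_mulVec,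
      Matrix.smul_mulVec, sum_dotProduct, smul_dotProduct, smul_eq_mul, neg_mul]
    ring
  have hrhs : ∀ F : P.facets, P.vertex ∈ F.1 → side ν F K *
        ∫ x in hull F.1, t.δ x * ((c.dir K (ν F) *ᵥ val u K x) ⬝ᵥ val v K x)
          ∂(Measure.euclideanHausdorffMeasure (d - 1)) = ∑ j, side ν F K * ν F j *
        ∫ x in hull F.1, peval (G j) x ∂(Measure.euclideanHausdorffMeasure (d - 1)) := by
    intro F hvF
    by_cases hFK : F.1 ⊆ K.1
    · simp only [mul_assoc, ← Finset.mul_sum]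
      congr 1
      have hsub : hull F.1 ⊆ hull K.1 := convexHull_mono (by exact_mod_cast hFK)
      have hmF : MeasurableSet (hull F.1) := (isCompact_hull F.1).isClosed.measurableSet
      simp only [← integral_const_mul]
      rw [← integral_finsetSum]
      · refine setIntegral_congr_fun hmF fun x hx => ?_
        simp only [hGval]
        rw [t.δ_eq_peval K (hsub hx), Coefficients.dir]
        simp only [Matrix.sum_mulVec, Matrix.smul_mulVec, sum_dotProduct, smul_dotProduct,
          smul_eq_mul, Finset.mul_sum]
        exact Finset.sum_congr rfl fun j _ => by ring
      · intro j _
        refine Integrable.const_mul ?_ _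
        exact (continuous_peval _).continuousOn.integrableOn_of_subset_isCompact
          (isCompact_hull _) hmF subset_rfl (facet_measure_lt_top F).ne
    · simp [side_eq_zero hFK]
  rw [hlhs, integral_add, integral_sub, integral_finsetSum]
  · congr 1
    simp only [hdiv]
    rw [Finset.sum_comm]
    exact Finset.sum_congr rfl fun F hF => (hrhs F (Finset.mem_filter.1 hF).2).symm
  · exact fun j _ => hIc _ (continuous_peval _)
  · exact hIc _ ((continuous_val _ K).dotProduct hcv)
  · exact hIc _ (hdot _ _ _ hcu hcv)
  · exact hIc _ (((continuous_val _ K).dotProduct hcv).sub (hdot _ _ _ hcu hcv))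
  · exact hIc _ (continuous_finsetSum _ fun j _ => continuous_peval _)

theorem tracePlus_eq {ν : P.facets → Space d} {F : P.facets} {K : P.elems}
    (h : plusElems ν F = {K}) (v : DGSpace P b p) (x : Space d) :
    tracePlus ν v F x = val v K x := by
  rw [tracePlus, h, Finset.sum_singleton]

theorem traceMinus_eq {ν : P.facets → Space d} {F : P.facets} {K : P.elems}
    (h : minusElems ν F = {K}) (v : DGSpace P b p) (x : Space d) :
    traceMinus ν v F x = val v K x := by
  rw [traceMinus, h, Finset.sum_singleton]

theorem continuous_avg (ν : P.facets → Space d) (v : DGSpace P b p) (F : P.facets) :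
    Continuous (avg ν v F) := by
  have h1 : Continuous fun x => tracePlus ν v F x + traceMinus ν v F x :=
    (continuous_finsetSum _ fun K _ => continuous_val v K).add
      (continuous_finsetSum _ fun K _ => continuous_val v K)
  exact h1.const_smul (1 / 2 : ℝ)

/-- The DG form after integration by parts. -/
theorem dgFun_eq (hd : 1 ≤ d) (hp : 0 < p) {c : Coefficients P b} {g₀ Λ c₀ : ℝ}
    (hc : c.Admissible g₀ Λ c₀) (t : Tent P) {ν : P.facets → Space d} (hν : IsNormalField P ν)
    (S : Matrix (Fin b) (Fin b) ℝ) (u v : DGSpace P b p) :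
    dgFun c t ν S u v = ip P b p (transport hp c t u) v -
      massFun (fun K => c.dir K (t.gradδ K)) u v - jumpFun c t ν S u v := by
  have hip : ip P b p (transport hp c t u) v =
      ∑ K : P.elems, ∫ x in hull K.1, val (transport hp c t u) K x ⬝ᵥ val v K x := by
    change massFun (fun _ => 1) _ _ = _
    simp [massFun, Matrix.one_mulVec]
  rw [dgFun, hip, massFun, jumpFun]
  simp only [integral_by_parts_elem hd hp c t hν u v, Finset.sum_add_distrib,
    Finset.sum_sub_distrib]
  rw [Finset.sum_comm, Finset.sum_filter, add_assoc, ← Finset.sum_add_distrib, sub_eq_add_neg _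
    (∑ F : P.facets, _), ← Finset.sum_neg_distrib]
  congr 1
  refine Finset.sum_congr rfl fun F _ => ?_
  -- On a facet through the central vertex the boundary terms are minus the jump of 𝒟u·v, which
  -- equals 𝒟{u}·⟦v⟧ + 𝒟⟦u⟧·{v} because 𝒟 is symmetric-free of sides, that is, the same from both
  -- elements. The flux cancels the first summand. On the other facets δ vanishes.
  by_cases hvF : P.vertex ∈ F.1
  · obtain ⟨Kp, hKp⟩ := exists_plusElems_eq hν hvF
    obtain ⟨Km, hKm⟩ := exists_minusElems_eq hν hvF
    have hdir := dir_normal_eq hd hν hc hvF hKp hKm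
    have hFM : facetMatrix c ν F = c.dir Kp (ν F) := by
      rw [facetMatrix, hKp, Finset.sum_singleton]
    rw [if_pos hvF]
    simp only [side, hKp, hKm, Finset.mem_singleton, sub_mul, ite_mul, one_mul, zero_mul,
      Finset.sum_sub_distrib, Finset.sum_ite_eq', Finset.mem_univ, if_true, ← hdir]
    have hdot : ∀ K, Continuous fun x => (c.dir Kp (ν F) *ᵥ val u K x) ⬝ᵥ val v K x := fun K =>
      (continuous_const.matrix_mulVec (continuous_val u K)).dotProduct (continuous_val v K)
    rw [← integral_sub (integrableOn_facet_of_continuous t F (hdot Km))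
      (integrableOn_facet_of_continuous t F (hdot Kp)), ← integral_add, ← integral_neg]
    · refine integral_congr_ae (Filter.Eventually.of_forall fun x => ?_)
      simp only [numFlux, jump, avg, tracePlus_eq hKp, traceMinus_eq hKm, hFM, Matrix.mulVec_sub,
        Matrix.mulVec_add, Matrix.mulVec_smul, sub_dotProduct, add_dotProduct, dotProduct_sub,
        dotProduct_add, smul_dotProduct, dotProduct_smul, smul_eq_mul]
      ring
    · exact (integrableOn_facet_of_continuous t F (hdot Km)).sub
        (integrableOn_facet_of_continuous t F (hdot Kp))
    · exact integrableOn_facet c t ν S u v F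
  · rw [if_neg hvF, zero_add]
    rw [setIntegral_eq_zero_of_forall_eq_zero, setIntegral_eq_zero_of_forall_eq_zero, neg_zero]
    · intro x hx; rw [t.δ_eq_zero_of_notMem hvF hx, zero_mul]
    · intro x hx; rw [t.δ_eq_zero_of_notMem hvF hx, zero_mul]

end

/-! ### Mass operators, termination of the recursion, and the energy identity -/

section

variable {d b p : ℕ} {P : VertexPatch d}

/-- Elementwise multiplication with constant matrices. -/
def mulOp (W : P.elems → Matrix (Fin b) (Fin b) ℝ) : Module.End ℝ (DGSpace P b p) where
  toFun u K l := ∑ k, W K l k • u K k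
  map_add' u v := by
    funext K l
    simp [Finset.sum_add_distrib]
  map_smul' a u := by
    funext K l
    simp only [Pi.smul_apply, RingHom.id_apply, Finset.smul_sum]
    exact Finset.sum_congr rfl fun k _ => smul_comm _ _ _

theorem coe_mulOp (W : P.elems → Matrix (Fin b) (Fin b) ℝ) (u : DGSpace P b p) (K : P.elems)
    (l : Fin b) : (mulOp W u K l : MvPolynomial (Fin d) ℝ) =
      ((W K).map MvPolynomial.C *ᵥ fun k => (u K k : MvPolynomial (Fin d) ℝ)) l := by
  simp [mulOp, Matrix.mulVec, dotProduct, MvPolynomial.smul_eq_C_mul]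

theorem val_mulOp (W : P.elems → Matrix (Fin b) (Fin b) ℝ) (u : DGSpace P b p) (K : P.elems)
    (x : Space d) : val (mulOp W u) K x = W K *ᵥ val u K x := by
  ext l
  rw [val_eq_peval, coe_mulOp]
  simp [peval, Matrix.mulVec, dotProduct, val]

theorem ip_eq (u v : DGSpace P b p) :
    ip P b p u v = ∑ K : P.elems, ∫ x in hull K.1, val u K x ⬝ᵥ val v K x := by
  change massFun (fun _ => 1) _ _ = _
  simp [massFun, Matrix.one_mulVec]

theorem ip_mulOp (W : P.elems → Matrix (Fin b) (Fin b) ℝ) (u v : DGSpace P b p) :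
    ip P b p (mulOp W u) v = massFun W u v := by
  rw [ip_eq]
  simp only [val_mulOp]
  rfl

theorem eq_of_ip_eq {u u' : DGSpace P b p} (h : ∀ v, ip P b p u v = ip P b p u' v) : u = u' := by
  rw [← sub_eq_zero]
  refine ip_self_eq_zero _ ?_
  rw [(ip P b p).map_sub u u', LinearMap.sub_apply, h, sub_self]

/-- Elementwise constant matrices map V_h to itself, so no projection occurs and mass operators can
be inverted pointwise on polynomials. -/
theorem operatorOf_massForm (W : P.elems → Matrix (Fin b) (Fin b) ℝ) :
    operatorOf (massForm W : LinearMap.BilinForm ℝ (DGSpace P b p)) = mulOp W :=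
  LinearMap.ext fun u => eq_of_ip_eq fun v => by
    rw [ip_operatorOf, ip_mulOp]; rfl

/-- The operator `q ↦ -∑ⱼ ℒ⁽ʲ⁾ ∂ⱼ q` on polynomial vectors. -/
def driftPoly (c : Coefficients P b) (K : P.elems) (q : Fin b → MvPolynomial (Fin d) ℝ)
    (l : Fin b) : MvPolynomial (Fin d) ℝ :=
  -∑ j, ∑ m, MvPolynomial.C (c.L K j l m) * MvPolynomial.pderiv j (q m)

theorem delta_mul_pderiv (t : Tent P) (K : P.elems) (k : ℕ) (j : Fin d)
    (q : MvPolynomial (Fin d) ℝ) :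
    t.δpoly K * MvPolynomial.pderiv j (t.δpoly K ^ k * q) =
      t.δpoly K ^ (k + 1) * MvPolynomial.pderiv j q +
        MvPolynomial.C (k : ℝ) * (MvPolynomial.C (t.gradδ K j) * (t.δpoly K ^ k * q)) := by
  rw [MvPolynomial.pderiv_mul, MvPolynomial.pderiv_pow, Tent.pderiv_δpoly]
  rcases k with _ | k
  · simp
  · simp only [Nat.add_sub_cancel, map_natCast]
    ring

/-- Differentiating δᵏ produces -k (∑ⱼ ∂ⱼδ ℒ⁽ʲ⁾) δᵏ q, and the term k M₁ of the recursion cancels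
precisely this. What is left has one more factor δ and one derivative on q. -/
theorem transportPoly_pow_mul (c : Coefficients P b) (t : Tent P) (K : P.elems) (k : ℕ)
    (q : Fin b → MvPolynomial (Fin d) ℝ) (l : Fin b) :
    transportPoly c t K (fun m => t.δpoly K ^ k * q m) l + MvPolynomial.C (k : ℝ) *
      ((c.dir K (t.gradδ K)).map MvPolynomial.C *ᵥ fun m => t.δpoly K ^ k * q m) l =
      t.δpoly K ^ (k + 1) * driftPoly c K q l := by
  have e1 : transportPoly c t K (fun m => t.δpoly K ^ k * q m) l =
      -∑ j, ∑ m, MvPolynomial.C (c.L K j l m) *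
        (t.δpoly K * MvPolynomial.pderiv j (t.δpoly K ^ k * q m)) := by
    rw [transportPoly, neg_mul, Finset.mul_sum]
    congr 1
    refine Finset.sum_congr rfl fun j _ => ?_
    rw [Finset.mul_sum]
    exact Finset.sum_congr rfl fun m _ => mul_left_comm _ _ _
  have e2 : ((c.dir K (t.gradδ K)).map MvPolynomial.C *ᵥ fun m => t.δpoly K ^ k * q m) l =
      ∑ j, ∑ m, MvPolynomial.C (c.L K j l m) *
        (MvPolynomial.C (t.gradδ K j) * (t.δpoly K ^ k * q m)) := by
    simp only [Matrix.mulVec, dotProduct, Matrix.map_apply, Coefficients.dir, Matrix.sum_apply,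
      Matrix.smul_apply, smul_eq_mul, map_sum, map_mul, Finset.sum_mul]
    rw [Finset.sum_comm]
    exact Finset.sum_congr rfl fun j _ => Finset.sum_congr rfl fun m _ => by
      rw [mul_comm (MvPolynomial.C (t.gradδ K j)), mul_assoc]
  rw [e1, e2, driftPoly, mul_neg, Finset.mul_sum, Finset.mul_sum, neg_add_eq_iff_eq_add,
    ← sub_eq_add_neg, eq_sub_iff_add_eq, ← Finset.sum_add_distrib]
  refine Finset.sum_congr rfl fun j _ => ?_
  rw [Finset.mul_sum, Finset.mul_sum, ← Finset.sum_add_distrib]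
  refine Finset.sum_congr rfl fun m _ => ?_
  rw [delta_mul_pderiv, mul_add, mul_left_comm (MvPolynomial.C (k : ℝ)), add_comm,
    mul_left_comm (t.δpoly K ^ (k + 1))]

theorem map_C_mulVec_mulVec (M N : Matrix (Fin b) (Fin b) ℝ)
    (q : Fin b → MvPolynomial (Fin d) ℝ) :
    M.map MvPolynomial.C *ᵥ (N.map MvPolynomial.C *ᵥ q) = (M * N).map MvPolynomial.C *ᵥ q := by
  rw [Matrix.mulVec_mulVec, Matrix.map_mul]

theorem map_C_one_mulVec (q : Fin b → MvPolynomial (Fin d) ℝ) :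
    (1 : Matrix (Fin b) (Fin b) ℝ).map MvPolynomial.C *ᵥ q = q := by
  rw [Matrix.map_one _ (map_zero _) (map_one _), Matrix.one_mulVec]

/-- The iterates of `W⁻¹` composed with `driftPoly`. -/
def driftIter (c : Coefficients P b) (K : P.elems) (W : Matrix (Fin b) (Fin b) ℝ)
    (q : Fin b → MvPolynomial (Fin d) ℝ) : ℕ → Fin b → MvPolynomial (Fin d) ℝ
  | 0 => q
  | k + 1 => W⁻¹.map MvPolynomial.C *ᵥ driftPoly c K (driftIter c K W q k)

theorem totalDegree_driftIter_le (c : Coefficients P b) (K : P.elems)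
    (W : Matrix (Fin b) (Fin b) ℝ) (q : Fin b → MvPolynomial (Fin d) ℝ)
    (hq : ∀ l, (q l).totalDegree ≤ p) (k : ℕ) (l : Fin b) :
    (driftIter c K W q k l).totalDegree ≤ p - k := by
  induction k generalizing l with
  | zero => exact hq l
  | succ k ih =>
    refine MvPolynomial.totalDegree_finsetSum_le fun m _ => ?_
    refine (MvPolynomial.totalDegree_mul _ _).trans ?_
    change (MvPolynomial.C (W⁻¹ l m)).totalDegree +
      (driftPoly c K (driftIter c K W q k) m).totalDegree ≤ _
    rw [MvPolynomial.totalDegree_C, zero_add, driftPoly, MvPolynomial.totalDegree_neg]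
    refine MvPolynomial.totalDegree_finsetSum_le fun j _ => ?_
    refine MvPolynomial.totalDegree_finsetSum_le fun m' _ => ?_
    refine (MvPolynomial.totalDegree_mul _ _).trans ?_
    rw [MvPolynomial.totalDegree_C, zero_add]
    refine (totalDegree_pderiv_le _ _).trans ?_
    have := ih m'
    omega

/-- The degree bound p - k saturates at zero, so the last step uses that constants are annihilated
by differentiation. -/
theorem driftIter_eq_zero (c : Coefficients P b) (K : P.elems)
    (W : Matrix (Fin b) (Fin b) ℝ) (q : Fin b → MvPolynomial (Fin d) ℝ)
    (hq : ∀ l, (q l).totalDegree ≤ p) : driftIter c K W q (p + 1) = 0 := by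
  have h : driftPoly c K (driftIter c K W q p) = 0 := by
    funext l
    rw [driftPoly, Finset.sum_eq_zero, neg_zero, Pi.zero_apply]
    refine fun j _ => Finset.sum_eq_zero fun m _ => ?_
    have h1 := totalDegree_driftIter_le c K W q hq p m
    rw [Nat.sub_self, Nat.le_zero, MvPolynomial.totalDegree_eq_zero_iff_eq_C] at h1
    rw [h1, MvPolynomial.pderiv_C, mul_zero]
  rw [driftIter, h, Matrix.mulVec_zero]

/-- On one element, the recursion without jump terms is solved by `δᵏ qₖ`, where the degree of `qₖ`
decreases; hence it terminates. -/
theorem polynomial_recursion_terminates (c : Coefficients P b) (t : Tent P) (K : P.elems)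
    (W : Matrix (Fin b) (Fin b) ℝ) (hW : IsUnit W.det)
    (y : ℕ → Fin b → MvPolynomial (Fin d) ℝ) (h0 : ∀ l, (y 0 l).totalDegree ≤ p)
    (hy : ∀ k l, (W.map MvPolynomial.C *ᵥ y (k + 1)) l = transportPoly c t K (y k) l +
      MvPolynomial.C (k : ℝ) *
        ((c.dir K (t.gradδ K)).map MvPolynomial.C *ᵥ y k) l) : y (p + 1) = 0 := by
  have hyq : ∀ k, y k = fun m => t.δpoly K ^ k * driftIter c K W (y 0) k m := by
    intro k
    induction k with
    | zero => funext m; rw [pow_zero, one_mul, driftIter]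
    | succ k ih =>
      have h1 : W.map MvPolynomial.C *ᵥ y (k + 1) =
          t.δpoly K ^ (k + 1) • driftPoly c K (driftIter c K W (y 0) k) := by
        funext l
        rw [hy, ih, transportPoly_pow_mul, Pi.smul_apply, smul_eq_mul]
      have h2 := congrArg (fun z => W⁻¹.map MvPolynomial.C *ᵥ z) h1
      simp only [map_C_mulVec_mulVec, Matrix.nonsing_inv_mul _ hW, map_C_one_mulVec,
        Matrix.mulVec_smul] at h2
      rw [h2]
      rfl
  rw [hyq, driftIter_eq_zero c K W _ h0]
  funext m
  exact mul_zero _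

theorem recursion_terminates (hp : 0 < p) (c : Coefficients P b) (t : Tent P)
    (W : P.elems → Matrix (Fin b) (Fin b) ℝ) (hW : ∀ K, IsUnit (W K).det)
    (y : ℕ → DGSpace P b p) (hy : ∀ k : ℕ, mulOp W (y (k + 1)) =
      transport hp c t (y k) + (k : ℝ) • mulOp (fun K => c.dir K (t.gradδ K)) (y k)) :
    y (p + 1) = 0 := by
  funext K l
  apply Subtype.ext
  have := polynomial_recursion_terminates c t K (W K) (hW K)
    (fun k m => (y k K m : MvPolynomial (Fin d) ℝ)) (fun m => totalDegree_dg_le (y 0) K m) ?_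
  · exact congrFun this l
  · intro k m
    rw [← coe_mulOp, ← coe_mulOp (fun K => c.dir K (t.gradδ K)), hy]
    simp [transport, MvPolynomial.smul_eq_C_mul]

theorem Coefficients.dir_isSymm {c : Coefficients P b} {g₀ Λ c₀ : ℝ} (hc : c.Admissible g₀ Λ c₀)
    (K : P.elems) (n : Space d) : (c.dir K n).IsSymm := by
  rw [Matrix.IsSymm, Coefficients.dir, Matrix.transpose_sum]
  exact Finset.sum_congr rfl fun j _ => by rw [Matrix.transpose_smul, (hc.L_symm K j).eq]

theorem mulVec_dotProduct_comm {M : Matrix (Fin b) (Fin b) ℝ} (hM : M.IsSymm) (u v : Fin b → ℝ) :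
    (M *ᵥ u) ⬝ᵥ v = (M *ᵥ v) ⬝ᵥ u := by
  rw [dotProduct_comm (M *ᵥ v), Matrix.dotProduct_mulVec, ← Matrix.mulVec_transpose, hM.eq]

theorem massFun_comm {W : P.elems → Matrix (Fin b) (Fin b) ℝ} (hW : ∀ K, (W K).IsSymm)
    (u v : DGSpace P b p) : massFun W u v = massFun W v u := by
  rw [massFun, massFun]
  exact Finset.sum_congr rfl fun K _ => integral_congr_ae (Filter.Eventually.of_forall fun x =>
    mulVec_dotProduct_comm (hW K) _ _)

theorem facetMatrix_isSymm {c : Coefficients P b} {g₀ Λ c₀ : ℝ} (hc : c.Admissible g₀ Λ c₀)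
    (ν : P.facets → Space d) (F : P.facets) : (facetMatrix c ν F).IsSymm := by
  rw [Matrix.IsSymm, facetMatrix, Matrix.transpose_sum]
  exact Finset.sum_congr rfl fun K _ => Coefficients.dir_isSymm hc K _

/-- The energy identity of the DG form. -/
theorem dgFun_energy (hd : 1 ≤ d) (hp : 0 < p) {c : Coefficients P b} {g₀ Λ c₀ : ℝ}
    (hc : c.Admissible g₀ Λ c₀) (t : Tent P) {ν : P.facets → Space d} (hν : IsNormalField P ν)
    (S : Matrix (Fin b) (Fin b) ℝ) (u : DGSpace P b p) :
    2 * dgFun c t ν S u u + massFun (fun K => c.dir K (t.gradδ K)) u u =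
      -2 * dissFun t ν S u u := by
  have h1 := dgFun_eq hd hp hc t hν S u u
  -- For v = u, symmetry of ℒ⁽ʲ⁾ makes the volume term minus the transport pairing. Adding the form
  -- before and after integration by parts then eliminates transport.
  have hvol : ∑ K : P.elems, ∫ x in hull K.1,
      t.δ x * ∑ j : Fin d, (c.L K j *ᵥ val u K x) ⬝ᵥ pdv u K j x =
      -ip P b p (transport hp c t u) u := by
    rw [ip_eq, ← Finset.sum_neg_distrib]
    refine Finset.sum_congr rfl fun K _ => ?_
    rw [← integral_neg]
    refine setIntegral_congr_fun (isCompact_hull K.1).isClosed.measurableSet fun x hx => ?_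
    rw [t.δ_eq_peval K hx, val_transport]
    simp only [neg_smul, neg_dotProduct, neg_neg, smul_dotProduct, smul_eq_mul, sum_dotProduct]
    congr 1
    exact Finset.sum_congr rfl fun j _ => mulVec_dotProduct_comm (hc.L_symm K j) _ _
  have h2 : dgFun c t ν S u u = _ + _ := rfl
  rw [hvol] at h2
  -- Symmetry of 𝒟 identifies 𝒟{u}·⟦u⟧ with 𝒟⟦u⟧·{u}; only the penalty with S changes sign, which
  -- leaves twice the dissipation.
  have h3 : ∑ F : P.facets, ∫ x in hull F.1, t.δ x * (numFlux c ν S u F x ⬝ᵥ jump ν u F x)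
      ∂(Measure.euclideanHausdorffMeasure (d - 1)) =
      jumpFun c t ν S u u - 2 * dissFun t ν S u u := by
    rw [jumpFun, dissFun, Finset.mul_sum, ← Finset.sum_sub_distrib]
    refine Finset.sum_congr rfl fun F _ => ?_
    have hS : Continuous fun x => (S *ᵥ jump ν u F x) ⬝ᵥ jump ν u F x :=
      (continuous_const.matrix_mulVec (continuous_jump ν u F)).dotProduct (continuous_jump ν u F)
    have hD : Continuous fun x => (facetMatrix c ν F *ᵥ jump ν u F x) ⬝ᵥ avg ν u F x :=
      (continuous_const.matrix_mulVec (continuous_jump ν u F)).dotProduct (continuous_avg ν u F)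
    have hDS : Continuous fun x => (facetMatrix c ν F *ᵥ jump ν u F x) ⬝ᵥ avg ν u F x +
        (S *ᵥ jump ν u F x) ⬝ᵥ jump ν u F x := hD.add hS
    rw [← integral_const_mul, ← integral_sub (integrableOn_facet_of_continuous t F hDS)
      ((integrableOn_facet_of_continuous t F hS).const_mul 2)]
    refine integral_congr_ae (Filter.Eventually.of_forall fun x => ?_)
    simp only
    rw [numFlux, sub_dotProduct, mulVec_dotProduct_comm (facetMatrix_isSymm hc ν F) (avg ν u F x)]
    ring
  rw [h3] at h2
  linarith

/-- `dissFun` as a bilinear form. -/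
def dissForm (t : Tent P) (ν : P.facets → Space d) (S : Matrix (Fin b) (Fin b) ℝ) :
    LinearMap.BilinForm ℝ (DGSpace P b p) :=
  have hI : ∀ (u v : DGSpace P b p) (F : P.facets), IntegrableOn
      (fun x => t.δ x * ((S *ᵥ jump ν u F x) ⬝ᵥ jump ν v F x)) (hull F.1)
      (Measure.euclideanHausdorffMeasure (d - 1)) := fun u v F =>
    integrableOn_facet_of_continuous t F ((continuous_const.matrix_mulVec
      (continuous_jump ν u F)).dotProduct (continuous_jump ν v F))
  LinearMap.mk₂ ℝ (dissFun t ν S)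
    (fun u₁ u₂ v => by
      simp only [dissFun, jump_add, Matrix.mulVec_add, add_dotProduct, mul_add]
      rw [← Finset.sum_add_distrib]
      exact Finset.sum_congr rfl fun F _ => integral_add (hI u₁ v F) (hI u₂ v F))
    (fun a u v => by
      simp only [dissFun, jump_smul, Matrix.mulVec_smul, smul_dotProduct, mul_smul_comm,
        integral_smul, Finset.smul_sum])
    (fun u v₁ v₂ => by
      simp only [dissFun, jump_add, dotProduct_add, mul_add]
      rw [← Finset.sum_add_distrib]
      exact Finset.sum_congr rfl fun F _ => integral_add (hI u v₁ F) (hI u v₂ F))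
    (fun a u v => by
      simp only [dissFun, jump_smul, dotProduct_smul, mul_smul_comm, integral_smul,
        Finset.smul_sum])

theorem dissForm_nonneg (t : Tent P) (ν : P.facets → Space d) {S : Matrix (Fin b) (Fin b) ℝ}
    (hS : S.PosDef) (u : DGSpace P b p) : 0 ≤ dissForm t ν S u u := by
  refine Finset.sum_nonneg fun F _ =>
    setIntegral_nonneg (isCompact_hull F.1).isClosed.measurableSet fun x hx => ?_
  obtain ⟨K, hK⟩ := facet_subset F
  refine mul_nonneg (t.δ_mem_Icc K (convexHull_mono (by exact_mod_cast hK) hx)).1 ?_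
  rw [dotProduct_comm]
  simpa using hS.posSemidef.dotProduct_mulVec_nonneg (jump ν u F x)

end

/-! ### Shape regularity and the weighted trace inequality -/

section

variable {d b p : ℕ} {P : VertexPatch d}

/-- The ball contained in an element that expresses its shape regularity. -/
structure ElementBall (K : P.elems) (γ : ℝ) (x₀ : Space d) (ρ : ℝ) : Prop where
  pos : 0 < ρ
  ball_subset : Metric.closedBall x₀ ρ ⊆ hull K.1
  diam_le : Metric.diam (hull K.1) ≤ γ * ρ

namespace ElementBall

variable {K : P.elems} {γ : ℝ} {x₀ : Space d} {ρ : ℝ}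

theorem add_smul_mem (hB : ElementBall K γ x₀ ρ) {n : Space d} (hn : ‖n‖ = 1) :
    x₀ + ρ • n ∈ hull K.1 :=
  hB.ball_subset (by simp [norm_smul, hn, abs_of_pos hB.pos])

theorem center_mem (hB : ElementBall K γ x₀ ρ) : x₀ ∈ hull K.1 :=
  hB.ball_subset (Metric.mem_closedBall_self hB.pos.le)

theorem dist_le (hB : ElementBall K γ x₀ ρ) {x y : Space d} (hx : x ∈ hull K.1)
    (hy : y ∈ hull K.1) : dist x y ≤ γ * ρ :=
  (Metric.dist_le_diam_of_mem (isCompact_hull K.1).isBounded hx hy).trans hB.diam_le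

theorem subset_closedBall (hB : ElementBall K γ x₀ ρ) :
    hull K.1 ⊆ Metric.closedBall x₀ (γ * ρ) := fun _ hx => hB.dist_le hx hB.center_mem

/-- Compare δ at the centre and at the boundary point of the ball in gradient direction: it
increases by ‖grad δ‖ ρ but stays between 0 and its value at the central vertex. -/
theorem norm_gradδ_mul_le (hB : ElementBall K γ x₀ ρ) (t : Tent P) :
    ‖t.gradδ K‖ * ρ ≤ t.δ P.vertex := by
  rcases eq_or_ne (t.gradδ K) 0 with h | h
  · rw [h, norm_zero, zero_mul]; exact t.δ_vertex_nonneg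
  have hn : ‖(‖t.gradδ K‖⁻¹ • t.gradδ K)‖ = 1 := norm_smul_inv_norm (𝕜 := ℝ) h
  have h1 := (t.δ_mem_Icc K (hB.add_smul_mem hn)).2
  have h2 := (t.δ_mem_Icc K hB.center_mem).1
  rw [t.δ_eq_peval K (hB.add_smul_mem hn), t.peval_δpoly] at h1
  rw [t.δ_eq_peval K hB.center_mem, t.peval_δpoly] at h2
  have h3 : inner ℝ (t.gradδ K) (x₀ + ρ • ‖t.gradδ K‖⁻¹ • t.gradδ K - P.vertex) =
      inner ℝ (t.gradδ K) (x₀ - P.vertex) + ‖t.gradδ K‖ * ρ := by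
    rw [add_sub_right_comm, inner_add_right, real_inner_smul_right, real_inner_smul_right,
      real_inner_self_eq_norm_sq]
    have := norm_ne_zero_iff.2 h
    field_simp
  linarith

theorem norm_gradδ_le (hB : ElementBall K γ x₀ ρ) (t : Tent P) {κ : ℝ}
    (hκ : t.δ P.vertex ≤ κ * ρ) : ‖t.gradδ K‖ ≤ κ :=
  le_of_mul_le_mul_right ((hB.norm_gradδ_mul_le t).trans hκ) hB.pos

/-- Moving from the centre by ρ ν changes the height over the facet by ρ. That height is the
barycentric coordinate of w, which stays in [0, 1], times the height of w. -/
theorem le_abs_inner (hB : ElementBall K γ x₀ ρ) {w : K.1} (hw : w ≠ apex K) {ν : Space d}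
    (hν1 : ‖ν‖ = 1) (hν : ∀ x ∈ K.1.erase w, ∀ y ∈ K.1.erase w, inner ℝ ν (y - x) = 0) :
    ρ ≤ |inner ℝ ν ((w : Space d) - P.vertex)| := by
  have hv : P.vertex ∈ K.1.erase w :=
    Finset.mem_erase.2 ⟨fun h => hw (Subtype.ext h.symm), mem_apex⟩
  have hc : ∀ x ∈ hull K.1, (bary K).coord w x ∈ Set.Icc (0 : ℝ) 1 := fun x hx => by
    have h := (mem_hull_iff K x).1 hx
    refine ⟨h w, ?_⟩
    rw [← (bary K).sum_coord_apply_eq_one x]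
    exact Finset.single_le_sum (f := fun w => (bary K).coord w x) (fun w _ => h w)
      (Finset.mem_univ _)
  have h1 := inner_eq_coord_mul K w hν hv (x₀ + ρ • ν)
  have h2 := inner_eq_coord_mul K w hν hv x₀
  rw [add_sub_right_comm, inner_add_right, real_inner_smul_right, real_inner_self_eq_norm_sq, hν1,
    h2] at h1
  have h3 := hc _ (hB.add_smul_mem hν1)
  have h4 := hc _ hB.center_mem
  have h5 : ρ = ((bary K).coord w (x₀ + ρ • ν) - (bary K).coord w x₀) *
      inner ℝ ν ((w : Space d) - P.vertex) := by linarith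
  calc ρ = |ρ| := (abs_of_pos hB.pos).symm
    _ = |(bary K).coord w (x₀ + ρ • ν) - (bary K).coord w x₀| *
        |inner ℝ ν ((w : Space d) - P.vertex)| := by rw [← abs_mul, ← h5]
    _ ≤ 1 * _ := by
        refine mul_le_mul_of_nonneg_right (abs_le.2 ⟨?_, ?_⟩) (abs_nonneg _)
        · linarith [h3.1, h4.2]
        · linarith [h3.2, h4.1]
    _ = _ := one_mul _

end ElementBall

theorem sq_sum_mul_le (e : Space d) (f : Fin d → ℝ) :
    (∑ j, f j * e j) ^ 2 ≤ ‖e‖ ^ 2 * ∑ j, f j ^ 2 := by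
  rw [EuclideanSpace.real_norm_sq_eq, mul_comm]
  exact Finset.sum_mul_sq_le_sq_mul_sq _ _ _

/-- The trace inequality with the weight `δ`, for one polynomial. -/
theorem exists_trace_estimate (d p : ℕ) (hd : 1 ≤ d) (γ : ℝ) (hγ : 0 < γ) : ∃ C : ℝ, 0 < C ∧
    ∀ (P : VertexPatch d) (t : Tent P) (K : P.elems) (x₀ : Space d) (ρ κ : ℝ),
      ElementBall K γ x₀ ρ → t.δ P.vertex ≤ κ * ρ → ∀ (w : K.1) (ν : Space d), w ≠ apex K →
      ‖ν‖ = 1 → (∀ x ∈ K.1.erase w, ∀ y ∈ K.1.erase w, inner ℝ ν (y - x) = 0) →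
      ∀ q : MvPolynomial (Fin d) ℝ, q.totalDegree ≤ p →
        ∫ x in hull (K.1.erase w), peval (t.δpoly K) x * peval q x ^ 2
          ∂(Measure.euclideanHausdorffMeasure (d - 1)) ≤
          C * κ * ∫ x in hull K.1, peval q x ^ 2 := by
  obtain ⟨C₀, hC₀, H⟩ := exists_inverse_estimate d p γ
  refine ⟨γ + 1 + γ ^ 2 * d * C₀, by positivity, ?_⟩
  intro P t K x₀ ρ κ hB hκ w ν hw hν1 hν q hq
  set e : Space d := (w : Space d) - P.vertex with he
  set δ₀ := t.δ P.vertex with hδ₀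
  have hδ0 : 0 ≤ δ₀ := t.δ_vertex_nonneg
  have hρ := hB.pos
  have hcomp := isCompact_hull K.1
  have hm : MeasurableSet (hull K.1) := hcomp.isClosed.measurableSet
  have hen : ‖e‖ ≤ γ * ρ := by
    rw [he, ← dist_eq_norm]
    exact hB.dist_le (subset_convexHull ℝ _ w.2) (subset_convexHull ℝ _ mem_apex)
  have hI : ∀ f : Space d → ℝ, Continuous f → IntegrableOn f (hull K.1) := fun f hf =>
    hf.continuousOn.integrableOn_compact hcomp
  have hev : ∀ x, peval (t.δpoly K * q ^ 2) x = peval (t.δpoly K) x * peval q x ^ 2 := fun x => by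
    simp [peval]
  have h0 : ∀ x ∈ hull (K.1.erase P.vertex), peval (t.δpoly K * q ^ 2) x = 0 := fun x hx => by
    rw [hev, t.peval_δpoly_opposite K hx, zero_mul]
  -- The divergence theorem for δ q² along the edge e. Its left side is of order δ(v) by the
  -- gradient bound for δ and the inverse inequality, and |⟨ν, e⟩| ≥ ρ, which produces the ratio
  -- δ(v)/ρ ≤ κ.
  have key := integral_fderiv_edge hd K w hw hν1 hν (contDiff_peval (t.δpoly K * q ^ 2)) h0
  simp only [hev] at key
  set I := ∫ x in hull K.1, peval q x ^ 2 with hIdef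
  have hI0 : 0 ≤ I := integral_nonneg fun x => sq_nonneg _
  have hpt : ∀ x ∈ hull K.1, -fderiv ℝ (peval (t.δpoly K * q ^ 2)) x e ≤
      δ₀ * (γ + 1) * peval q x ^ 2 +
        ∑ j, δ₀ * (γ * ρ) ^ 2 * peval (MvPolynomial.pderiv j q) x ^ 2 := by
    intro x hx
    have hδx := t.δ_mem_Icc K hx
    rw [t.δ_eq_peval K hx] at hδx
    set D := ∑ j, peval (MvPolynomial.pderiv j q) x * e j with hD
    have hfd : fderiv ℝ (peval (t.δpoly K * q ^ 2)) x e =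
        inner ℝ (t.gradδ K) e * peval q x ^ 2 + peval (t.δpoly K) x * (2 * peval q x * D) := by
      have hin : inner ℝ (t.gradδ K) e = ∑ j, t.gradδ K j * e j := by
        simp [PiLp.inner_apply, mul_comm]
      rw [fderiv_peval, hin, hD, Finset.sum_mul, Finset.mul_sum, Finset.mul_sum,
        ← Finset.sum_add_distrib]
      refine Finset.sum_congr rfl fun j _ => ?_
      simp [peval, Tent.pderiv_δpoly]
      ring
    have h1 : -(inner ℝ (t.gradδ K) e) ≤ δ₀ * γ := by
      have h2 := (abs_le.1 (abs_real_inner_le_norm (t.gradδ K) e)).1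
      have h3 : ‖t.gradδ K‖ * ‖e‖ ≤ ‖t.gradδ K‖ * (γ * ρ) :=
        mul_le_mul_of_nonneg_left hen (norm_nonneg _)
      have h4 := mul_le_mul_of_nonneg_right (hB.norm_gradδ_mul_le t) hγ.le
      nlinarith
    have h2 : D ^ 2 ≤ (γ * ρ) ^ 2 * ∑ j, peval (MvPolynomial.pderiv j q) x ^ 2 :=
      (sq_sum_mul_le e _).trans (mul_le_mul_of_nonneg_right
        (pow_le_pow_left₀ (norm_nonneg _) hen 2) (Finset.sum_nonneg fun j _ => sq_nonneg _))
    have h3 : -(peval (t.δpoly K) x * (2 * peval q x * D)) ≤ δ₀ * (peval q x ^ 2 + D ^ 2) := by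
      have h4 : -(2 * peval q x * D) ≤ peval q x ^ 2 + D ^ 2 := by
        nlinarith [sq_nonneg (peval q x + D)]
      have h5 : 0 ≤ peval q x ^ 2 + D ^ 2 := by positivity
      calc _ = peval (t.δpoly K) x * -(2 * peval q x * D) := by ring
        _ ≤ peval (t.δpoly K) x * (peval q x ^ 2 + D ^ 2) :=
          mul_le_mul_of_nonneg_left h4 hδx.1
        _ ≤ _ := mul_le_mul_of_nonneg_right hδx.2 h5
    rw [hfd, ← Finset.mul_sum]
    have h6 := mul_le_mul_of_nonneg_right h1 (sq_nonneg (peval q x))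
    have h7 := mul_le_mul_of_nonneg_left h2 hδ0
    nlinarith
  have hint : -∫ x in hull K.1, fderiv ℝ (peval (t.δpoly K * q ^ 2)) x e ≤
      δ₀ * (γ + 1 + γ ^ 2 * d * C₀) * I := by
    rw [← integral_neg]
    have hc1 : Continuous fun x => -fderiv ℝ (peval (t.δpoly K * q ^ 2)) x e :=
      (((contDiff_peval (n := 1) (t.δpoly K * q ^ 2)).continuous_fderiv one_ne_zero).clm_apply
        continuous_const).neg
    have hcj : ∀ j, Continuous fun x => δ₀ * (γ * ρ) ^ 2 *
        peval (MvPolynomial.pderiv j q) x ^ 2 := fun j =>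
      continuous_const.mul ((continuous_peval _).pow 2)
    have hcq : Continuous fun x => δ₀ * (γ + 1) * peval q x ^ 2 :=
      continuous_const.mul ((continuous_peval _).pow 2)
    refine (setIntegral_mono_on (hI _ hc1)
      ((hI _ hcq).add (hI _ (continuous_finsetSum _ fun j _ => hcj j))) hm hpt).trans ?_
    rw [integral_add' (hI _ hcq) (hI _ (continuous_finsetSum _ fun j _ => hcj j)),
      integral_finsetSum _ fun j _ => hI _ (hcj j)]
    simp only [integral_const_mul]
    have hj : ∀ j ∈ Finset.univ, δ₀ * (γ * ρ) ^ 2 *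
        ∫ x in hull K.1, peval (MvPolynomial.pderiv j q) x ^ 2 ≤ δ₀ * γ ^ 2 * C₀ * I := by
      intro j _
      have := H (hull K.1) x₀ ρ hρ hcomp hB.ball_subset hB.subset_closedBall q hq j
      calc _ ≤ δ₀ * (γ * ρ) ^ 2 * (C₀ / ρ ^ 2 * I) := by gcongr
        _ = _ := by field_simp
    have := Finset.sum_le_sum hj
    simp only [Finset.sum_const, Finset.card_univ, Fintype.card_fin, nsmul_eq_mul] at this
    nlinarith
  set T := ∫ x in hull (K.1.erase w), peval (t.δpoly K) x * peval q x ^ 2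
          ∂(Measure.euclideanHausdorffMeasure (d - 1)) with hT
  have hab := hB.le_abs_inner hw hν1 hν
  rw [key, neg_mul, neg_neg] at hint
  rcases le_total T 0 with hT0 | hT0
  · refine hT0.trans ?_
    have : 0 ≤ κ := le_of_mul_le_mul_right (by rw [zero_mul]; exact hδ0.trans hκ) hρ
    positivity
  · have h1 : ρ * T ≤ δ₀ * (γ + 1 + γ ^ 2 * d * C₀) * I :=
      (mul_le_mul_of_nonneg_right hab hT0).trans hint
    have h2 : δ₀ * (γ + 1 + γ ^ 2 * d * C₀) * I ≤ κ * ρ * (γ + 1 + γ ^ 2 * d * C₀) * I := by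
      gcongr
    refine le_of_mul_le_mul_left ?_ hρ
    linarith

end

/-! ### Bounds for the transport operator and the traces -/

section

variable {d b p : ℕ} {P : VertexPatch d}

theorem two_mul_dotProduct_le (a v : Fin b → ℝ) {lam : ℝ} (hl : 0 < lam) :
    2 * (a ⬝ᵥ v) ≤ lam * (a ⬝ᵥ a) + lam⁻¹ * (v ⬝ᵥ v) := by
  simp only [dotProduct, Finset.mul_sum, ← Finset.sum_add_distrib]
  refine Finset.sum_le_sum fun i _ => ?_
  have h : lam * lam⁻¹ = 1 := mul_inv_cancel₀ hl.ne'
  have := mul_nonneg hl.le (sq_nonneg (a i - lam⁻¹ * v i))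
  have e : lam * (a i - lam⁻¹ * v i) ^ 2 = lam * (a i * a i) - 2 * (lam * lam⁻¹) * (a i * v i) +
    (lam * lam⁻¹) * (lam⁻¹ * (v i * v i)) := by ring
  rw [e, h] at this
  linarith

theorem dotProduct_self_nonneg (a : Fin b → ℝ) : 0 ≤ a ⬝ᵥ a :=
  Finset.sum_nonneg fun _ _ => mul_self_nonneg _

theorem dotProduct_self_add_le (a v : Fin b → ℝ) :
    (a + v) ⬝ᵥ (a + v) ≤ 2 * (a ⬝ᵥ a + v ⬝ᵥ v) := by
  simp only [dotProduct, ← Finset.sum_add_distrib, Finset.mul_sum, Pi.add_apply]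
  exact Finset.sum_le_sum fun i _ => by nlinarith [sq_nonneg (a i - v i)]

theorem dotProduct_self_sub_le (a v : Fin b → ℝ) :
    (a - v) ⬝ᵥ (a - v) ≤ 2 * (a ⬝ᵥ a + v ⬝ᵥ v) := by
  simpa [sub_eq_add_neg] using dotProduct_self_add_le a (-v)

theorem mulVec_dotProduct_self_le {M : Matrix (Fin b) (Fin b) ℝ} {β : ℝ}
    (hM : ∀ i j, |M i j| ≤ β) (u : Fin b → ℝ) :
    (M *ᵥ u) ⬝ᵥ (M *ᵥ u) ≤ (b * β) ^ 2 * (u ⬝ᵥ u) := by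
  have h : ∀ i, (M *ᵥ u) i * (M *ᵥ u) i ≤ b * β ^ 2 * (u ⬝ᵥ u) := fun i => by
    rw [← sq]
    refine LE.le.trans (Finset.sum_mul_sq_le_sq_mul_sq Finset.univ (M i) u) ?_
    have h1 : ∑ j, M i j ^ 2 ≤ b * β ^ 2 := by
      have h2 : ∀ j ∈ Finset.univ, M i j ^ 2 ≤ β ^ 2 := fun j _ =>
        sq_le_sq' (abs_le.1 (hM i j)).1 (abs_le.1 (hM i j)).2
      simpa using Finset.sum_le_sum h2
    have h2 : u ⬝ᵥ u = ∑ j, u j ^ 2 := by simp [dotProduct, sq]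
    rw [h2]
    exact mul_le_mul_of_nonneg_right h1 (Finset.sum_nonneg fun j _ => sq_nonneg _)
  refine (Finset.sum_le_sum fun i _ => h i).trans ?_
  simp only [Finset.sum_const, Finset.card_univ, Fintype.card_fin, nsmul_eq_mul]
  exact le_of_eq (by ring)

theorem sum_dotProduct_self_le (a : Fin d → Fin b → ℝ) :
    (∑ j, a j) ⬝ᵥ (∑ j, a j) ≤ d * ∑ j, a j ⬝ᵥ a j := by
  simp only [dotProduct]
  rw [Finset.sum_comm, Finset.mul_sum]
  refine Finset.sum_le_sum fun i _ => ?_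
  have := sq_sum_le_card_mul_sum_sq (s := Finset.univ) (f := fun j => a j i)
  simpa [sq] using this

theorem Coefficients.abs_dir_le {c : Coefficients P b} {g₀ Λ c₀ : ℝ} (hc : c.Admissible g₀ Λ c₀)
    (K : P.elems) (n : Space d) (l k : Fin b) : |c.dir K n l k| ≤ d * |Λ| * ‖n‖ := by
  rw [Coefficients.dir, Matrix.sum_apply]
  refine (Finset.abs_sum_le_sum_abs _ _).trans ?_
  have h : ∀ j ∈ Finset.univ, |(n j • c.L K j) l k| ≤ |Λ| * ‖n‖ := fun j _ => by
    rw [Matrix.smul_apply, smul_eq_mul, abs_mul, mul_comm]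
    exact mul_le_mul ((hc.L_bound K j l k).trans (le_abs_self _)) (PiLp.norm_apply_le n j)
      (abs_nonneg _) (abs_nonneg _)
  refine (Finset.sum_le_sum h).trans ?_
  simp [mul_assoc]

theorem ip_self_mulOp_le {W : P.elems → Matrix (Fin b) (Fin b) ℝ} {β : ℝ}
    (hW : ∀ K i j, |W K i j| ≤ β) (u : DGSpace P b p) :
    ip P b p (mulOp W u) (mulOp W u) ≤ (b * β) ^ 2 * ip P b p u u := by
  rw [ip_eq, ip_eq, Finset.mul_sum]
  refine Finset.sum_le_sum fun K _ => ?_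
  rw [← integral_const_mul]
  refine setIntegral_mono_on ?_ ?_ (isCompact_hull K.1).isClosed.measurableSet fun x _ => ?_
  · exact ((continuous_val _ K).dotProduct (continuous_val _ K)).continuousOn.integrableOn_compact
      (isCompact_hull _)
  · exact (continuous_const.mul ((continuous_val u K).dotProduct
      (continuous_val u K))).continuousOn.integrableOn_compact (isCompact_hull _)
  · rw [val_mulOp]
    exact mulVec_dotProduct_self_le (hW K) _

/-- All elements of the patch contain balls expressing shape regularity, whose radii bound the
height of the tent up to the factor `κ`. -/
def Tent.HeightBound (t : Tent P) (γ κ : ℝ) : Prop :=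
  ∀ K : P.elems, ∃ (x₀ : Space d) (ρ : ℝ), ElementBall K γ x₀ ρ ∧ t.δ P.vertex ≤ κ * ρ

/-- The factor δ ≤ κ ρ cancels the 1/ρ of the inverse inequality, so only κ survives. -/
theorem exists_transport_bound (d b p : ℕ) (γ Λ : ℝ) : ∃ C : ℝ, 0 < C ∧
    ∀ (P : VertexPatch d) (hp : 0 < p) (c : Coefficients P b) (g₀ c₀ : ℝ),
      c.Admissible g₀ Λ c₀ → ∀ (t : Tent P) (κ : ℝ), t.HeightBound γ κ → ∀ u : DGSpace P b p,
        ip P b p (transport hp c t u) (transport hp c t u) ≤ C * κ ^ 2 * ip P b p u u := by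
  obtain ⟨C₀, hC₀, H⟩ := exists_inverse_estimate d p γ
  refine ⟨(d * (b * Λ)) ^ 2 * C₀ + 1, by positivity, ?_⟩
  intro P hp c g₀ c₀ hc t κ ht u
  rw [ip_eq, ip_eq, Finset.mul_sum]
  refine Finset.sum_le_sum fun K _ => ?_
  obtain ⟨x₀, ρ, hB, hκ⟩ := ht K
  have hρ := hB.pos
  have hδ0 := t.δ_vertex_nonneg
  have hcomp := isCompact_hull K.1
  have hm : MeasurableSet (hull K.1) := hcomp.isClosed.measurableSet
  have hI : ∀ f : Space d → ℝ, Continuous f → IntegrableOn f (hull K.1) := fun f hf =>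
    hf.continuousOn.integrableOn_compact hcomp
  have hcu : Continuous fun x => val u K x ⬝ᵥ val u K x :=
    (continuous_val u K).dotProduct (continuous_val u K)
  have hcd : ∀ j, Continuous fun x => pdv u K j x ⬝ᵥ pdv u K j x := fun j =>
    (continuous_pdv u K j).dotProduct (continuous_pdv u K j)
  have hpt : ∀ x ∈ hull K.1, val (transport hp c t u) K x ⬝ᵥ val (transport hp c t u) K x ≤
      (κ * ρ) ^ 2 * (d * (b * Λ) ^ 2) * ∑ j, pdv u K j x ⬝ᵥ pdv u K j x := by
    intro x hx
    have hδx := t.δ_mem_Icc K hx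
    rw [t.δ_eq_peval K hx] at hδx
    rw [val_transport, smul_dotProduct, dotProduct_smul, smul_eq_mul, smul_eq_mul, ← mul_assoc,
      neg_mul_neg, ← sq, mul_assoc]
    refine mul_le_mul (pow_le_pow_left₀ hδx.1 (hδx.2.trans hκ) 2) ?_ (dotProduct_self_nonneg _)
      (sq_nonneg _)
    refine (sum_dotProduct_self_le _).trans ?_
    rw [mul_assoc, Finset.mul_sum Finset.univ _ ((b * Λ) ^ 2)]
    refine mul_le_mul_of_nonneg_left (Finset.sum_le_sum fun j _ => ?_) (Nat.cast_nonneg (α := ℝ) d)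
    exact mulVec_dotProduct_self_le (hc.L_bound K j) _
  have hder : ∀ j, ∫ x in hull K.1, pdv u K j x ⬝ᵥ pdv u K j x ≤
      C₀ / ρ ^ 2 * ∫ x in hull K.1, val u K x ⬝ᵥ val u K x := by
    intro j
    simp only [dotProduct, val_eq_peval, pdv_eq_peval, ← sq]
    have hc2 : ∀ q : MvPolynomial (Fin d) ℝ, Continuous fun x => peval q x ^ 2 := fun q =>
      (continuous_peval q).pow 2
    rw [integral_finsetSum _ fun l _ => hI _ (hc2 _), integral_finsetSum _ fun l _ => hI _ (hc2 _),
      Finset.mul_sum]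
    exact Finset.sum_le_sum fun l _ => H _ x₀ ρ hρ hcomp hB.ball_subset hB.subset_closedBall _
      (totalDegree_dg_le u K l) j
  have hcs : Continuous fun x => (κ * ρ) ^ 2 * (d * (b * Λ) ^ 2) *
      ∑ j, pdv u K j x ⬝ᵥ pdv u K j x :=
    continuous_const.mul (continuous_finsetSum _ fun j _ => hcd j)
  refine (setIntegral_mono_on (hI _ ((continuous_val _ K).dotProduct (continuous_val _ K)))
    (hI _ hcs) hm hpt).trans ?_
  rw [integral_const_mul, integral_finsetSum _ fun j _ => hI _ (hcd j)]
  have h1 := Finset.sum_le_sum fun j (_ : j ∈ Finset.univ) => hder j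
  simp only [Finset.sum_const, Finset.card_univ, Fintype.card_fin, nsmul_eq_mul] at h1
  set I := ∫ x in hull K.1, val u K x ⬝ᵥ val u K x with hIdef
  have hI0 : 0 ≤ I := integral_nonneg fun x => dotProduct_self_nonneg _
  refine (mul_le_mul_of_nonneg_left h1 (by positivity)).trans ?_
  have e : (κ * ρ) ^ 2 * (d * (b * Λ) ^ 2) * (d * (C₀ / ρ ^ 2 * I)) =
      (d * (b * Λ)) ^ 2 * C₀ * κ ^ 2 * I := by
    field_simp
  rw [e]
  gcongr
  linarith

/-- The weighted norm of the traces on the sides of the facets to which the normals point. -/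
def traceFun (t : Tent P) (ν : P.facets → Space d) (u : DGSpace P b p) : ℝ :=
  ∑ F : P.facets, ∫ x in hull F.1, t.δ x * (tracePlus ν u F x ⬝ᵥ tracePlus ν u F x)
    ∂(Measure.euclideanHausdorffMeasure (d - 1))

theorem card_plus_facets_le (ν : P.facets → Space d) (K : P.elems) :
    (Finset.univ.filter fun F : P.facets => K ∈ plusElems ν F).card ≤ d + 1 := by
  have h : ((Finset.univ.filter fun F : P.facets => K ∈ plusElems ν F).map
      (Function.Embedding.subtype _)) ⊆ K.1.powersetCard d := by
    intro F hF
    simp only [Finset.mem_map, Finset.mem_filter, Finset.mem_univ, true_and,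
      Function.Embedding.coe_subtype] at hF
    obtain ⟨F', hF', rfl⟩ := hF
    simp only [plusElems, Finset.mem_filter, Finset.mem_univ, true_and] at hF'
    exact Finset.mem_powersetCard.2 ⟨hF'.1, card_facet F'⟩
  have := Finset.card_le_card h
  rw [Finset.card_map, Finset.card_powersetCard, card_elem, Nat.choose_succ_self_right] at this
  exact this

/-- Each facet through the central vertex is charged to its unique element on the positive side, and
an element is charged by at most d + 1 facets. The other facets carry weight zero. -/
theorem exists_trace_bound (d b p : ℕ) (hd : 1 ≤ d) (γ : ℝ) (hγ : 0 < γ) : ∃ C : ℝ, 0 < C ∧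
    ∀ (P : VertexPatch d) (t : Tent P) (ν : P.facets → Space d) (κ : ℝ), 0 ≤ κ →
      IsNormalField P ν → t.HeightBound γ κ → ∀ u : DGSpace P b p,
        traceFun t ν u ≤ C * κ * ip P b p u u := by
  obtain ⟨C₀, hC₀, H⟩ := exists_trace_estimate d p hd γ hγ
  refine ⟨C₀ * (d + 1), by positivity, ?_⟩
  intro P t ν κ hκ0 hν ht u
  set I : P.elems → ℝ := fun K => ∫ x in hull K.1, val u K x ⬝ᵥ val u K x with hIdef
  have hI0 : ∀ K, 0 ≤ I K := fun K => integral_nonneg fun x => dotProduct_self_nonneg _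
  have hF : ∀ F : P.facets, ∫ x in hull F.1, t.δ x * (tracePlus ν u F x ⬝ᵥ tracePlus ν u F x)
      ∂(Measure.euclideanHausdorffMeasure (d - 1)) ≤
      ∑ K : P.elems, if K ∈ plusElems ν F then C₀ * κ * I K else 0 := by
    intro F
    by_cases hvF : P.vertex ∈ F.1
    · obtain ⟨K, hK⟩ := exists_plusElems_eq hν hvF
      have hFK : F.1 ⊆ K.1 := by
        have : K ∈ plusElems ν F := by rw [hK]; exact Finset.mem_singleton_self _
        exact (Finset.mem_filter.1 this).2.1
      obtain ⟨w, hw⟩ := exists_eq_erase hFK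
      have hwa : w ≠ apex K := by
        rintro rfl
        rw [hw] at hvF
        simp at hvF
      obtain ⟨x₀, ρ, hB, hκ⟩ := ht K
      simp only [hK, Finset.mem_singleton, Finset.sum_ite_eq', Finset.mem_univ, if_true,
        tracePlus_eq hK]
      have hsub : hull F.1 ⊆ hull K.1 := convexHull_mono (by exact_mod_cast hFK)
      have hm := (isCompact_hull F.1).isClosed.measurableSet
      have e : ∀ x ∈ hull F.1, t.δ x * (val u K x ⬝ᵥ val u K x) =
          ∑ l, t.δ x * peval (u K l : MvPolynomial (Fin d) ℝ) x ^ 2 := fun x hx => by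
        rw [dotProduct, Finset.mul_sum]
        simp only [val_eq_peval, ← sq]
      have hc2 : ∀ q : MvPolynomial (Fin d) ℝ, Continuous fun x => peval q x ^ 2 := fun q =>
        (continuous_peval q).pow 2
      rw [setIntegral_congr_fun hm e, integral_finsetSum _ fun l _ =>
        integrableOn_facet_of_continuous t F (hc2 _)]
      simp only [hIdef, dotProduct, val_eq_peval, ← sq]
      rw [integral_finsetSum _ fun l _ =>
        (hc2 _).continuousOn.integrableOn_compact (isCompact_hull K.1), Finset.mul_sum]
      refine Finset.sum_le_sum fun l _ => ?_
      have := H P t K x₀ ρ κ hB hκ w (ν F) hwa (hν F).1 (hw ▸ (hν F).2) _ (totalDegree_dg_le u K l)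
      rw [← hw] at this
      refine le_of_eq_of_le (setIntegral_congr_fun hm fun x hx => ?_) this
      simp only [t.δ_eq_peval K (hsub hx)]
    · rw [setIntegral_eq_zero_of_forall_eq_zero fun x hx => by
        rw [t.δ_eq_zero_of_notMem hvF hx, zero_mul]]
      refine Finset.sum_nonneg fun K _ => ?_
      split_ifs
      · have := hI0 K; positivity
      · exact le_rfl
  refine (Finset.sum_le_sum fun F _ => hF F).trans ?_
  rw [Finset.sum_comm, ip_eq, Finset.mul_sum]
  refine Finset.sum_le_sum fun K _ => ?_
  rw [← Finset.sum_filter, Finset.sum_const, nsmul_eq_mul]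
  have h1 : ((Finset.univ.filter fun F : P.facets => K ∈ plusElems ν F).card : ℝ) ≤ d + 1 := by
    exact_mod_cast card_plus_facets_le ν K
  have h2 := mul_le_mul_of_nonneg_right h1 (mul_nonneg (mul_nonneg hC₀.le hκ0) (hI0 K))
  refine h2.trans (le_of_eq ?_)
  simp only [hIdef]
  ring

end

/-! ### Bounds for the dissipation and the jump form -/

section

variable {d b p : ℕ} {P : VertexPatch d}

/-- Flipping all normals exchanges the two sides, so the bound for one trace serves for both. -/
theorem tracePlus_neg (ν : P.facets → Space d) (u : DGSpace P b p) (F : P.facets) (x : Space d) :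
    tracePlus (fun F => -ν F) u F x = traceMinus ν u F x := by
  rw [tracePlus, traceMinus, minusElems_eq]

theorem continuous_tracePlus (ν : P.facets → Space d) (u : DGSpace P b p) (F : P.facets) :
    Continuous (tracePlus ν u F) := continuous_finsetSum _ fun K _ => continuous_val u K

theorem continuous_traceMinus (ν : P.facets → Space d) (u : DGSpace P b p) (F : P.facets) :
    Continuous (traceMinus ν u F) := continuous_finsetSum _ fun K _ => continuous_val u K

theorem facetMatrix_abs_le {c : Coefficients P b} {g₀ Λ c₀ : ℝ} (hc : c.Admissible g₀ Λ c₀)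
    {ν : P.facets → Space d} (hν : IsNormalField P ν) {F : P.facets} (hvF : P.vertex ∈ F.1)
    (i j : Fin b) : |facetMatrix c ν F i j| ≤ d * |Λ| := by
  obtain ⟨K, hK⟩ := exists_plusElems_eq hν hvF
  rw [facetMatrix, hK, Finset.sum_singleton]
  simpa [(hν F).1] using Coefficients.abs_dir_le hc K (ν F) i j

theorem exists_abs_entry_le (S : Matrix (Fin b) (Fin b) ℝ) : ∃ β : ℝ, 0 ≤ β ∧ ∀ i j, |S i j| ≤ β := by
  refine ⟨∑ i, ∑ j, |S i j|, by positivity, fun i j => ?_⟩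
  exact (Finset.single_le_sum (f := fun j => |S i j|) (fun _ _ => abs_nonneg _)
    (Finset.mem_univ j)).trans (Finset.single_le_sum (f := fun i => ∑ j, |S i j|)
      (fun _ _ => Finset.sum_nonneg fun _ _ => abs_nonneg _) (Finset.mem_univ i))

theorem traceFun_add_eq (t : Tent P) (ν : P.facets → Space d) (u : DGSpace P b p) :
    traceFun t ν u + traceFun t (fun F => -ν F) u =
      ∑ F : P.facets, ∫ x in hull F.1, t.δ x * (tracePlus ν u F x ⬝ᵥ tracePlus ν u F x +
        traceMinus ν u F x ⬝ᵥ traceMinus ν u F x) ∂(Measure.euclideanHausdorffMeasure (d - 1)) := by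
  rw [traceFun, traceFun, ← Finset.sum_add_distrib]
  refine Finset.sum_congr rfl fun F _ => ?_
  simp only [tracePlus_neg, mul_add]
  rw [integral_add]
  · exact integrableOn_facet_of_continuous t F
      ((continuous_tracePlus ν u F).dotProduct (continuous_tracePlus ν u F))
  · exact integrableOn_facet_of_continuous t F
      ((continuous_traceMinus ν u F).dotProduct (continuous_traceMinus ν u F))

/-- Monotonicity of the weighted facet integrals; only the facets containing the central vertex
matter. -/
theorem sum_facet_integral_mono (t : Tent P) {f g : P.facets → Space d → ℝ}
    (hf : ∀ F, Continuous (f F)) (hg : ∀ F, Continuous (g F))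
    (hfg : ∀ F : P.facets, P.vertex ∈ F.1 → ∀ x, f F x ≤ g F x) :
    ∑ F : P.facets, ∫ x in hull F.1, t.δ x * f F x
        ∂(Measure.euclideanHausdorffMeasure (d - 1)) ≤
      ∑ F : P.facets, ∫ x in hull F.1, t.δ x * g F x
        ∂(Measure.euclideanHausdorffMeasure (d - 1)) := by
  refine Finset.sum_le_sum fun F _ => ?_
  refine setIntegral_mono_on (integrableOn_facet_of_continuous t F (hf F))
    (integrableOn_facet_of_continuous t F (hg F)) (isCompact_hull F.1).isClosed.measurableSet
    fun x hx => ?_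
  by_cases hvF : P.vertex ∈ F.1
  · obtain ⟨K, hK⟩ := facet_subset F
    exact mul_le_mul_of_nonneg_left (hfg F hvF x)
      (t.δ_mem_Icc K (convexHull_mono (by exact_mod_cast hK) hx)).1
  · rw [t.δ_eq_zero_of_notMem hvF hx, zero_mul, zero_mul]

theorem sum_facet_integral_linear (t : Tent P) {f g : P.facets → Space d → ℝ}
    (hf : ∀ F, Continuous (f F)) (hg : ∀ F, Continuous (g F)) (a a' : ℝ) :
    ∑ F : P.facets, ∫ x in hull F.1, t.δ x * (a * f F x + a' * g F x)
        ∂(Measure.euclideanHausdorffMeasure (d - 1)) =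
      a * ∑ F : P.facets, ∫ x in hull F.1, t.δ x * f F x
          ∂(Measure.euclideanHausdorffMeasure (d - 1)) +
        a' * ∑ F : P.facets, ∫ x in hull F.1, t.δ x * g F x
          ∂(Measure.euclideanHausdorffMeasure (d - 1)) := by
  rw [Finset.mul_sum, Finset.mul_sum, ← Finset.sum_add_distrib]
  refine Finset.sum_congr rfl fun F _ => ?_
  rw [← integral_const_mul, ← integral_const_mul, ← integral_add]
  · exact integral_congr_ae (Filter.Eventually.of_forall fun x => by simp only; ring)
  · exact (integrableOn_facet_of_continuous t F (hf F)).const_mul a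
  · exact (integrableOn_facet_of_continuous t F (hg F)).const_mul a'

theorem exists_dissFun_bound (d b p : ℕ) (hd : 1 ≤ d) (γ : ℝ) (hγ : 0 < γ)
    (S : Matrix (Fin b) (Fin b) ℝ) : ∃ C : ℝ, 0 < C ∧
    ∀ (P : VertexPatch d) (t : Tent P) (ν : P.facets → Space d) (κ : ℝ), 0 ≤ κ →
      IsNormalField P ν → t.HeightBound γ κ → ∀ u : DGSpace P b p,
        dissFun t ν S u u ≤ C * κ * ip P b p u u := by
  obtain ⟨C₀, hC₀, H⟩ := exists_trace_bound d b p hd γ hγ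
  obtain ⟨β, hβ, hS⟩ := exists_abs_entry_le S
  refine ⟨((b * β) ^ 2 + 1) * 2 * C₀, by positivity, ?_⟩
  intro P t ν κ hκ hν ht u
  have h1 := H P t ν κ hκ hν ht u
  have h2 := H P t _ κ hκ hν.neg ht u
  have h3 := traceFun_add_eq t ν u
  have hcp := continuous_tracePlus ν u
  have hcm := continuous_traceMinus ν u
  have hcT : ∀ F, Continuous fun x => tracePlus ν u F x ⬝ᵥ tracePlus ν u F x +
      traceMinus ν u F x ⬝ᵥ traceMinus ν u F x := fun F =>
    ((hcp F).dotProduct (hcp F)).add ((hcm F).dotProduct (hcm F))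
  have h4 : dissFun t ν S u u ≤ ((b * β) ^ 2 + 1) *
      (traceFun t ν u + traceFun t (fun F => -ν F) u) := by
    have h5 := sum_facet_integral_linear t hcT hcT ((b * β) ^ 2 + 1) 0
    rw [zero_mul, add_zero] at h5
    rw [h3, ← h5]
    refine sum_facet_integral_mono t (fun F => ?_) (fun F => ?_) fun F _ x => ?_
    · exact (continuous_const.matrix_mulVec (continuous_jump ν u F)).dotProduct
        (continuous_jump ν u F)
    · exact (continuous_const.mul (hcT F)).add (continuous_const.mul (hcT F))
    · have e1 := two_mul_dotProduct_le (S *ᵥ jump ν u F x) (jump ν u F x) one_pos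
      have e2 := mulVec_dotProduct_self_le hS (jump ν u F x)
      have e3 := dotProduct_self_sub_le (tracePlus ν u F x) (traceMinus ν u F x)
      rw [← jump] at e3
      rw [inv_one, one_mul, one_mul] at e1
      nlinarith [sq_nonneg (b * β)]
  nlinarith [sq_nonneg (b * β)]

/-- Weighted Young inequality on each facet: the jumps of u are controlled by the dissipation
through the lower bound σ of S, and the traces of v by its L² norm. The coefficient 1 of the last
term lets it be absorbed when v represents the form. -/
theorem exists_jumpFun_bound (d b p : ℕ) (hd : 1 ≤ d) (γ : ℝ) (hγ : 0 < γ) (Λ : ℝ)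
    (S : Matrix (Fin b) (Fin b) ℝ) (hS : S.PosDef) : ∃ C : ℝ, 0 < C ∧
    ∀ (P : VertexPatch d) (c : Coefficients P b) (g₀ c₀ : ℝ) (t : Tent P)
      (ν : P.facets → Space d) (κ : ℝ), 0 < κ → c.Admissible g₀ Λ c₀ →
      IsNormalField P ν → t.HeightBound γ κ → ∀ u v : DGSpace P b p,
        2 * jumpFun c t ν S u v ≤ C * κ * dissFun t ν S u u + ip P b p v v := by
  obtain ⟨C₀, hC₀, H⟩ := exists_trace_bound d b p hd γ hγ
  obtain ⟨β, hβ, hSβ⟩ := exists_abs_entry_le S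
  obtain ⟨σ, hσ, hSσ⟩ := exists_lower_bound_of_dotProduct_pos S fun w hw => by
    simpa using hS.dotProduct_mulVec_pos hw
  set B : ℝ := (b * (d * |Λ|)) ^ 2 + (b * β) ^ 2 with hB
  refine ⟨5 * C₀ * (B * σ⁻¹) + 1, by positivity, ?_⟩
  intro P c g₀ c₀ t ν κ hκ hc hν ht u v
  have h1 := H P t ν κ hκ.le hν ht v
  have h2 := H P t _ κ hκ.le hν.neg ht v
  have h3 := traceFun_add_eq t ν v
  have hcp := continuous_tracePlus ν v
  have hcm := continuous_traceMinus ν v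
  have hcT : ∀ F, Continuous fun x => tracePlus ν v F x ⬝ᵥ tracePlus ν v F x +
      traceMinus ν v F x ⬝ᵥ traceMinus ν v F x := fun F =>
    ((hcp F).dotProduct (hcp F)).add ((hcm F).dotProduct (hcm F))
  have hcS : ∀ F, Continuous fun x => (S *ᵥ jump ν u F x) ⬝ᵥ jump ν u F x := fun F =>
    (continuous_const.matrix_mulVec (continuous_jump ν u F)).dotProduct (continuous_jump ν u F)
  have hcJ : ∀ F, Continuous fun x => (facetMatrix c ν F *ᵥ jump ν u F x) ⬝ᵥ avg ν v F x +
      (S *ᵥ jump ν u F x) ⬝ᵥ jump ν v F x := fun F =>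
    ((continuous_const.matrix_mulVec (continuous_jump ν u F)).dotProduct
      (continuous_avg ν v F)).add ((continuous_const.matrix_mulVec
        (continuous_jump ν u F)).dotProduct (continuous_jump ν v F))
  -- Average and jump together cost 5/2 of the squared traces, which sum to at most 2 C₀ κ ‖v‖²;
  -- with this weight the result is exactly ‖v‖².
  set lam : ℝ := 5 * C₀ * κ with hlam
  have hl : 0 < lam := by positivity
  have h4 : 2 * jumpFun c t ν S u v ≤ lam * (B * σ⁻¹) * dissFun t ν S u u +
      lam⁻¹ * (5 / 2) * (traceFun t ν v + traceFun t (fun F => -ν F) v) := by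
    have h5 := sum_facet_integral_linear t hcJ hcJ 2 0
    rw [zero_mul, add_zero] at h5
    rw [h3, jumpFun, ← h5, dissFun, ← sum_facet_integral_linear t hcS hcT]
    refine sum_facet_integral_mono t (fun F => ?_) (fun F => ?_) fun F hvF x => ?_
    · exact (continuous_const.mul (hcJ F)).add (continuous_const.mul (hcJ F))
    · exact (continuous_const.mul (hcS F)).add (continuous_const.mul (hcT F))
    · have e1 := two_mul_dotProduct_le (facetMatrix c ν F *ᵥ jump ν u F x) (avg ν v F x) hl
      have e2 := two_mul_dotProduct_le (S *ᵥ jump ν u F x) (jump ν v F x) hl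
      have e3 := mulVec_dotProduct_self_le (facetMatrix_abs_le hc hν hvF) (jump ν u F x)
      have e4 := mulVec_dotProduct_self_le hSβ (jump ν u F x)
      have e5 := dotProduct_self_sub_le (tracePlus ν v F x) (traceMinus ν v F x)
      rw [← jump] at e5
      have e6 := dotProduct_self_add_le (tracePlus ν v F x) (traceMinus ν v F x)
      have e7 : avg ν v F x ⬝ᵥ avg ν v F x = 1 / 4 * ((tracePlus ν v F x + traceMinus ν v F x) ⬝ᵥ
          (tracePlus ν v F x + traceMinus ν v F x)) := by
        rw [avg, smul_dotProduct, dotProduct_smul, smul_eq_mul, smul_eq_mul]; ring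
      have e8 : jump ν u F x ⬝ᵥ jump ν u F x ≤ σ⁻¹ * ((S *ᵥ jump ν u F x) ⬝ᵥ jump ν u F x) := by
        rw [le_inv_mul_iff₀ hσ, dotProduct_comm (S *ᵥ _)]
        exact hSσ _
      set j := jump ν u F x ⬝ᵥ jump ν u F x
      set T := tracePlus ν v F x ⬝ᵥ tracePlus ν v F x + traceMinus ν v F x ⬝ᵥ traceMinus ν v F x
      have e9 : lam * ((facetMatrix c ν F *ᵥ jump ν u F x) ⬝ᵥ (facetMatrix c ν F *ᵥ jump ν u F x) +
          (S *ᵥ jump ν u F x) ⬝ᵥ (S *ᵥ jump ν u F x)) ≤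
          lam * (B * (σ⁻¹ * ((S *ᵥ jump ν u F x) ⬝ᵥ jump ν u F x))) := by
        refine mul_le_mul_of_nonneg_left ?_ hl.le
        refine (add_le_add e3 e4).trans ?_
        rw [← add_mul]
        exact mul_le_mul_of_nonneg_left e8 (by positivity)
      have e10 : lam⁻¹ * (avg ν v F x ⬝ᵥ avg ν v F x + jump ν v F x ⬝ᵥ jump ν v F x) ≤
          lam⁻¹ * (5 / 2 * T) :=
        mul_le_mul_of_nonneg_left (by linarith) (inv_nonneg.2 hl.le)
      linarith
  have h5 : lam⁻¹ * (5 / 2) * (traceFun t ν v + traceFun t (fun F => -ν F) v) ≤ ip P b p v v := by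
    calc _ ≤ lam⁻¹ * (5 / 2) * (2 * (C₀ * κ * ip P b p v v)) := by
          refine mul_le_mul_of_nonneg_left (by linarith) (by positivity)
      _ = ip P b p v v := by rw [hlam]; field_simp
  have h6 : 0 ≤ dissFun t ν S u u := dissForm_nonneg t ν hS u
  have h7 : 0 ≤ κ * dissFun t ν S u u := mul_nonneg hκ.le h6
  have h8 : (5 * C₀ * (B * σ⁻¹) + 1) * κ * dissFun t ν S u u =
      lam * (B * σ⁻¹) * dissFun t ν S u u + κ * dissFun t ν S u u := by rw [hlam]; ring
  linarith

/-! ### Coercivity of the mass operators -/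

/-- A bound for the generalized eigenvalues of a pencil bounds its Rayleigh quotient. -/
theorem dotProduct_mulVec_le_of_eigenvalue_le {G M : Matrix (Fin b) (Fin b) ℝ} (hG : G.IsSymm)
    (hM : M.IsSymm) {g₀ c₀ : ℝ} (hg₀ : 0 < g₀) (hpos : ∀ w, g₀ * (w ⬝ᵥ w) ≤ w ⬝ᵥ (G *ᵥ w))
    (h : ∀ (lam : ℝ) (w : Fin b → ℝ), w ≠ 0 → M *ᵥ w = lam • (G *ᵥ w) → lam ≤ c₀)
    (w : Fin b → ℝ) : w ⬝ᵥ (M *ᵥ w) ≤ c₀ * (w ⬝ᵥ (G *ᵥ w)) := by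
  rcases eq_or_ne w 0 with rfl | hw
  · simp
  set s : Set (Fin b → ℝ) := {w | w ⬝ᵥ w = 1} with hs
  have hscale : ∀ w : Fin b → ℝ, w ≠ 0 → ∃ a : ℝ, 0 < a ∧ ∃ z ∈ s, w = a • z := by
    intro w hw
    have h1 : 0 < w ⬝ᵥ w := (dotProduct_self_nonneg w).lt_of_ne' fun h =>
      hw (dotProduct_self_eq_zero.1 h)
    refine ⟨√(w ⬝ᵥ w), Real.sqrt_pos.2 h1, (√(w ⬝ᵥ w))⁻¹ • w, ?_, ?_⟩
    · change _ ⬝ᵥ _ = (1 : ℝ)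
      rw [smul_dotProduct, dotProduct_smul, smul_eq_mul, smul_eq_mul, ← mul_assoc, ← mul_inv,
        Real.mul_self_sqrt h1.le, inv_mul_cancel₀ h1.ne']
    · rw [smul_smul, mul_inv_cancel₀ (Real.sqrt_pos.2 h1).ne', one_smul]
  have hcont : ∀ N : Matrix (Fin b) (Fin b) ℝ, Continuous fun w : Fin b → ℝ => w ⬝ᵥ (N *ᵥ w) :=
    fun N => continuous_id.dotProduct (continuous_const.matrix_mulVec continuous_id)
  have hGpos : ∀ z ∈ s, 0 < z ⬝ᵥ (G *ᵥ z) := fun z hz => by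
    have := hpos z
    rw [show z ⬝ᵥ z = 1 from hz, mul_one] at this
    linarith
  have hcomp : IsCompact s := by
    refine Metric.isCompact_of_isClosed_isBounded
      (isClosed_eq (continuous_id.dotProduct continuous_id) continuous_const) ?_
    refine (Metric.isBounded_closedBall (x := 0) (r := 1)).subset fun z hz => ?_
    rw [mem_closedBall_zero_iff, pi_norm_le_iff_of_nonneg zero_le_one]
    intro i
    have h1 : z i * z i ≤ z ⬝ᵥ z :=
      Finset.single_le_sum (f := fun i => z i * z i) (fun i _ => mul_self_nonneg _)
        (Finset.mem_univ i)
    rw [show z ⬝ᵥ z = 1 from hz] at h1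
    exact abs_le_one_iff_mul_self_le_one.2 h1
  obtain ⟨_, _, z₁, hz₁, -⟩ := hscale w hw
  obtain ⟨z, hz, hmax⟩ := hcomp.exists_isMaxOn ⟨z₁, hz₁⟩
    (f := fun z => z ⬝ᵥ (M *ᵥ z) / (z ⬝ᵥ (G *ᵥ z)))
    ((hcont M).continuousOn.div (hcont G).continuousOn fun z hz => (hGpos z hz).ne')
  set lam := z ⬝ᵥ (M *ᵥ z) / (z ⬝ᵥ (G *ᵥ z)) with hlam
  have hle : ∀ w : Fin b → ℝ, w ⬝ᵥ (M *ᵥ w) ≤ lam * (w ⬝ᵥ (G *ᵥ w)) := by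
    intro w
    rcases eq_or_ne w 0 with rfl | hw
    · simp
    obtain ⟨a, ha, y, hy, rfl⟩ := hscale w hw
    have h1 : y ⬝ᵥ (M *ᵥ y) / (y ⬝ᵥ (G *ᵥ y)) ≤ lam := hmax hy
    rw [div_le_iff₀ (hGpos y hy)] at h1
    simp only [Matrix.mulVec_smul, smul_dotProduct, dotProduct_smul, smul_eq_mul]
    nlinarith [mul_le_mul_of_nonneg_left h1 (mul_pos ha ha).le]
  -- The maximal Rayleigh quotient makes the pencil semidefinite, and the form vanishes at the
  -- maximizer z; hence z is in the kernel, a generalized eigenvector to which the hypothesis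
  -- applies.
  have hpsd : (lam • G - M).PosSemidef := by
    refine Matrix.PosSemidef.of_dotProduct_mulVec_nonneg ?_ fun w => ?_
    · rw [Matrix.IsHermitian, Matrix.conjTranspose_eq_transpose_of_trivial]
      rw [Matrix.transpose_sub, Matrix.transpose_smul, hG.eq, hM.eq]
    · rw [star_trivial, Matrix.sub_mulVec, dotProduct_sub, Matrix.smul_mulVec, dotProduct_smul,
        smul_eq_mul]
      linarith [hle w]
  have hzero : (lam • G - M) *ᵥ z = 0 := by
    rw [← hpsd.dotProduct_mulVec_zero_iff, star_trivial, Matrix.sub_mulVec, dotProduct_sub,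
      Matrix.smul_mulVec, dotProduct_smul, smul_eq_mul, hlam, div_mul_cancel₀ _ (hGpos z hz).ne',
      sub_self]
  have hz0 : z ≠ 0 := by
    rintro rfl
    have : (0 : Fin b → ℝ) ⬝ᵥ 0 = 1 := hz
    simp at this
  have hlc := h lam z hz0 (by
    rw [Matrix.sub_mulVec, sub_eq_zero, Matrix.smul_mulVec] at hzero
    exact hzero.symm)
  refine (hle w).trans (mul_le_mul_of_nonneg_right hlc ?_)
  have := hpos w
  have := mul_nonneg hg₀.le (dotProduct_self_nonneg w)
  linarith

/-- By homogeneity the speed bound for the unit vector a/‖a‖ shows that the matrix in direction a is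
at most (c₀/cmax) 𝒢 as a quadratic form. -/
theorem Coefficients.coercive {c : Coefficients P b} {g₀ Λ c₀ cmax : ℝ} (hg₀ : 0 < g₀)
    (hc₀ : 0 ≤ c₀) (hcmax : c₀ < cmax) (hc : c.Admissible g₀ Λ c₀) (K : P.elems) {a : Space d}
    (ha : ‖a‖ ≤ 1 / cmax) (w : Fin b → ℝ) :
    (1 - c₀ / cmax) * g₀ * (w ⬝ᵥ w) ≤ w ⬝ᵥ ((c.G K - c.dir K a) *ᵥ w) := by
  have hcm : 0 < cmax := hc₀.trans_lt hcmax
  have hG := hc.G_pos K w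
  have hGn : 0 ≤ w ⬝ᵥ (c.G K *ᵥ w) :=
    (mul_nonneg hg₀.le (dotProduct_self_nonneg w)).trans hG
  have h1 : w ⬝ᵥ (c.dir K a *ᵥ w) ≤ c₀ / cmax * (w ⬝ᵥ (c.G K *ᵥ w)) := by
    rcases eq_or_ne a 0 with rfl | ha0
    · have : c.dir K 0 = 0 := by simp [Coefficients.dir]
      rw [this, Matrix.zero_mulVec, dotProduct_zero]
      positivity
    have hn : ‖(‖a‖⁻¹ • a)‖ = 1 := norm_smul_inv_norm (𝕜 := ℝ) ha0
    have h2 := dotProduct_mulVec_le_of_eigenvalue_le (hc.G_symm K)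
      (Coefficients.dir_isSymm hc K (‖a‖⁻¹ • a)) hg₀ (hc.G_pos K)
      (fun lam w hw h => (le_abs_self _).trans (hc.speed K _ hn lam w hw h)) w
    have h3 : c.dir K a = ‖a‖ • c.dir K (‖a‖⁻¹ • a) := by
      simp only [Coefficients.dir, Finset.smul_sum, smul_smul, PiLp.smul_apply, smul_eq_mul]
      exact Finset.sum_congr rfl fun j _ => by
        rw [mul_inv_cancel_left₀ (norm_ne_zero_iff.2 ha0)]
    rw [h3, Matrix.smul_mulVec, dotProduct_smul, smul_eq_mul]
    calc _ ≤ ‖a‖ * (c₀ * (w ⬝ᵥ (c.G K *ᵥ w))) := mul_le_mul_of_nonneg_left h2 (norm_nonneg _)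
      _ ≤ 1 / cmax * (c₀ * (w ⬝ᵥ (c.G K *ᵥ w))) :=
        mul_le_mul_of_nonneg_right ha (mul_nonneg hc₀ hGn)
      _ = _ := by ring
  have h4 : 0 ≤ 1 - c₀ / cmax := by rw [sub_nonneg, div_le_one hcm]; exact hcmax.le
  rw [Matrix.sub_mulVec, dotProduct_sub]
  have h5 := mul_le_mul_of_nonneg_left hG h4
  linarith

theorem isUnit_det_of_coercive {W : Matrix (Fin b) (Fin b) ℝ} {μ : ℝ} (hμ : 0 < μ)
    (hW : ∀ w, μ * (w ⬝ᵥ w) ≤ w ⬝ᵥ (W *ᵥ w)) : IsUnit W.det := by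
  rw [isUnit_iff_ne_zero]
  intro h0
  obtain ⟨w, hw, h⟩ := Matrix.exists_mulVec_eq_zero_iff.2 h0
  have h1 := hW w
  rw [h, dotProduct_zero] at h1
  have h2 : 0 < w ⬝ᵥ w := (dotProduct_self_nonneg w).lt_of_ne' fun h =>
    hw (dotProduct_self_eq_zero.1 h)
  exact absurd h1 (not_le.2 (mul_pos hμ h2))

end

/-! ### The DG space as an inner product space -/

section

variable {d b p : ℕ} {P : VertexPatch d}

theorem ip_comm (u v : DGSpace P b p) : ip P b p u v = ip P b p v u :=
  massFun_comm (fun _ => Matrix.isSymm_one) u v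

theorem ip_self_nonneg (u : DGSpace P b p) : 0 ≤ ip P b p u u := by
  rw [ip_eq]
  exact Finset.sum_nonneg fun K _ => integral_nonneg fun x => dotProduct_self_nonneg _

/-- The `L²` inner product on the DG space. -/
instance DGSpace.innerCore : InnerProductSpace.Core ℝ (DGSpace P b p) where
  inner u v := ip P b p u v
  conj_inner_symm u v := ip_comm v u
  re_inner_nonneg u := ip_self_nonneg u
  add_left u v w := by simp
  smul_left u v a := by simp
  definite u hu := ip_self_eq_zero u hu

instance : NormedAddCommGroup (DGSpace P b p) := DGSpace.innerCore.toNormedAddCommGroup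

instance : InnerProductSpace ℝ (DGSpace P b p) := InnerProductSpace.ofCore DGSpace.innerCore.toCore

theorem inner_eq_ip (u v : DGSpace P b p) : inner ℝ u v = ip P b p u v := rfl

theorem norm_sq_eq_ip (u : DGSpace P b p) : ‖u‖ ^ 2 = ip P b p u u := by
  rw [← real_inner_self_eq_norm_sq, inner_eq_ip]

theorem norm_le_of_ip_le {u v : DGSpace P b p} {C K : ℝ} (h : ip P b p u u ≤ C * ip P b p v v)
    (hCK : C ≤ K) (hK : 1 ≤ K) : ‖u‖ ≤ K * ‖v‖ := by
  rw [← norm_sq_eq_ip, ← norm_sq_eq_ip] at h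
  refine le_of_sq_le_sq ?_ (by positivity)
  rw [mul_pow]
  refine h.trans (mul_le_mul_of_nonneg_right ?_ (sq_nonneg _))
  nlinarith

end

/-! ### Verification of the abstract hypotheses for the scaled DG operators -/

section

variable {d b p : ℕ} {P : VertexPatch d}

theorem mulOp_sub (W W' : P.elems → Matrix (Fin b) (Fin b) ℝ) :
    (mulOp (W - W') : Module.End ℝ (DGSpace P b p)) = mulOp W - mulOp W' :=
  LinearMap.ext fun u => eq_of_ip_eq fun v => by
    rw [LinearMap.sub_apply, (ip P b p).map_sub, LinearMap.sub_apply, ip_eq, ip_eq, ip_eq,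
      ← Finset.sum_sub_distrib]
    refine Finset.sum_congr rfl fun K _ => ?_
    rw [← integral_sub]
    · simp only [val_mulOp, Pi.sub_apply, Matrix.sub_mulVec, sub_dotProduct]
    all_goals exact ((continuous_val _ K).dotProduct
      (continuous_val _ K)).continuousOn.integrableOn_compact (isCompact_hull _)

theorem mulOp_smul (a : ℝ) (W : P.elems → Matrix (Fin b) (Fin b) ℝ) :
    (mulOp (a • W) : Module.End ℝ (DGSpace P b p)) = a • mulOp W :=
  LinearMap.ext fun u => eq_of_ip_eq fun v => by
    rw [LinearMap.smul_apply, (ip P b p).map_smul, LinearMap.smul_apply, ip_eq, ip_eq,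
      Finset.smul_sum]
    refine Finset.sum_congr rfl fun K _ => ?_
    rw [← integral_smul]
    simp only [val_mulOp, Pi.smul_apply, Matrix.smul_mulVec, smul_dotProduct]

theorem Coefficients.dir_add_smul (c : Coefficients P b) (K : P.elems) (m n : Space d) (a : ℝ) :
    c.dir K (m + a • n) = c.dir K m + a • c.dir K n := by
  simp only [Coefficients.dir, PiLp.add_apply, PiLp.smul_apply, smul_eq_mul, add_smul,
    Finset.sum_add_distrib, Finset.smul_sum, mul_smul]

/-- The mass operator `M₀ - θ M₁` at pseudotime `θ` is multiplication by a matrix. -/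
theorem massOperator_eq (c : Coefficients P b) (t : Tent P) (θ : ℝ) :
    M₀ p c t - θ • M₁ p c t =
      mulOp fun K => c.G K - c.dir K (t.bot.grad K + θ • t.gradδ K) := by
  rw [M₀, M₁, operatorOf_massForm, operatorOf_massForm, ← mulOp_smul, ← mulOp_sub]
  congr 1
  funext K
  simp only [Pi.sub_apply, Pi.smul_apply, Coefficients.dir_add_smul]
  abel

theorem Tent.norm_grad_le {t : Tent P} {cmax : ℝ} (ht : t.Causal cmax) (K : P.elems) {θ : ℝ}
    (h0 : 0 ≤ θ) (h1 : θ ≤ 1) : ‖t.bot.grad K + θ • t.gradδ K‖ ≤ 1 / cmax := by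
  have e : t.bot.grad K + θ • t.gradδ K = (1 - θ) • t.bot.grad K + θ • t.top.grad K := by
    rw [Tent.gradδ]; module
  rw [e]
  refine (norm_add_le _ _).trans ?_
  rw [norm_smul, norm_smul, Real.norm_of_nonneg h0, Real.norm_of_nonneg (sub_nonneg.2 h1)]
  have h2 := mul_le_mul_of_nonneg_left (ht K).1.le (sub_nonneg.2 h1)
  have h3 := mul_le_mul_of_nonneg_left (ht K).2.le h0
  linarith

/-- The deviation of the DG operator from `transport - M₁`. -/
theorem ip_jumpOp (hd : 1 ≤ d) (hp : 0 < p) {c : Coefficients P b} {g₀ Λ c₀ : ℝ}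
    (hc : c.Admissible g₀ Λ c₀) (t : Tent P) {ν : P.facets → Space d} (hν : IsNormalField P ν)
    (S : Matrix (Fin b) (Fin b) ℝ) (u v : DGSpace P b p) :
    ip P b p (transport hp c t u - M₁ p c t u - A p c t ν S u) v = jumpFun c t ν S u v := by
  have h := dgFun_eq hd hp hc t hν S u v
  have h1 : ip P b p (M₁ p c t u) v = massFun (fun K => c.dir K (t.gradδ K)) u v :=
    ip_operatorOf _ _ _
  have h2 : ip P b p (A p c t ν S u) v = dgFun c t ν S u v := ip_operatorOf _ _ _
  rw [(ip P b p).map_sub, (ip P b p).map_sub, LinearMap.sub_apply, LinearMap.sub_apply, h1, h2]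
  linarith

theorem massFun_coercive {W : P.elems → Matrix (Fin b) (Fin b) ℝ} {μ : ℝ}
    (hW : ∀ K w, μ * (w ⬝ᵥ w) ≤ w ⬝ᵥ (W K *ᵥ w)) (u : DGSpace P b p) :
    μ * ip P b p u u ≤ massFun W u u := by
  rw [ip_eq, massFun, Finset.mul_sum]
  refine Finset.sum_le_sum fun K _ => ?_
  rw [← integral_const_mul]
  refine setIntegral_mono_on ?_ (integrableOn_mass W u u K)
    (isCompact_hull K.1).isClosed.measurableSet fun x _ => ?_
  · exact (continuous_const.mul ((continuous_val u K).dotProduct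
      (continuous_val u K))).continuousOn.integrableOn_compact (isCompact_hull _)
  · rw [dotProduct_comm (W K *ᵥ _)]
    exact hW K _

theorem ip_smul_smul (a : ℝ) (u : DGSpace P b p) :
    ip P b p (a • u) (a • u) = a ^ 2 * ip P b p u u := by
  rw [(ip P b p).map_smul, LinearMap.smul_apply, LinearMap.map_smul, smul_eq_mul, smul_eq_mul]
  ring

/-- The operators of the SAT-DG method, scaled by the inverse of the height of the tent, satisfy
the assumptions of the abstract stability estimate. -/
theorem exists_stepData (d b p : ℕ) (hd : 1 ≤ d) (hp : 0 < p) (S : Matrix (Fin b) (Fin b) ℝ)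
    (hS : S.PosDef) (γ g₀ Λ c₀ cmax : ℝ) (hγ : 0 < γ) (hg₀ : 0 < g₀) (hc₀ : 0 ≤ c₀)
    (hcmax : c₀ < cmax) : ∃ k : ℝ, 0 < k ∧
    ∀ (P : VertexPatch d) (c : Coefficients P b) (t : Tent P) (ν : P.facets → Space d) (κ : ℝ),
      0 < κ → c.Admissible g₀ Λ c₀ → t.Causal cmax → IsNormalField P ν → t.HeightBound γ κ →
      ∀ θ : ℝ, 0 ≤ θ → θ ≤ κ →
        StepData (M₀ p c t - θ • κ⁻¹ • M₁ p c t) (κ⁻¹ • M₁ p c t) (κ⁻¹ • A p c t ν S)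
          (κ⁻¹ • transport hp c t) (κ⁻¹ • dissForm t ν S) ((1 - c₀ / cmax) * g₀) k p := by
  obtain ⟨CN, hCN, HN⟩ := exists_transport_bound d b p γ Λ
  obtain ⟨CD, hCD, HD⟩ := exists_dissFun_bound d b p hd γ hγ S
  obtain ⟨CJ, hCJ, HJ⟩ := exists_jumpFun_bound d b p hd γ hγ Λ S hS
  have hcm : 0 < cmax := hc₀.trans_lt hcmax
  set β : ℝ := |Λ| + d * |Λ| * (1 / cmax) with hβ
  set C₀ : ℝ := (b * β) ^ 2 with hC₀
  set C₁ : ℝ := (b * (d * |Λ|)) ^ 2 with hC₁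
  set k₀ : ℝ := 1 + C₀ + C₁ + CN + CJ + CJ * CD with hk₀
  have h₀ : 0 ≤ C₀ := sq_nonneg _
  have h₁ : 0 ≤ C₁ := sq_nonneg _
  have hJD : 0 < CJ * CD := mul_pos hCJ hCD
  -- A is a combination of the three operators N, M₁ and J, each bounded by k₀ after scaling.
  refine ⟨3 * k₀, by positivity, ?_⟩
  intro P c t ν κ hκ hc ht hν hH θ hθ0 hθκ
  have hk1 : 1 ≤ k₀ := by linarith
  have hμ : 0 < (1 - c₀ / cmax) * g₀ :=
    mul_pos (by rw [sub_pos, div_lt_one hcm]; exact hcmax) hg₀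
  have hθ' : 0 ≤ θ * κ⁻¹ := by positivity
  have hθ1 : θ * κ⁻¹ ≤ 1 := by rw [← div_eq_mul_inv]; exact (div_le_one hκ).2 hθκ
  have hMθ : M₀ p c t - θ • κ⁻¹ • M₁ p c t =
      mulOp fun K => c.G K - c.dir K (t.bot.grad K + (θ * κ⁻¹) • t.gradδ K) := by
    rw [smul_smul, massOperator_eq]
  set W : P.elems → Matrix (Fin b) (Fin b) ℝ := fun K =>
    c.G K - c.dir K (t.bot.grad K + (θ * κ⁻¹) • t.gradδ K) with hW
  have hgrad : ∀ K, ‖t.bot.grad K + (θ * κ⁻¹) • t.gradδ K‖ ≤ 1 / cmax := fun K =>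
    Tent.norm_grad_le ht K hθ' hθ1
  have hWsymm : ∀ K, (W K).IsSymm := fun K => (hc.G_symm K).sub (Coefficients.dir_isSymm hc K _)
  have hWco : ∀ K w, (1 - c₀ / cmax) * g₀ * (w ⬝ᵥ w) ≤ w ⬝ᵥ (W K *ᵥ w) := fun K w =>
    Coefficients.coercive hg₀ hc₀ hcmax hc K (hgrad K) w
  have hM₁ : M₁ p c t = mulOp fun K => c.dir K (t.gradδ K) := operatorOf_massForm _
  have hW₁symm : ∀ K, (c.dir K (t.gradδ K)).IsSymm := fun K => Coefficients.dir_isSymm hc K _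
  have hsymm : ∀ (V : P.elems → Matrix (Fin b) (Fin b) ℝ), (∀ K, (V K).IsSymm) →
      ∀ u v : DGSpace P b p, ip P b p (mulOp V u) v = ip P b p u (mulOp V v) := fun V hV u v => by
    rw [ip_mulOp, massFun_comm hV, ← ip_mulOp, ip_comm]
  have hbW : ∀ v : DGSpace P b p, ‖mulOp W v‖ ≤ k₀ * ‖v‖ := fun v =>
    norm_le_of_ip_le (C := C₀) (ip_self_mulOp_le (fun K i j => by
      change |c.G K i j - c.dir K _ i j| ≤ β
      refine (abs_sub _ _).trans (add_le_add ((hc.G_bound K i j).trans (le_abs_self _)) ?_)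
      exact (Coefficients.abs_dir_le hc K _ i j).trans
        (mul_le_mul_of_nonneg_left (hgrad K) (by positivity))) v) (by linarith) hk1
  have hscale : ∀ (u v : DGSpace P b p) (C : ℝ), ip P b p u u ≤ C * κ ^ 2 * ip P b p v v →
      C ≤ k₀ → ‖κ⁻¹ • u‖ ≤ k₀ * ‖v‖ := fun u v C h hC => by
    refine norm_le_of_ip_le (C := C) ?_ hC hk1
    rw [ip_smul_smul, inv_pow, inv_mul_le_iff₀ (by positivity)]
    linarith
  have hb₁ : ∀ v : DGSpace P b p, ‖κ⁻¹ • M₁ p c t v‖ ≤ k₀ * ‖v‖ := fun v => by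
    refine hscale _ v C₁ ?_ (by linarith)
    rw [hM₁]
    refine (ip_self_mulOp_le (β := d * |Λ| * κ) (fun K i j => ?_) v).trans (le_of_eq ?_)
    · obtain ⟨x₀, ρ, hB, hδ⟩ := hH K
      exact (Coefficients.abs_dir_le hc K _ i j).trans
        (mul_le_mul_of_nonneg_left (hB.norm_gradδ_le t hδ) (by positivity))
    · rw [hC₁]; ring
  have hbN : ∀ v : DGSpace P b p, ‖κ⁻¹ • transport hp c t v‖ ≤ k₀ * ‖v‖ := fun v =>
    hscale _ v CN (HN P hp c g₀ c₀ hc t κ hH v) (by linarith)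
  set J : DGSpace P b p → DGSpace P b p := fun u =>
    transport hp c t u - M₁ p c t u - A p c t ν S u with hJ
  -- J u represents the jump form, so testing with v = J u gives twice its squared norm on the left,
  -- one copy of which absorbs the last term of the bound.
  have hJD' : ∀ u, ip P b p (J u) (J u) ≤ CJ * κ * dissFun t ν S u u := fun u => by
    have h1 := HJ P c g₀ c₀ t ν κ hκ hc hν hH u (J u)
    rw [← ip_jumpOp hd hp hc t hν S u (J u)] at h1
    change 2 * ip P b p (J u) (J u) ≤ _ at h1
    linarith
  have hbJ : ∀ v : DGSpace P b p, ‖κ⁻¹ • J v‖ ≤ k₀ * ‖v‖ := fun v => by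
    refine hscale _ v (CJ * CD) ((hJD' v).trans ?_) (by linarith)
    have := mul_le_mul_of_nonneg_left (HD P t ν κ hκ.le hν hH v) (mul_pos hCJ hκ).le
    refine this.trans (le_of_eq (by ring))
  have hle : ∀ v : DGSpace P b p, k₀ * ‖v‖ ≤ 3 * k₀ * ‖v‖ := fun v => by
    nlinarith [norm_nonneg v]
  have hD0 : ∀ u : DGSpace P b p, 0 ≤ κ⁻¹ * dissFun t ν S u u := fun u =>
    mul_nonneg (by positivity) (dissForm_nonneg t ν hS u)
  rw [hMθ]
  refine
    { symm := hsymm W hWsymm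
      coercive := fun v => ?_
      bound := fun v => (hbW v).trans (hle v)
      bound_M₁ := fun v => (hb₁ v).trans (hle v)
      bound_A := fun v => ?_
      bound_N := fun v => (hbN v).trans (hle v)
      symm_M₁ := fun u v => ?_
      nonneg := fun u => hD0 u
      energy := fun u => ?_
      jump := fun u => ?_
      nilpotent := fun y hy => ?_ }
  · rw [norm_sq_eq_ip, inner_eq_ip, ip_mulOp]
    exact massFun_coercive hWco v
  · have e : (κ⁻¹ • A p c t ν S) v =
        κ⁻¹ • transport hp c t v - κ⁻¹ • M₁ p c t v - κ⁻¹ • J v := by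
      simp only [hJ, LinearMap.smul_apply]; module
    rw [e]
    have h1 := norm_sub_le (κ⁻¹ • transport hp c t v - κ⁻¹ • M₁ p c t v) (κ⁻¹ • J v)
    have h2 := norm_sub_le (κ⁻¹ • transport hp c t v) (κ⁻¹ • M₁ p c t v)
    linarith [hbN v, hb₁ v, hbJ v]
  · rw [LinearMap.smul_apply, LinearMap.smul_apply, real_inner_smul_left, real_inner_smul_right,
      inner_eq_ip, inner_eq_ip, hM₁, hsymm _ hW₁symm]
  · have h1 := dgFun_energy hd hp hc t hν S u
    have h2 : ip P b p (A p c t ν S u) u = dgFun c t ν S u u := ip_operatorOf _ _ _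
    have h3 : ip P b p (M₁ p c t u) u = massFun (fun K => c.dir K (t.gradδ K)) u u :=
      ip_operatorOf _ _ _
    rw [← h2, ← h3] at h1
    rw [LinearMap.smul_apply, LinearMap.smul_apply, real_inner_smul_left, real_inner_smul_left,
      inner_eq_ip, inner_eq_ip]
    change _ = -2 * (κ⁻¹ * dissFun t ν S u u)
    linear_combination κ⁻¹ * h1
  · have e : (κ⁻¹ • transport hp c t) u - (κ⁻¹ • M₁ p c t) u - (κ⁻¹ • A p c t ν S) u =
        κ⁻¹ • J u := by
      simp only [hJ, LinearMap.smul_apply]; module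
    rw [e, norm_sq_eq_ip, ip_smul_smul]
    have h1 := mul_le_mul_of_nonneg_left (hJD' u) (sq_nonneg κ⁻¹)
    have h2 : κ⁻¹ ^ 2 * (CJ * κ * dissFun t ν S u u) = CJ * (κ⁻¹ * dissFun t ν S u u) := by
      field_simp
    change _ ≤ 3 * k₀ * (κ⁻¹ * dissFun t ν S u u)
    have h3 := mul_le_mul_of_nonneg_right (show CJ ≤ 3 * k₀ by linarith) (hD0 u)
    linarith
  -- Multiplying the k-th iterate by κᵏ undoes the division of the operators by κ.
  · have hz := recursion_terminates hp c t W (fun K => isUnit_det_of_coercive hμ (hWco K))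
      (fun k => κ ^ k • y k) fun k => by
        rw [map_smul, hy, ← hM₁]
        simp only [LinearMap.smul_apply, map_smul]
        have e : κ ^ (k + 1) * κ⁻¹ = κ ^ k := by
          rw [pow_succ, mul_assoc, mul_inv_cancel₀ hκ.ne', mul_one]
        rw [smul_add, smul_smul, e, smul_comm (κ ^ (k + 1)), smul_smul (κ ^ (k + 1)), e]
    exact (smul_eq_zero.1 hz).resolve_left (pow_ne_zero _ hκ.ne')

end

/-! ### From the tent geometry to the stability bound -/

section

variable {d b p : ℕ} {P : VertexPatch d}

theorem VertexPatch.nonempty_elems (P : VertexPatch d) : Nonempty P.elems := by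
  obtain ⟨K, hK, -⟩ := Set.mem_iUnion₂.1 (interior_subset P.vertex_interior)
  exact ⟨⟨K, VertexPatch.mem_elems.2 hK⟩⟩

theorem exists_elementBall {γ : ℝ} (h : ShapeRegular P.mesh γ) (K : P.elems) :
    ∃ (x₀ : Space d) (ρ : ℝ), ElementBall K (max γ 1) x₀ ρ := by
  obtain ⟨x₀, ρ, hρ, h1, h2⟩ := h K.1 (VertexPatch.mem_elems.1 K.2).1
  exact ⟨x₀, ρ, hρ, h1, h2.trans (mul_le_mul_of_nonneg_right (le_max_left _ _) hρ.le)⟩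

theorem ElementBall.le_diam (hd : 1 ≤ d) {K : P.elems} {γ : ℝ} {x₀ : Space d} {ρ : ℝ}
    (hB : ElementBall K γ x₀ ρ) : ρ ≤ Metric.diam (hull K.1) := by
  have hn : ‖EuclideanSpace.single (⟨0, hd⟩ : Fin d) (1 : ℝ)‖ = 1 := by simp
  have := Metric.dist_le_diam_of_mem (isCompact_hull K.1).isBounded (hB.add_smul_mem hn)
    hB.center_mem
  rwa [dist_self_add_left, norm_smul, hn, mul_one, Real.norm_of_nonneg hB.pos.le] at this

/-- By causality the gradient of δ is at most 2/cmax, and δ vanishes at another vertex of the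
element, at distance at most γ ρ. -/
theorem Tent.δ_vertex_le (hd : 1 ≤ d) {t : Tent P} {cmax : ℝ} (ht : t.Causal cmax) (hcm : 0 < cmax)
    {K : P.elems} {γ : ℝ} {x₀ : Space d} {ρ : ℝ} (hB : ElementBall K γ x₀ ρ) :
    t.δ P.vertex ≤ 2 * γ / cmax * ρ := by
  obtain ⟨w, hw, hwv⟩ : ∃ w ∈ K.1, w ≠ P.vertex :=
    Finset.exists_mem_ne (by rw [card_elem]; omega) _
  have hwK : w ∈ hull K.1 := subset_convexHull ℝ _ hw
  have h1 : t.δ w = 0 := by rw [Tent.δ, t.eq_off_pole K.1 K.2 w hw hwv, sub_self]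
  rw [t.δ_eq_peval K hwK, t.peval_δpoly] at h1
  have h2 := (abs_le.1 (abs_real_inner_le_norm (t.gradδ K) (w - P.vertex))).1
  have h3 : ‖w - P.vertex‖ ≤ γ * ρ := by
    rw [← dist_eq_norm]
    exact hB.dist_le hwK (subset_convexHull ℝ _ mem_apex)
  have h4 : ‖t.gradδ K‖ ≤ 2 / cmax := by
    refine (norm_sub_le _ _).trans ?_
    have := ht K
    have e : 2 / cmax = 1 / cmax + 1 / cmax := by ring
    linarith
  have h5 : ‖t.gradδ K‖ * ‖w - P.vertex‖ ≤ 2 / cmax * (γ * ρ) :=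
    mul_le_mul h4 h3 (norm_nonneg _) (by positivity)
  have e : 2 / cmax * (γ * ρ) = 2 * γ / cmax * ρ := by ring
  linarith

theorem TentProblem.Admissible.h_pos (hd : 1 ≤ d) {Q : TentProblem d b} {γ g₀ Λ c₀ cmax : ℝ}
    (hQ : Q.Admissible γ g₀ Λ c₀ cmax) : 0 < Q.h := by
  obtain ⟨K⟩ := Q.patch.nonempty_elems
  obtain ⟨x₀, ρ, hB⟩ := exists_elementBall hQ.shapeRegular K
  exact (hB.pos.trans_le (hB.le_diam hd)).trans_le
    (hQ.meshSize.2 ⟨K.1, (VertexPatch.mem_elems.1 K.2).1, rfl⟩)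

/-- Weak stability, if the time step is small relative to a bound `κ` for the height of the tent
in units of the radii of the elements. -/
theorem exists_weakStabilityBound (d b s p : ℕ) (hd : 1 ≤ d) (hp : 0 < p) (hps : p < s)
    (S : Matrix (Fin b) (Fin b) ℝ) (hS : S.PosDef) (γ g₀ Λ c₀ cmax κ₀ : ℝ) (hg₀ : 0 < g₀)
    (hc₀ : 0 ≤ c₀) (hcmax : c₀ < cmax) (hκ₀ : 0 < κ₀) :
    ∃ c : ℝ, 0 < c ∧ ∃ C : ℝ, 0 < C ∧
      ∀ Q : TentProblem d b, Q.Admissible γ g₀ Λ c₀ cmax →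
        ∀ (r : ℕ) (κ : ℝ), 1 ≤ r → 0 < κ → κ ≤ κ₀ → Q.tent.HeightBound (max γ 1) κ →
          κ / r ≤ c * Q.h ^ (1 / (2 * (s : ℝ) - 2 * (p : ℝ))) →
          Q.WeakStabilityBound S p s r C := by
  have hcm : 0 < cmax := hc₀.trans_lt hcmax
  have hμ : 0 < (1 - c₀ / cmax) * g₀ :=
    mul_pos (by rw [sub_pos, div_lt_one hcm]; exact hcmax) hg₀
  obtain ⟨k, hk, hstep⟩ := exists_stepData d b p hd hp S hS (max γ 1) g₀ Λ c₀ cmax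
    (lt_max_of_lt_right one_pos) hg₀ hc₀ hcmax
  obtain ⟨c, hc, C, hC, H⟩ := propagator_estimate s p hps _ k κ₀ hμ hk hκ₀
  refine ⟨c, hc, C, hC, ?_⟩
  intro Q hQ r κ hr hκ hκκ₀ hH hκr v
  have hh := hQ.h_pos hd
  have h1 := H (DGSpace Q.patch b p) (M₀ p Q.coeff Q.tent) (κ⁻¹ • M₁ p Q.coeff Q.tent)
    (κ⁻¹ • A p Q.coeff Q.tent Q.normal S) (κ⁻¹ • transport hp Q.coeff Q.tent)
    (κ⁻¹ • dissForm Q.tent Q.normal S) κ Q.h r hκ hκκ₀ hh hr hκr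
    (hstep Q.patch Q.coeff Q.tent Q.normal κ hκ hQ.coeff hQ.causal hQ.normal hH) v
  -- r steps of size κ/r with the scaled operators are the original r steps of size 1/r.
  have e := satSteps_smul s (1 / (r : ℝ)) κ (M₀ p Q.coeff Q.tent) (κ⁻¹ • M₁ p Q.coeff Q.tent)
    (κ⁻¹ • A p Q.coeff Q.tent Q.normal S) r
  rw [smul_inv_smul₀ hκ.ne', smul_inv_smul₀ hκ.ne', mul_one_div] at e
  rw [← e, smul_inv_smul₀ hκ.ne'] at h1
  have h2 : 0 ≤ 1 + C * Q.h := by positivity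
  rw [normWith, normWith, satPropagator, ← Real.sqrt_sq h2, ← Real.sqrt_mul (sq_nonneg _)]
  exact Real.sqrt_le_sqrt h1

end

end TentDG

end

theorem mainTheorem6 (d b s p : ℕ) (hd : 1 ≤ d) (hp : 0 < p)
    (hps : (p : ℝ) ≤ ((s : ℝ) - 1) / 2)
    (S : Matrix (Fin b) (Fin b) ℝ) (hS : S.PosDef)
    (γ g₀ Λ c₀ cmax : ℝ) (hg₀ : 0 < g₀) (hc₀ : 0 ≤ c₀) (hcmax : c₀ < cmax) :
    (∃ c : ℝ, 0 < c ∧ ∃ C : ℝ, 0 < C ∧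
      ∀ Q : TentDG.TentProblem d b, Q.Admissible γ g₀ Λ c₀ cmax →
        ∀ r : ℕ, 1 ≤ r →
          1 / (r : ℝ) ≤ c * Q.h ^ (1 / (2 * (s : ℝ) - 2 * (p : ℝ))) →
          Q.WeakStabilityBound S p s r C) ∧
    (∀ θ : ℝ, 0 < θ → ∃ c : ℝ, 0 < c ∧ ∃ C : ℝ, 0 < C ∧
      ∀ Q : TentDG.TentProblem d b, Q.Admissible γ g₀ Λ c₀ cmax →
        (∀ K ∈ Q.patch.elems, θ * Q.h ≤ Metric.diam (TentDG.hull K)) →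
        ∀ r : ℕ, 1 ≤ r →
          (∀ x ∈ Q.patch.carrier,
            1 / (r : ℝ) * Q.tent.δ x ≤ c * Q.h ^ (1 + 1 / (2 * (s : ℝ) - 2 * (p : ℝ)))) →
          Q.WeakStabilityBound S p s r C) := by
  have hps' : p < s := by
    have h1 : (0 : ℝ) < p := by exact_mod_cast hp
    have h2 : (p : ℝ) < s := by linarith
    exact_mod_cast h2
  have hcm : 0 < cmax := hc₀.trans_lt hcmax
  set γ' : ℝ := max γ 1 with hγ'
  have hγ0 : 0 < γ' := lt_max_of_lt_right one_pos
  set κ₀ : ℝ := 2 * γ' / cmax with hκ₀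
  have hκ0 : 0 < κ₀ := by positivity
  obtain ⟨c, hc, C, hC, H⟩ := TentDG.exists_weakStabilityBound d b s p hd hp hps' S hS γ g₀ Λ c₀
    cmax κ₀ hg₀ hc₀ hcmax hκ0
  refine ⟨⟨c / κ₀, by positivity, C, hC, fun Q hQ r hr hτ => ?_⟩,
    fun θ hθ => ⟨c * θ / γ', by positivity, C, hC, fun Q hQ hquasi r hr hτ => ?_⟩⟩
  -- Here κ is the worst ratio of height to inradius that causality allows.
  · refine H Q hQ r κ₀ hr hκ0 le_rfl (fun K => ?_) ?_
    · obtain ⟨x₀, ρ, hB⟩ := TentDG.exists_elementBall hQ.shapeRegular K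
      exact ⟨x₀, ρ, hB, TentDG.Tent.δ_vertex_le hd hQ.causal hcm hB⟩
    · calc κ₀ / r = κ₀ * (1 / r) := by ring
        _ ≤ κ₀ * (c / κ₀ * Q.h ^ (1 / (2 * (s : ℝ) - 2 * (p : ℝ)))) :=
          mul_le_mul_of_nonneg_left hτ hκ0.le
        _ = _ := by field_simp
  · have hh := hQ.h_pos hd
    have hr0 : (0 : ℝ) < r := by exact_mod_cast hr
    set a : ℝ := Q.h ^ (1 / (2 * (s : ℝ) - 2 * (p : ℝ))) with ha
    have ha0 : 0 < a := Real.rpow_pos_of_pos hh _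
    -- The largest κ admitted by the abstract CFL condition, capped by κ₀. It bounds the height of
    -- the tent because quasi-uniformity turns the mesh size h into an inradius, θ h ≤ γ' ρ.
    refine H Q hQ r (min κ₀ (c * r * a)) hr (by positivity) (min_le_left _ _) (fun K => ?_) ?_
    · obtain ⟨x₀, ρ, hB⟩ := TentDG.exists_elementBall hQ.shapeRegular K
      refine ⟨x₀, ρ, hB, ?_⟩
      rw [min_mul_of_nonneg _ _ hB.pos.le]
      refine le_min (TentDG.Tent.δ_vertex_le hd hQ.causal hcm hB) ?_
      -- The restriction on the physical time step is needed only at the central vertex, where δ is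
      -- maximal.
      have h1 := hτ Q.patch.vertex (Set.mem_iUnion₂.2
        ⟨K.1, K.2, subset_convexHull ℝ _ TentDG.mem_apex⟩)
      rw [Real.rpow_add hh, Real.rpow_one, ← ha, one_div_mul_eq_div, div_le_iff₀ hr0] at h1
      have h2 : θ * Q.h ≤ γ' * ρ := (hquasi K.1 K.2).trans hB.diam_le
      calc Q.tent.δ Q.patch.vertex ≤ c * θ / γ' * (Q.h * a) * r := h1
        _ = c * r * a / γ' * (θ * Q.h) := by ring
        _ ≤ c * r * a / γ' * (γ' * ρ) := mul_le_mul_of_nonneg_left h2 (by positivity)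
        _ = c * r * a * ρ := by field_simp
    · calc min κ₀ (c * r * a) / r ≤ c * r * a / r :=
            div_le_div_of_nonneg_right (min_le_right _ _) hr0.le
        _ = c * a := by field_simp
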